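/- Let $k$ be a field, $H$ a Hopf algebra over $k$ and $B$ a unital associative $k$-algebra. Let $B$ be a $\sigma$-twisted left $H$-module: there is a linear map $\cdot:H\otimes B\to B$ with $h\cdot 1=\epsilon(h)1$ and $h\cdot(bb')=(h_1\cdot b)(h_2\cdot b')$, and a convolution invertible linear map $\sigma:H\otimes H\to B$ with $$\sigma(h\otimes 1)=\epsilon(h)1=\sigma(1\otimes h),\qquad (h_1\cdot\sigma(h'_1\otimes h''_1))\,\sigma(h_2\otimes h'_2h''_2)=\sigma(h_1\otimes h'_1)\,\sigma(h_2h'_2\otimes h''),$$ $$1\cdot b=b,\qquad h\cdot(h'\cdot b)=\sigma(h_1\otimes h'_1)\,((h_2h'_2)\cdot b)\,\sigma^{-1}(h_3\otimes h'_3).$$ The crossed product algebra $B\sharp_\sigma H$ is $B\otimes H$ with unit $1\otimes 1$, product $(b\otimes h)(b'\otimes h')=b(h_1\cdot b')\sigma(h_2\otimes h'_1)\otimes h_3h'_2$, and right $H$-coaction $\mathrm{id}\otimes\Delta$. A differential calculus on an algebra $A$ is a differential $\mathbb N_0$-graded algebra $(\Omega^\bullet(A),\wedge,d)$ with $\Omega^0(A)=A$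 and $\Omega^n(A)=\mathrm{span}\{a^0da^1\wedge\cdots\wedge da^n\}$. Let $\Omega^\bullet(B)$ be a $\sigma$-twisted $H$-module differential calculus on $B$, i.e. a differential calculus with linear maps $\cdot:H\otimes\Omega^n(B)\to\Omega^n(B)$, extending the given one for $n=0$, such that $h\cdot(b^0db^1\wedge\cdots\wedge db^n)=(h_1\cdot b^0)(h_2\cdot db^1)\wedge\cdots\wedge(h_{n+1}\cdot db^n)$, $h\cdot db=d(h\cdot b)$ and $d\circ\sigma=0$. Let $\Omega^\bullet(H)$ be a bicovariant differential calculus on $H$, with left coaction $\eta\mapsto\eta_{-1}\otimes\eta_0$, which is complete, i.e. $\Delta:H\to H\otimes H$ extends to a morphism $\Omega^\bullet(H)\to\Omega^\bullet(H)\otimes\Omega^\bullet(H)$ of differential graded algebras (tensor products of differential graded algebras carry the usual Koszul signs). Put $\Omega^n(B\sharp_\sigma H)=\bigoplus_{i=0}^n\Omega^{n-i}(B)\otimes\Omega^i(H)$, with $$(\omega\otimes\eta)\wedge(\omega'\otimes\eta')=(-1)^{|\eta||\omega'|}\,\omega\wedge(\eta_{-2}\cdot\omega')\,\sigma(\eta_{-1}\otimes\eta'_{-1})\otimes\eta_0\wedge\eta'_0,\qquad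 d(\omega\otimes\eta)=d\omega\otimes\eta+(-1)^{|\omega|}\omega\otimes d\eta .$$ Then $\Omega^\bullet(B\sharp_\sigma H)$ is a differential calculus on $B\sharp_\sigma H$, and it is complete: the coaction $\mathrm{id}\otimes\Delta$ extends to a morphism of differential graded algebras $\Delta^\wedge:\Omega^\bullet(B\sharp_\sigma H)\to\Omega^\bullet(B\sharp_\sigma H)\otimes\Omega^\bullet(H)$. For every such extension, the base space forms are $$\{x\in\Omega^\bullet(B\sharp_\sigma H):\Delta^\wedge(x)=x\otimes 1\}=\Omega^\bullet(B)\otimes 1,$$ in each degree $n$ they are $\Omega^n(B)\otimes 1$, and $\omega\mapsto\omega\otimes 1$ is an injective morphism of differential graded algebras extending $b\mapsto b\otimes 1$, so that the base space forms are isomorphic to $\Omega^\bullet(B)$ as a differential graded algebra. -/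

import Mathlib

open scoped TensorProduct

noncomputable section

namespace CrossedCalculus

/-! ### Algebras and differential graded algebras

The multiplication is recorded as a bilinear map, so that the structures on the tensor products
below can be written down first; being an algebra or a differential graded algebra is a predicate. -/

section DGA

variable {k : Type*} [Field k]

/-- A bilinear product and a distinguished element on a vector space. -/
structure AlgData (k : Type*) [Field k] (A : Type*) [AddCommGroup A] [Module k A] where
  mul : A →ₗ[k] A →ₗ[k] A
  one : A

/-- The product and the unit of a `k`-algebra. -/
def AlgData.of (k : Type*) [Field k] (A : Type*) [Ring A] [Algebra k A] : AlgData k A where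
  mul := LinearMap.mul k A
  one := 1

/-- The data `(Ω, ∧, 1, (Ωⁿ)ₙ, d)` of a differential graded algebra. -/
structure DGData (k : Type*) [Field k] (V : Type*) [AddCommGroup V] [Module k V]
    extends AlgData k V where
  deg : ℕ → Submodule k V
  d : V →ₗ[k] V

variable {A : Type*} [AddCommGroup A] [Module k A]
variable {V : Type*} [AddCommGroup V] [Module k V]
variable {W : Type*} [AddCommGroup W] [Module k W]

/-- Differential `ℕ`-graded algebras. -/
structure DGData.IsDGA (D : DGData k V) : Prop where
  mul_assoc : ∀ x y z, D.mul (D.mul x y) z = D.mul x (D.mul y z)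
  one_mul : ∀ x, D.mul D.one x = x
  mul_one : ∀ x, D.mul x D.one = x
  internal : DirectSum.IsInternal D.deg
  one_mem : D.one ∈ D.deg 0
  mul_mem : ∀ m n x y, x ∈ D.deg m → y ∈ D.deg n → D.mul x y ∈ D.deg (m + n)
  d_mem : ∀ n x, x ∈ D.deg n → D.d x ∈ D.deg (n + 1)
  d_d : ∀ x, D.d (D.d x) = 0
  leibniz : ∀ n x y, x ∈ D.deg n →
    D.d (D.mul x y) = D.mul (D.d x) y + (-1 : k) ^ n • D.mul x (D.d y)

/-- Morphisms of differential graded algebras. -/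
structure IsDGHom (D : DGData k V) (E : DGData k W) (f : V →ₗ[k] W) : Prop where
  map_one : f D.one = E.one
  map_mul : ∀ x y, f (D.mul x y) = E.mul (f x) (f y)
  map_deg : ∀ n x, x ∈ D.deg n → f x ∈ E.deg n
  map_d : ∀ x, f (D.d x) = E.d (f x)

/-- The form `a₀ da₁ ∧ ⋯ ∧ daₙ`, where `l = [a₁, …, aₙ]`. -/
def DGData.monomial (D : DGData k V) (ι : A →ₗ[k] V) (a₀ : A) (l : List A) : V :=
  l.foldl (fun ω a => D.mul ω (D.d (ι a))) (ι a₀)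

/-- `D` is a differential calculus on the algebra `R`: a differential graded algebra, generated in
degree zero, whose degree zero part is identified with `R` by the algebra map `ι`. -/
structure IsDifferentialCalculus (R : AlgData k A) (D : DGData k V) (ι : A →ₗ[k] V) : Prop where
  isDGA : D.IsDGA
  injective : Function.Injective ι
  range_eq : LinearMap.range ι = D.deg 0
  map_one : ι R.one = D.one
  map_mul : ∀ a b, ι (R.mul a b) = D.mul (ι a) (ι b)
  generated : ∀ n, D.deg n =
    Submodule.span k {ω | ∃ (a₀ : A) (l : List A), l.length = n ∧ ω = D.monomial ι a₀ l}

/-! ### Koszul signs and tensor products -/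

open Classical in
/-- The linear map acting on the degree `n` part of a graded space as multiplication by `c n`
(and zero if `deg` is not a grading). -/
def gradedScale (deg : ℕ → Submodule k V) (c : ℕ → k) : V →ₗ[k] V :=
  if h : DirectSum.IsInternal deg then
    DirectSum.toModule k ℕ V (fun n => c n • (deg n).subtype) ∘ₗ
      (LinearEquiv.ofBijective (DirectSum.coeLinearMap deg)
        (show Function.Bijective (DirectSum.coeLinearMap deg) from h)).symm.toLinearMap
  else 0

theorem gradedScale_apply {deg : ℕ → Submodule k V} (h : DirectSum.IsInternal deg) (c : ℕ → k)
    {n : ℕ} {x : V} (hx : x ∈ deg n) : gradedScale deg c x = c n • x := by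
  have hs : (LinearEquiv.ofBijective (DirectSum.coeLinearMap deg)
        (show Function.Bijective (DirectSum.coeLinearMap deg) from h)).symm x =
      DirectSum.lof k ℕ (fun i => deg i) n ⟨x, hx⟩ := by
    rw [LinearEquiv.symm_apply_eq]
    simp
  simp [gradedScale, h, hs]

/-- The grading involution `x ↦ (-1)^|x| x`. -/
def parity (deg : ℕ → Submodule k V) : V →ₗ[k] V := gradedScale deg (fun n => (-1) ^ n)

/-- The projection onto the even part. -/
def evenPart (deg : ℕ → Submodule k V) : V →ₗ[k] V :=
  gradedScale deg (fun n => if Even n then 1 else 0)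

/-- The projection onto the odd part. -/
def oddPart (deg : ℕ → Submodule k V) : V →ₗ[k] V :=
  gradedScale deg (fun n => if Even n then 0 else 1)

/-- The product `m` on `V ⊗ W` modified by the Koszul sign: the value on
`(v ⊗ w, v' ⊗ w')` is `(-1)^(|w| |v'|) m (v ⊗ w) (v' ⊗ w')`. -/
def koszul (degV : ℕ → Submodule k V) (degW : ℕ → Submodule k W)
    (m : (V ⊗[k] W) →ₗ[k] (V ⊗[k] W) →ₗ[k] (V ⊗[k] W)) :
    (V ⊗[k] W) →ₗ[k] (V ⊗[k] W) →ₗ[k] (V ⊗[k] W) :=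
  m ∘ₗ TensorProduct.map LinearMap.id (evenPart degW) +
    m.compl₂ (TensorProduct.map (parity degV) LinearMap.id) ∘ₗ
      TensorProduct.map LinearMap.id (oddPart degW)

theorem koszul_tmul {degV : ℕ → Submodule k V} {degW : ℕ → Submodule k W}
    (hV : DirectSum.IsInternal degV) (hW : DirectSum.IsInternal degW)
    (m : (V ⊗[k] W) →ₗ[k] (V ⊗[k] W) →ₗ[k] (V ⊗[k] W)) {i j : ℕ} (v : V) {w : W} {v' : V} (w' : W)
    (hw : w ∈ degW j) (hv' : v' ∈ degV i) :
    koszul degV degW m (v ⊗ₜ w) (v' ⊗ₜ w') = (-1 : k) ^ (j * i) • m (v ⊗ₜ w) (v' ⊗ₜ w') := by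
  rcases Nat.even_or_odd j with hj | hj
  · simp [koszul, evenPart, oddPart, gradedScale_apply hW _ hw, hj, (hj.mul_right i).neg_one_pow]
  · simp [koszul, evenPart, oddPart, parity, gradedScale_apply hW _ hw, gradedScale_apply hV _ hv',
      Nat.not_even_iff_odd.mpr hj, pow_mul, hj.neg_one_pow,
      ← TensorProduct.smul_tmul']

/-- The total grading `⨁_{i + j = n} Vⁱ ⊗ Wʲ` of the tensor product. -/
def tensorDeg (degV : ℕ → Submodule k V) (degW : ℕ → Submodule k W) (n : ℕ) :
    Submodule k (V ⊗[k] W) :=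
  ⨆ p ∈ Finset.HasAntidiagonal.antidiagonal n,
    LinearMap.range (TensorProduct.map (degV p.1).subtype (degW p.2).subtype)

/-- The differential `v ⊗ w ↦ dv ⊗ w + (-1)^|v| v ⊗ dw`. -/
def tensorD (D : DGData k V) (E : DGData k W) : (V ⊗[k] W) →ₗ[k] (V ⊗[k] W) :=
  TensorProduct.map D.d LinearMap.id + TensorProduct.map (parity D.deg) E.d

/-- The graded tensor product of two differential graded algebras,
`(v ⊗ w)(v' ⊗ w') = (-1)^(|w| |v'|) vv' ⊗ ww'`. -/
def DGData.tensor (D : DGData k V) (E : DGData k W) : DGData k (V ⊗[k] W) where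
  mul := koszul D.deg E.deg (TensorProduct.map₂ D.mul E.mul)
  one := D.one ⊗ₜ E.one
  deg := tensorDeg D.deg E.deg
  d := tensorD D E

/-- The convolution product `c ↦ f(c₁) g(c₂)` of linear maps from a coalgebra to an algebra with
product `m`. -/
def conv {C : Type*} [AddCommGroup C] [Module k C] [Coalgebra k C]
    (m : A →ₗ[k] A →ₗ[k] A) (f g : C →ₗ[k] A) : C →ₗ[k] A :=
  TensorProduct.lift m ∘ₗ TensorProduct.map f g ∘ₗ Coalgebra.comul

end DGA

/-! ### Twisted modules and crossed product algebras -/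

section Hopf

variable {k : Type*} [Field k]
variable {H : Type*} [Ring H] [HopfAlgebra k H]
variable {B : Type*} [Ring B] [Algebra k B]
variable {A : Type*} [AddCommGroup A] [Module k A]
variable {V : Type*} [AddCommGroup V] [Module k V]
variable {W : Type*} [AddCommGroup W] [Module k W]

/-- A `σ`-twisted left `H`-module structure on the algebra `B`. -/
structure TwistedModule (k : Type*) [Field k] (H : Type*) [Ring H] [HopfAlgebra k H]
    (B : Type*) [Ring B] [Algebra k B] where
  /-- the measure `h ⊗ b ↦ h · b` -/
  act : H →ₗ[k] B →ₗ[k] B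
  /-- the cocycle -/
  σ : H ⊗[k] H →ₗ[k] B
  /-- its convolution inverse -/
  σInv : H ⊗[k] H →ₗ[k] B
  act_one : ∀ h, act h 1 = algebraMap k B (Coalgebra.counit h)
  /-- `h · (bb') = (h₁ · b)(h₂ · b')` -/
  act_mul : ∀ b b',
    act.flip (b * b') = conv (LinearMap.mul k B) (act.flip b) (act.flip b')
  σ_conv_σInv : conv (LinearMap.mul k B) σ σInv = Algebra.linearMap k B ∘ₗ Coalgebra.counit
  σInv_conv_σ : conv (LinearMap.mul k B) σInv σ = Algebra.linearMap k B ∘ₗ Coalgebra.counit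
  σ_one_right : ∀ h, σ (h ⊗ₜ 1) = algebraMap k B (Coalgebra.counit h)
  σ_one_left : ∀ h, σ (1 ⊗ₜ h) = algebraMap k B (Coalgebra.counit h)
  /-- `(h₁ · σ(h'₁ ⊗ h''₁)) σ(h₂ ⊗ h'₂h''₂) = σ(h₁ ⊗ h'₁) σ(h₂h'₂ ⊗ h'')`, as linear maps on
  `H ⊗ (H ⊗ H)`; the first factor on the right is `h ⊗ h' ⊗ h'' ↦ σ(h ⊗ h') ε(h'')`. -/
  cocycle :
    conv (LinearMap.mul k B)
        (TensorProduct.lift act ∘ₗ TensorProduct.map LinearMap.id σ)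
        (σ ∘ₗ TensorProduct.map LinearMap.id (LinearMap.mul' k H)) =
      conv (LinearMap.mul k B)
        ((TensorProduct.rid k B).toLinearMap ∘ₗ TensorProduct.map σ Coalgebra.counit ∘ₗ
          (TensorProduct.assoc k H H H).symm.toLinearMap)
        (σ ∘ₗ TensorProduct.map (LinearMap.mul' k H) LinearMap.id ∘ₗ
          (TensorProduct.assoc k H H H).symm.toLinearMap)
  one_act : ∀ b, act 1 b = b
  /-- `h · (h' · b) = σ(h₁ ⊗ h'₁) ((h₂h'₂) · b) σ⁻¹(h₃ ⊗ h'₃)` -/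
  twisted : ∀ b,
    TensorProduct.lift act ∘ₗ TensorProduct.map LinearMap.id (act.flip b) =
      conv (LinearMap.mul k B)
        (conv (LinearMap.mul k B) σ (act.flip b ∘ₗ LinearMap.mul' k H)) σInv

/-- `(v ⊗ (h₁ ⊗ h₂)) ⊗ (v' ⊗ h') ↦ v (h₁ · v') σ(h₂ ⊗ h')`. -/
def crossedKernel (m : V →ₗ[k] V →ₗ[k] V) (act : H →ₗ[k] V →ₗ[k] V) (σ : H ⊗[k] H →ₗ[k] V) :
    (V ⊗[k] (H ⊗[k] H)) ⊗[k] (V ⊗[k] H) →ₗ[k] V :=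
  TensorProduct.lift m ∘ₗ
    TensorProduct.map
      (TensorProduct.lift m ∘ₗ TensorProduct.map LinearMap.id (TensorProduct.lift act) ∘ₗ
        (TensorProduct.assoc k V H V).toLinearMap) σ ∘ₗ
    (TensorProduct.tensorTensorTensorComm k (V ⊗[k] H) H V H).toLinearMap ∘ₗ
    TensorProduct.map (TensorProduct.assoc k V H H).symm.toLinearMap LinearMap.id

theorem crossedKernel_tmul (m : V →ₗ[k] V →ₗ[k] V) (act : H →ₗ[k] V →ₗ[k] V)
    (σ : H ⊗[k] H →ₗ[k] V) (v v' : V) (h₁ h₂ h' : H) :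
    crossedKernel m act σ ((v ⊗ₜ (h₁ ⊗ₜ h₂)) ⊗ₜ (v' ⊗ₜ h')) =
      m (m v (act h₁ v')) (σ (h₂ ⊗ₜ h')) := by
  simp [crossedKernel]

/-- The product `(v ⊗ w)(v' ⊗ w') = v (w₋₂ · v') σ(w₋₁ ⊗ w'₋₁) ⊗ w₀ w'₀` on `V ⊗ W`, where
`lco w = w₋₁ ⊗ w₀` is a left `H`-coaction on `W`. -/
def crossedMul (mV : V →ₗ[k] V →ₗ[k] V) (act : H →ₗ[k] V →ₗ[k] V) (σ : H ⊗[k] H →ₗ[k] V)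
    (mW : W →ₗ[k] W →ₗ[k] W) (lco : W →ₗ[k] H ⊗[k] W) :
    (V ⊗[k] W) →ₗ[k] (V ⊗[k] W) →ₗ[k] (V ⊗[k] W) :=
  TensorProduct.curry <|
    TensorProduct.map (crossedKernel mV act σ) (TensorProduct.lift mW) ∘ₗ
    (TensorProduct.tensorTensorTensorComm k (V ⊗[k] (H ⊗[k] H)) W (V ⊗[k] H) W).toLinearMap ∘ₗ
    TensorProduct.map
      ((TensorProduct.assoc k V (H ⊗[k] H) W).symm.toLinearMap ∘ₗ
        TensorProduct.map LinearMap.id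
          (TensorProduct.map Coalgebra.comul LinearMap.id ∘ₗ lco))
      ((TensorProduct.assoc k V H W).symm.toLinearMap ∘ₗ TensorProduct.map LinearMap.id lco)

/-- The crossed product algebra `B ♯_σ H` on `B ⊗ H`,
`(b ⊗ h)(b' ⊗ h') = b (h₁ · b') σ(h₂ ⊗ h'₁) ⊗ h₃ h'₂`. -/
def TwistedModule.crossedProduct (T : TwistedModule k H B) : AlgData k (B ⊗[k] H) where
  mul := crossedMul (LinearMap.mul k B) T.act T.σ (LinearMap.mul k H) Coalgebra.comul
  one := 1 ⊗ₜ 1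

/-- The right `H`-coaction `b ⊗ h ↦ (b ⊗ h₁) ⊗ h₂` on `B ♯_σ H`. -/
def crossedCoaction (k : Type*) [Field k] (H : Type*) [Ring H] [HopfAlgebra k H]
    (B : Type*) [Ring B] [Algebra k B] : B ⊗[k] H →ₗ[k] (B ⊗[k] H) ⊗[k] H :=
  (TensorProduct.assoc k B H H).symm.toLinearMap ∘ₗ
    TensorProduct.map LinearMap.id Coalgebra.comul

/-! ### Covariant, twisted and complete calculi -/

/-- The differential calculus `E` on `H` is left covariant, with left `H`-coaction `lco`. -/
structure IsLeftCovariant (E : DGData k W) (ι : H →ₗ[k] W) (lco : W →ₗ[k] H ⊗[k] W) : Prop where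
  coassoc : TensorProduct.map LinearMap.id lco ∘ₗ lco =
    (TensorProduct.assoc k H H W).toLinearMap ∘ₗ
      TensorProduct.map Coalgebra.comul LinearMap.id ∘ₗ lco
  counit : (TensorProduct.lid k W).toLinearMap ∘ₗ
    TensorProduct.map Coalgebra.counit LinearMap.id ∘ₗ lco = LinearMap.id
  map_deg : ∀ n x, x ∈ E.deg n →
    lco x ∈ LinearMap.range (TensorProduct.map (LinearMap.id : H →ₗ[k] H) (E.deg n).subtype)
  map_mul : ∀ x y,
    lco (E.mul x y) = TensorProduct.map₂ (LinearMap.mul k H) E.mul (lco x) (lco y)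
  extends_comul : lco ∘ₗ ι = TensorProduct.map LinearMap.id ι ∘ₗ Coalgebra.comul
  map_d : lco ∘ₗ E.d = TensorProduct.map LinearMap.id E.d ∘ₗ lco

/-- The differential calculus `E` on `H` is right covariant, with right `H`-coaction `rco`. -/
structure IsRightCovariant (E : DGData k W) (ι : H →ₗ[k] W) (rco : W →ₗ[k] W ⊗[k] H) : Prop where
  coassoc : TensorProduct.map rco LinearMap.id ∘ₗ rco =
    (TensorProduct.assoc k W H H).symm.toLinearMap ∘ₗ
      TensorProduct.map LinearMap.id Coalgebra.comul ∘ₗ rco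
  counit : (TensorProduct.rid k W).toLinearMap ∘ₗ
    TensorProduct.map LinearMap.id Coalgebra.counit ∘ₗ rco = LinearMap.id
  map_deg : ∀ n x, x ∈ E.deg n →
    rco x ∈ LinearMap.range (TensorProduct.map (E.deg n).subtype (LinearMap.id : H →ₗ[k] H))
  map_mul : ∀ x y,
    rco (E.mul x y) = TensorProduct.map₂ E.mul (LinearMap.mul k H) (rco x) (rco y)
  extends_comul : rco ∘ₗ ι = TensorProduct.map ι LinearMap.id ∘ₗ Coalgebra.comul
  map_d : rco ∘ₗ E.d = TensorProduct.map E.d LinearMap.id ∘ₗ rco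

/-- The differential calculus `E` on `H` is bicovariant, with coactions `lco` and `rco`. -/
structure IsBicovariant (E : DGData k W) (ι : H →ₗ[k] W) (lco : W →ₗ[k] H ⊗[k] W)
    (rco : W →ₗ[k] W ⊗[k] H) : Prop where
  left : IsLeftCovariant E ι lco
  right : IsRightCovariant E ι rco

/-- The differential calculus `D` on the `σ`-twisted `H`-module `B` is a `σ`-twisted `H`-module
differential calculus, with action `actV` of `H` on forms (in degree zero the given measure). -/
structure IsTwistedCalculus (T : TwistedModule k H B) (D : DGData k V) (ι : B →ₗ[k] V)
    (actV : H →ₗ[k] V →ₗ[k] V) : Prop where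
  act_mem : ∀ h n x, x ∈ D.deg n → actV h x ∈ D.deg n
  act_zero : ∀ h b, actV h (ι b) = ι (T.act h b)
  /-- `h · (b₀ db₁ ∧ ⋯ ∧ dbₙ) = (h₁ · b₀)(h₂ · db₁) ∧ ⋯ ∧ (hₙ₊₁ · dbₙ)` -/
  act_monomial : ∀ b₀ l, actV.flip (D.monomial ι b₀ l) =
    l.foldl (fun f b => conv D.mul f (actV.flip (D.d (ι b)))) (actV.flip (ι b₀))
  act_d : ∀ h b, actV h (D.d (ι b)) = D.d (ι (T.act h b))
  d_σ : ∀ x, D.d (ι (T.σ x)) = 0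

/-- The linear map `Δ : Ω(A) → Ω(A) ⊗ Ω(H)` is a morphism of differential graded algebras which
extends the coaction `δ : A → A ⊗ H`. Here `D`, `ιA` and `E`, `ιH` are the calculi on `A`, `H`. -/
structure IsCoactionExtension (δ : A →ₗ[k] A ⊗[k] H) (D : DGData k V) (ιA : A →ₗ[k] V)
    (E : DGData k W) (ιH : H →ₗ[k] W) (Δ : V →ₗ[k] V ⊗[k] W) : Prop where
  isDGHom : IsDGHom D (D.tensor E) Δ
  extends_coaction : Δ ∘ₗ ιA = TensorProduct.map ιA ιH ∘ₗ δ

/-- The calculus `D` on `A` is complete: the coaction `δ` of `H` on `A` extends to a morphism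
`Ω(A) → Ω(A) ⊗ Ω(H)` of differential graded algebras. -/
def IsCompleteCalculus (δ : A →ₗ[k] A ⊗[k] H) (D : DGData k V) (ιA : A →ₗ[k] V)
    (E : DGData k W) (ιH : H →ₗ[k] W) : Prop :=
  ∃ Δ : V →ₗ[k] V ⊗[k] W, IsCoactionExtension δ D ιA E ιH Δ

/-- The base space forms `{x | Δ x = x ⊗ 1}`. -/
def baseForms (E : DGData k W) (Δ : V →ₗ[k] V ⊗[k] W) : Submodule k V :=
  LinearMap.eqLocus Δ ((TensorProduct.mk k V W).flip E.one)

/-- The crossed product calculus on `Ω(B) ⊗ Ω(H)`: total degree,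
`(ω ⊗ η) ∧ (ω' ⊗ η') = (-1)^(|η| |ω'|) ω ∧ (η₋₂ · ω') σ(η₋₁ ⊗ η'₋₁) ⊗ η₀ ∧ η'₀` and
`d(ω ⊗ η) = dω ⊗ η + (-1)^|ω| ω ⊗ dη`. -/
def TwistedModule.crossedCalculus (T : TwistedModule k H B) (D : DGData k V) (ιB : B →ₗ[k] V)
    (actV : H →ₗ[k] V →ₗ[k] V) (E : DGData k W) (lco : W →ₗ[k] H ⊗[k] W) :
    DGData k (V ⊗[k] W) where
  mul := koszul D.deg E.deg (crossedMul D.mul actV (ιB ∘ₗ T.σ) E.mul lco)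
  one := D.one ⊗ₜ E.one
  deg := tensorDeg D.deg E.deg
  d := tensorD D E

end Hopf

end CrossedCalculus

end

open CrossedCalculus

noncomputable section

namespace CrossedCalculus

/-! ### Gradings, their projections, and the total grading of a tensor product. -/

section Graded

variable {k : Type*} [Field k]
variable {V : Type*} [AddCommGroup V] [Module k V]
variable {W : Type*} [AddCommGroup W] [Module k W]
variable {X : Type*} [AddCommGroup X] [Module k X]

/-! The hard point is that the product on Ω(B) ⊗ Ω(H) is associative and compatible with `d` and
with the coaction. The twist by `σ` and the Koszul signs are handled separately. If H is viewed as a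
differential graded algebra in degree zero with zero differential (`trivialDG`), then Ω(B) ♯_σ H is
a crossed product without signs. Its associativity is an identity in the convolution algebra Hom(H ⊗
H ⊗ H, Ω(B)) and follows from the cocycle and twisted module conditions (`crossed_assoc_conv`); its
Leibniz rule holds because `d` commutes with the action and kills `σ`. The graded tensor product
(Ω(B) ♯_σ H) ⊗ Ω(H), in turn, has signs but no twist (`tensor_isDGA`). The map ω ⊗ η ↦ (ω ⊗ η₋₁) ⊗
η₀ (`crossedEmbedding`) embeds the crossed product calculus there: it is injective by the counit and
respects all operations because the left coaction is multiplicative, coassociative and commutes with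
`d`. The axioms therefore pull back (`DGData.IsDGA.of_injective`).

The twisted module identities are given on B, and the action on forms only on monomials. They reach
all forms by induction on x ↦ x ∧ db (`IsTwistedCalculus.isTwistedDGA`), the ingredients being the
Leibniz rule and d ∘ σ = 0.

Generation in degree zero uses σ⁻¹ to undo the twist: ω ⊗ ξ ∧ da = (ω σ⁻¹(ξ₋₁ ⊗ a₁) ⊗ ξ₀) ∧ d(1 ⊗
a₂), so one inducts on the degree of the second leg
(`IsDifferentialCalculus.tmul_mem_monomialSpan`).

For completeness the extension is id ⊗ Δ (`formCoaction`). After the embedding it becomes id ⊗ Δ on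
an untwisted tensor product, where it is a tensor product of morphisms. A morphism out of a calculus
is determined in degree zero, so this is the only extension. Finally, the counit ε of H, extended by
zero to positive degrees, satisfies (ε ⊗ id)Δ = id on Ω(H); applied to the middle leg of Δ^(x) = x ⊗
1 it gives x = (id ⊗ ε)(x) ⊗ 1, which lies in Ω(B) ⊗ 1. -/

theorem isInternal_induction {deg : ℕ → Submodule k V} (h : DirectSum.IsInternal deg)
    {p : V → Prop} (hom : ∀ n, ∀ x ∈ deg n, p x) (add : ∀ x y, p x → p y → p (x + y)) (x : V) :
    p x := by
  have hx : x ∈ iSup deg := h.submodule_iSup_eq_top ▸ Submodule.mem_top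
  exact Submodule.iSup_induction deg (motive := p) hx hom (hom 0 0 (zero_mem _)) add

/-- The projection onto the degree `n` part. -/
def gradedProj (deg : ℕ → Submodule k V) (n : ℕ) : V →ₗ[k] V :=
  gradedScale deg (fun m => if m = n then 1 else 0)

theorem gradedProj_of_mem {deg : ℕ → Submodule k V} (h : DirectSum.IsInternal deg) {n : ℕ} {x : V}
    (hx : x ∈ deg n) : gradedProj deg n x = x := by
  simp [gradedProj, gradedScale_apply h _ hx]

theorem gradedProj_of_mem_ne {deg : ℕ → Submodule k V} (h : DirectSum.IsInternal deg) {n m : ℕ}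
    {x : V} (hx : x ∈ deg m) (hmn : m ≠ n) : gradedProj deg n x = 0 := by
  simp [gradedProj, gradedScale_apply h _ hx, hmn]

theorem gradedProj_mem {deg : ℕ → Submodule k V} (h : DirectSum.IsInternal deg) (n : ℕ) (x : V) :
    gradedProj deg n x ∈ deg n := by
  induction x using isInternal_induction h with
  | hom m x hx =>
    by_cases hmn : m = n
    · subst hmn
      rwa [gradedProj_of_mem h hx]
    · rw [gradedProj_of_mem_ne h hx hmn]
      exact zero_mem _
  | add x y hx hy => rw [map_add]; exact add_mem hx hy

/-- An element of degree `n` that is also a sum of elements of other degrees is both fixed and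
killed by `P n`, which gives independence. -/
theorem isInternal_of_projections {deg : ℕ → Submodule k V} (htop : iSup deg = ⊤)
    (P : ℕ → V →ₗ[k] V) (hP : ∀ n, ∀ x ∈ deg n, P n x = x)
    (hP' : ∀ m n, m ≠ n → ∀ x ∈ deg m, P n x = 0) : DirectSum.IsInternal deg := by
  rw [DirectSum.isInternal_submodule_iff_iSupIndep_and_iSup_eq_top]
  refine ⟨fun n => ?_, htop⟩
  rw [Submodule.disjoint_def]
  intro x hx hx'
  have hle : (⨆ m, ⨆ (_ : m ≠ n), deg m) ≤ LinearMap.ker (P n) :=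
    iSup_le fun m => iSup_le fun hm x hx => hP' m n hm x hx
  rw [← hP n x hx]
  exact hle hx'

/-- An injective graded map reflects degrees. -/
theorem mem_deg_of_injective {degV : ℕ → Submodule k V} {degX : ℕ → Submodule k X}
    (hV : DirectSum.IsInternal degV) (hX : DirectSum.IsInternal degX) {f : V →ₗ[k] X}
    (hf : Function.Injective f) (hdeg : ∀ n, ∀ x ∈ degV n, f x ∈ degX n) {n : ℕ} {x : V}
    (hx : f x ∈ degX n) : x ∈ degV n := by
  -- A graded map commutes with the projections onto degree `n`; injectivity then removes `f`.
  have key : ∀ y, gradedProj degX n (f y) = f (gradedProj degV n y) := by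
    intro y
    induction y using isInternal_induction hV with
    | hom m y hy =>
      by_cases hmn : m = n
      · subst hmn
        rw [gradedProj_of_mem hV hy, gradedProj_of_mem hX (hdeg _ _ hy)]
      · rw [gradedProj_of_mem_ne hV hy hmn, gradedProj_of_mem_ne hX (hdeg _ _ hy) hmn, map_zero]
    | add y z hy hz => simp only [map_add, hy, hz]
  have h := key x
  rw [gradedProj_of_mem hX hx] at h
  rw [hf h]
  exact gradedProj_mem hV n x

theorem parity_of_mem {deg : ℕ → Submodule k V} (h : DirectSum.IsInternal deg) {n : ℕ} {x : V}
    (hx : x ∈ deg n) : parity deg x = (-1 : k) ^ n • x :=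
  gradedScale_apply h _ hx

/-! ### The grading of a tensor product -/

theorem tmul_mem_tensorDeg {degV : ℕ → Submodule k V} {degW : ℕ → Submodule k W} {i j n : ℕ}
    {v : V} {w : W} (hv : v ∈ degV i) (hw : w ∈ degW j) (hn : i + j = n) :
    v ⊗ₜ w ∈ tensorDeg degV degW n := by
  refine Submodule.mem_iSup_of_mem (i, j) (Submodule.mem_iSup_of_mem ?_ ?_)
  · simpa using hn
  · exact ⟨(⟨v, hv⟩ : degV i) ⊗ₜ (⟨w, hw⟩ : degW j), by simp⟩

theorem tensorDeg_le {degV : ℕ → Submodule k V} {degW : ℕ → Submodule k W} {n : ℕ}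
    {S : Submodule k (V ⊗[k] W)}
    (h : ∀ i j, i + j = n → ∀ v ∈ degV i, ∀ w ∈ degW j, v ⊗ₜ w ∈ S) :
    tensorDeg degV degW n ≤ S := by
  refine iSup_le fun p => iSup_le fun hp => ?_
  rintro _ ⟨t, rfl⟩
  rw [Finset.HasAntidiagonal.mem_antidiagonal] at hp
  induction t with
  | zero => simp
  | tmul v w => exact h _ _ hp _ v.2 _ w.2
  | add s t hs ht => rw [map_add]; exact add_mem hs ht

theorem tensor_induction {degV : ℕ → Submodule k V} {degW : ℕ → Submodule k W}
    (hV : DirectSum.IsInternal degV) (hW : DirectSum.IsInternal degW) {p : V ⊗[k] W → Prop}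
    (tmul : ∀ i j, ∀ v ∈ degV i, ∀ w ∈ degW j, p (v ⊗ₜ w))
    (add : ∀ x y, p x → p y → p (x + y)) (x : V ⊗[k] W) : p x := by
  induction x with
  | zero => simpa using tmul 0 0 0 (zero_mem _) 0 (zero_mem _)
  | add x y hx hy => exact add x y hx hy
  | tmul v w =>
    induction v using isInternal_induction hV with
    | add v v' h h' => rw [TensorProduct.add_tmul]; exact add _ _ h h'
    | hom i v hv =>
      induction w using isInternal_induction hW with
      | add w w' h h' => rw [TensorProduct.tmul_add]; exact add _ _ h h'
      | hom j w hw => exact tmul i j v hv w hw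

theorem tensorDeg_induction {degV : ℕ → Submodule k V} {degW : ℕ → Submodule k W} {n : ℕ}
    {p : (x : V ⊗[k] W) → x ∈ tensorDeg degV degW n → Prop}
    (tmul : ∀ i j (hij : i + j = n), ∀ v (hv : v ∈ degV i), ∀ w (hw : w ∈ degW j),
      p (v ⊗ₜ w) (tmul_mem_tensorDeg hv hw hij))
    (add : ∀ x y hx hy, p x hx → p y hy → p (x + y) (add_mem hx hy))
    {x : V ⊗[k] W} (hx : x ∈ tensorDeg degV degW n) : p x hx := by
  have h0 : p 0 (zero_mem _) := by
    simpa using tmul 0 n (zero_add n) 0 (zero_mem _) 0 (zero_mem _)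
  -- Induction on a supremum takes predicates on bare elements, so the membership proof on which `p`
  -- depends is packed into the carrier.
  let S : AddSubmonoid (V ⊗[k] W) :=
    { carrier := {x | ∃ hx, p x hx}
      add_mem' := fun ⟨hx, px⟩ ⟨hy, py⟩ => ⟨add_mem hx hy, add _ _ hx hy px py⟩
      zero_mem' := ⟨zero_mem _, h0⟩ }
  suffices h : x ∈ S from h.2
  refine Submodule.iSup_induction (motive := (· ∈ S)) _ hx (fun q y hy => ?_) (zero_mem _)
    (fun _ _ => add_mem)
  refine Submodule.iSup_induction (motive := (· ∈ S)) _ hy (fun hq z hz => ?_) (zero_mem _)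
    (fun _ _ => add_mem)
  rw [Finset.HasAntidiagonal.mem_antidiagonal] at hq
  obtain ⟨t, rfl⟩ := hz
  induction t with
  | zero => rw [map_zero]; exact zero_mem _
  | tmul v w => exact ⟨_, tmul _ _ hq _ v.2 _ w.2⟩
  | add s t hs ht => rw [map_add]; exact add_mem hs ht

/-- The projection onto total degree `n` is the sum of p_i ⊗ p_j over i + j = n. -/
theorem tensorDeg_isInternal {degV : ℕ → Submodule k V} {degW : ℕ → Submodule k W}
    (hV : DirectSum.IsInternal degV) (hW : DirectSum.IsInternal degW) :
    DirectSum.IsInternal (tensorDeg degV degW) := by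
  have hproj : ∀ n i j (v : V) (w : W), v ∈ degV i → w ∈ degW j →
      (∑ q ∈ Finset.HasAntidiagonal.antidiagonal n, TensorProduct.map (gradedProj degV q.1) (gradedProj degW q.2))
        (v ⊗ₜ[k] w) = if i + j = n then v ⊗ₜ w else 0 := by
    intro n i j v w hv hw
    rw [LinearMap.sum_apply]
    have : ∀ q ∈ Finset.HasAntidiagonal.antidiagonal n,
        TensorProduct.map (gradedProj degV q.1) (gradedProj degW q.2) (v ⊗ₜ[k] w) =
          if q = (i, j) then v ⊗ₜ w else 0 := by
      rintro ⟨a, b⟩ -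
      by_cases ha : i = a
      · subst ha
        by_cases hb : j = b
        · subst hb
          simp [gradedProj_of_mem hV hv, gradedProj_of_mem hW hw]
        · have hb' : b ≠ j := fun h => hb h.symm
          simp [gradedProj_of_mem_ne hW hw hb, hb']
      · have ha' : a ≠ i := fun h => ha h.symm
        simp [gradedProj_of_mem_ne hV hv ha, ha']
    rw [Finset.sum_congr rfl this, Finset.sum_ite_eq']
    simp
  refine isInternal_of_projections ?_
    (fun n => ∑ q ∈ Finset.HasAntidiagonal.antidiagonal n,
      TensorProduct.map (gradedProj degV q.1) (gradedProj degW q.2)) ?_ ?_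
  · rw [eq_top_iff]
    rintro x -
    induction x using tensor_induction hV hW with
    | tmul i j v hv w hw =>
      exact Submodule.mem_iSup_of_mem (i + j) (tmul_mem_tensorDeg hv hw rfl)
    | add x y hx hy => exact add_mem hx hy
  · intro n x hx
    induction hx using tensorDeg_induction with
    | tmul i j hij v hv w hw => rw [hproj n i j v w hv hw, if_pos hij]
    | add x y _ _ hx hy => rw [map_add, hx, hy]
  · intro m n hmn x hx
    induction hx using tensorDeg_induction with
    | tmul i j hij v hv w hw => rw [hproj n i j v w hv hw, if_neg (by omega)]
    | add x y _ _ hx hy => rw [map_add, hx, hy, add_zero]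

end Graded

/-! ### Tensor products of differential graded algebras -/

section Tensor

variable {k : Type*} [Field k]
variable {V : Type*} [AddCommGroup V] [Module k V]
variable {W : Type*} [AddCommGroup W] [Module k W]
variable {X : Type*} [AddCommGroup X] [Module k X]
variable {V' : Type*} [AddCommGroup V'] [Module k V']
variable {W' : Type*} [AddCommGroup W'] [Module k W']
variable {D : DGData k V} {E : DGData k W} {F : DGData k X}
variable {D' : DGData k V'} {E' : DGData k W'}

theorem DGData.tensor_mul_tmul (hV : DirectSum.IsInternal D.deg) (hW : DirectSum.IsInternal E.deg)
    {i j : ℕ} (v : V) {w : W} {v' : V} (w' : W) (hw : w ∈ E.deg j) (hv' : v' ∈ D.deg i) :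
    (D.tensor E).mul (v ⊗ₜ w) (v' ⊗ₜ w') = (-1 : k) ^ (j * i) • (D.mul v v' ⊗ₜ E.mul w w') := by
  simp only [DGData.tensor]
  rw [koszul_tmul hV hW _ v w' hw hv', TensorProduct.map₂_apply_tmul, TensorProduct.map_tmul]

theorem tensorD_tmul (hV : DirectSum.IsInternal D.deg) {i : ℕ} {v : V} (hv : v ∈ D.deg i) (w : W) :
    tensorD D E (v ⊗ₜ w) = D.d v ⊗ₜ w + (-1 : k) ^ i • (v ⊗ₜ E.d w) := by
  simp [tensorD, parity_of_mem hV hv, TensorProduct.smul_tmul']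

theorem tensorD_mem (hD : DirectSum.IsInternal D.deg)
    (hDd : ∀ n x, x ∈ D.deg n → D.d x ∈ D.deg (n + 1))
    (hEd : ∀ n x, x ∈ E.deg n → E.d x ∈ E.deg (n + 1)) (n : ℕ) (x : V ⊗[k] W)
    (hx : x ∈ tensorDeg D.deg E.deg n) : tensorD D E x ∈ tensorDeg D.deg E.deg (n + 1) := by
  induction hx using tensorDeg_induction with
  | tmul i j hij v hv w hw =>
    rw [tensorD_tmul hD hv]
    exact add_mem (tmul_mem_tensorDeg (hDd _ _ hv) hw (by omega))
      (Submodule.smul_mem _ _ (tmul_mem_tensorDeg hv (hEd _ _ hw) (by omega)))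
  | add x y _ _ hx hy => rw [map_add]; exact add_mem hx hy

theorem tensorD_tensorD (hD : D.IsDGA) (hE : E.IsDGA) (x : V ⊗[k] W) :
    tensorD D E (tensorD D E x) = 0 := by
  induction x using tensor_induction hD.internal hE.internal with
  | tmul i j v hv w hw =>
    rw [tensorD_tmul hD.internal hv, map_add, map_smul, tensorD_tmul hD.internal (hD.d_mem _ _ hv),
      tensorD_tmul hD.internal hv, hD.d_d, hE.d_d]
    simp [pow_succ]
  | add x y hx hy => simp only [map_add, hx, hy, add_zero]

theorem tensor_isDGA (hD : D.IsDGA) (hE : E.IsDGA) : (D.tensor E).IsDGA where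
  internal := tensorDeg_isInternal hD.internal hE.internal
  one_mem := tmul_mem_tensorDeg hD.one_mem hE.one_mem rfl
  d_mem := tensorD_mem hD.internal hD.d_mem hE.d_mem
  d_d := tensorD_tensorD hD hE
  one_mul x := by
    induction x using tensor_induction hD.internal hE.internal with
    | tmul i j v hv w hw =>
      have h := DGData.tensor_mul_tmul hD.internal hE.internal D.one w hE.one_mem hv
      simpa [hD.one_mul, hE.one_mul, DGData.tensor] using h
    | add x y hx hy => rw [map_add, hx, hy]
  mul_one x := by
    induction x using tensor_induction hD.internal hE.internal with
    | tmul i j v hv w hw =>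
      have h := DGData.tensor_mul_tmul hD.internal hE.internal v E.one hw hD.one_mem
      rw [mul_zero, pow_zero, one_smul, hD.mul_one, hE.mul_one] at h
      exact h
    | add x y hx hy => rw [map_add, LinearMap.add_apply, hx, hy]
  mul_mem m n x y hx hy := by
    induction hx using tensorDeg_induction with
    | tmul i j hij v hv w hw =>
      induction hy using tensorDeg_induction with
      | tmul i' j' hij' v' hv' w' hw' =>
        rw [DGData.tensor_mul_tmul hD.internal hE.internal v w' hw hv']
        exact Submodule.smul_mem _ _ (tmul_mem_tensorDeg (hD.mul_mem _ _ _ _ hv hv')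
          (hE.mul_mem _ _ _ _ hw hw') (by omega))
      | add x y _ _ hx hy => rw [map_add]; exact add_mem hx hy
    | add x y _ _ hx hy => rw [map_add, LinearMap.add_apply]; exact add_mem hx hy
  mul_assoc x y z := by
    induction x using tensor_induction hD.internal hE.internal with
    | add x y hx hy => simp only [map_add, LinearMap.add_apply, hx, hy]
    | tmul i j v hv w hw =>
    induction y using tensor_induction hD.internal hE.internal with
    | add x y hx hy => simp only [map_add, LinearMap.add_apply, hx, hy]
    | tmul i' j' v' hv' w' hw' =>
    induction z using tensor_induction hD.internal hE.internal with
    | add x y hx hy => simp only [map_add, hx, hy]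
    | tmul i'' j'' v'' hv'' w'' hw'' =>
      rw [DGData.tensor_mul_tmul hD.internal hE.internal v w' hw hv',
        DGData.tensor_mul_tmul hD.internal hE.internal v' w'' hw' hv'', map_smul, map_smul,
        LinearMap.smul_apply, DGData.tensor_mul_tmul hD.internal hE.internal _ w''
          (hE.mul_mem _ _ _ _ hw hw') hv'',
        DGData.tensor_mul_tmul hD.internal hE.internal v _ hw (hD.mul_mem _ _ _ _ hv' hv''),
        smul_smul, smul_smul, hD.mul_assoc, hE.mul_assoc]
      congr 1
      ring
  leibniz n x y hx := by
    induction hx using tensorDeg_induction with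
    | add x y _ _ hx hy =>
      simp only [map_add, LinearMap.add_apply, hx, hy, smul_add]
      abel
    | tmul i j hij v hv w hw =>
    induction y using tensor_induction hD.internal hE.internal with
    | add x y hx hy =>
      simp only [map_add, hx, hy, smul_add]
      abel
    | tmul i' j' v' hv' w' hw' =>
      subst hij
      have hd : ∀ x, (D.tensor E).d x = tensorD D E x := fun _ => rfl
      simp only [hd]
      rw [DGData.tensor_mul_tmul hD.internal hE.internal v w' hw hv', map_smul,
        tensorD_tmul hD.internal (hD.mul_mem _ _ _ _ hv hv'), tensorD_tmul hD.internal hv,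
        tensorD_tmul hD.internal hv', hD.leibniz _ _ _ hv, hE.leibniz _ _ _ hw, map_add, map_add,
        map_smul, map_smul, LinearMap.add_apply, LinearMap.smul_apply,
        DGData.tensor_mul_tmul hD.internal hE.internal _ w' hw hv',
        DGData.tensor_mul_tmul hD.internal hE.internal _ w' (hE.d_mem _ _ hw) hv',
        DGData.tensor_mul_tmul hD.internal hE.internal _ w' hw (hD.d_mem _ _ hv'),
        DGData.tensor_mul_tmul hD.internal hE.internal _ (E.d w') hw hv']
      simp only [TensorProduct.add_tmul, TensorProduct.tmul_add, TensorProduct.tmul_smul,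
        ← TensorProduct.smul_tmul', smul_add, smul_smul]
      -- Moving `w` past `dv'` instead of `v'` costs an extra (-1)^j, which cancels the (-1)^j
      -- contained in the Leibniz sign (-1)^(i+j).
      have h1 : (-1 : k) ^ j * (-1) ^ j = 1 := by rw [← mul_pow]; simp
      have e1 : (-1 : k) ^ (j * i') * (-1) ^ i = (-1) ^ (i + j) * (-1) ^ (j * (i' + 1)) := by
        rw [mul_add, mul_one, pow_add _ i j, pow_add _ (j * i') j]
        linear_combination (-(-1 : k) ^ (j * i') * (-1) ^ i) * h1
      have e2 : (-1 : k) ^ (j * i') * (-1) ^ (i + i') = (-1) ^ i * (-1) ^ ((j + 1) * i') := by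
        ring
      have e3 : (-1 : k) ^ (j * i') * ((-1) ^ (i + i') * (-1) ^ j) =
          (-1) ^ (i + j) * ((-1) ^ i' * (-1) ^ (j * i')) := by
        ring
      rw [e1, e2, e3]
      abel

/-! ### Morphisms between tensor products -/

theorem map_mem_tensorDeg {f : V →ₗ[k] V'} {g : W →ₗ[k] W'}
    (hf : ∀ n x, x ∈ D.deg n → f x ∈ D'.deg n) (hg : ∀ n x, x ∈ E.deg n → g x ∈ E'.deg n)
    (n : ℕ) (x : V ⊗[k] W) (hx : x ∈ tensorDeg D.deg E.deg n) :
    TensorProduct.map f g x ∈ tensorDeg D'.deg E'.deg n := by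
  induction hx using tensorDeg_induction with
  | tmul i j hij v hv w hw =>
    rw [TensorProduct.map_tmul]
    exact tmul_mem_tensorDeg (hf _ _ hv) (hg _ _ hw) hij
  | add x y _ _ hx hy => rw [map_add]; exact add_mem hx hy

theorem map_tensorD (hD : DirectSum.IsInternal D.deg) (hD' : DirectSum.IsInternal D'.deg)
    {f : V →ₗ[k] V'} {g : W →ₗ[k] W'} (hf : ∀ n x, x ∈ D.deg n → f x ∈ D'.deg n)
    (hfd : ∀ x, f (D.d x) = D'.d (f x)) (hgd : ∀ x, g (E.d x) = E'.d (g x)) (x : V ⊗[k] W) :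
    TensorProduct.map f g (tensorD D E x) = tensorD D' E' (TensorProduct.map f g x) := by
  induction x with
  | zero => simp
  | add x y hx hy => simp only [map_add, hx, hy]
  | tmul v w =>
    induction v using isInternal_induction hD with
    | hom i v hv =>
      rw [tensorD_tmul hD hv, TensorProduct.map_tmul, tensorD_tmul hD' (hf _ _ hv), map_add,
        map_smul, TensorProduct.map_tmul, TensorProduct.map_tmul, hfd, hgd]
    | add v v' h h' => simp only [TensorProduct.add_tmul, map_add, h, h']

theorem map_tensor_mul (hD : DirectSum.IsInternal D.deg) (hE : DirectSum.IsInternal E.deg)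
    (hD' : DirectSum.IsInternal D'.deg) (hE' : DirectSum.IsInternal E'.deg)
    {f : V →ₗ[k] V'} {g : W →ₗ[k] W'}
    (hf : ∀ n x, x ∈ D.deg n → f x ∈ D'.deg n) (hg : ∀ n x, x ∈ E.deg n → g x ∈ E'.deg n)
    (hfm : ∀ x y, f (D.mul x y) = D'.mul (f x) (f y))
    (hgm : ∀ x y, g (E.mul x y) = E'.mul (g x) (g y)) (x y : V ⊗[k] W) :
    TensorProduct.map f g ((D.tensor E).mul x y) =
      (D'.tensor E').mul (TensorProduct.map f g x) (TensorProduct.map f g y) := by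
  induction x using tensor_induction hD hE with
  | add x y hx hy => simp only [map_add, LinearMap.add_apply, hx, hy]
  | tmul i j v hv w hw =>
  induction y using tensor_induction hD hE with
  | add x y hx hy => simp only [map_add, hx, hy]
  | tmul i' j' v' hv' w' hw' =>
    rw [DGData.tensor_mul_tmul hD hE v w' hw hv', map_smul]
    simp only [TensorProduct.map_tmul]
    rw [DGData.tensor_mul_tmul hD' hE' _ _ (hg _ _ hw) (hf _ _ hv'), hfm, hgm]

theorem assoc_symm_mem_tensorDeg (n : ℕ) (x : V ⊗[k] (W ⊗[k] X))
    (hx : x ∈ tensorDeg D.deg (tensorDeg E.deg F.deg) n) :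
    (TensorProduct.assoc k V W X).symm x ∈ tensorDeg (tensorDeg D.deg E.deg) F.deg n := by
  induction hx using tensorDeg_induction with
  | add x y _ _ hx hy => rw [map_add]; exact add_mem hx hy
  | tmul i j hij v hv t ht =>
    induction ht using tensorDeg_induction with
    | add x y _ _ hx hy => rw [TensorProduct.tmul_add, map_add]; exact add_mem hx hy
    | tmul i' j' hij' w hw x hx =>
      rw [TensorProduct.assoc_symm_tmul]
      exact tmul_mem_tensorDeg (tmul_mem_tensorDeg hv hw rfl) hx (by omega)

theorem assoc_symm_tensorD (hD : DirectSum.IsInternal D.deg) (hE : DirectSum.IsInternal E.deg)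
    (x : V ⊗[k] (W ⊗[k] X)) :
    (TensorProduct.assoc k V W X).symm (tensorD D (E.tensor F) x) =
      tensorD (D.tensor E) F ((TensorProduct.assoc k V W X).symm x) := by
  have hd : ∀ x, (D.tensor E).d x = tensorD D E x := fun _ => rfl
  have hd' : ∀ x, (E.tensor F).d x = tensorD E F x := fun _ => rfl
  induction x with
  | zero => simp
  | add x y hx hy => simp only [map_add, hx, hy]
  | tmul v t =>
  induction v using isInternal_induction hD with
  | add v v' h h' => simp only [TensorProduct.add_tmul, map_add, h, h']
  | hom i v hv =>
  induction t with
  | zero => simp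
  | add x y hx hy => simp only [TensorProduct.tmul_add, map_add, hx, hy]
  | tmul w x =>
  induction w using isInternal_induction hE with
  | add v v' h h' => simp only [TensorProduct.add_tmul, TensorProduct.tmul_add, map_add, h, h']
  | hom j w hw =>
    rw [tensorD_tmul hD hv, TensorProduct.assoc_symm_tmul, hd',
      tensorD_tmul (D := D.tensor E) (tensorDeg_isInternal hD hE) (tmul_mem_tensorDeg hv hw rfl),
      hd, tensorD_tmul hD hv, tensorD_tmul hE hw]
    simp only [TensorProduct.tmul_add, TensorProduct.tmul_smul, map_add, map_smul,
      TensorProduct.assoc_symm_tmul, TensorProduct.add_tmul, ← TensorProduct.smul_tmul', smul_add,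
      smul_smul, pow_add, add_assoc]

/-- The exponent of the Koszul sign is biadditive in the degrees, so both bracketings produce the
same sign. -/
theorem assoc_symm_tensor_mul (hD : DirectSum.IsInternal D.deg) (hE : E.IsDGA) (hF : F.IsDGA)
    (x y : V ⊗[k] (W ⊗[k] X)) :
    (TensorProduct.assoc k V W X).symm ((D.tensor (E.tensor F)).mul x y) =
      ((D.tensor E).tensor F).mul ((TensorProduct.assoc k V W X).symm x)
        ((TensorProduct.assoc k V W X).symm y) := by
  have hEF := tensorDeg_isInternal hE.internal hF.internal
  have hDE := tensorDeg_isInternal hD hE.internal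
  induction x with
  | zero => simp
  | add x y hx hy => simp only [map_add, LinearMap.add_apply, hx, hy]
  | tmul v t =>
  induction t using tensor_induction hE.internal hF.internal with
  | add x y hx hy => simp only [TensorProduct.tmul_add, map_add, LinearMap.add_apply, hx, hy]
  | tmul j l w hw x hx =>
  induction y using tensor_induction hD hEF with
  | add x y hx hy => simp only [map_add, hx, hy]
  | tmul i' n' v' hv' t' ht' =>
  clear ht'
  induction t' using tensor_induction hE.internal hF.internal with
  | add x y hx hy => simp only [TensorProduct.tmul_add, map_add, hx, hy]
  | tmul j' l' w' hw' x' hx' =>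
    rw [DGData.tensor_mul_tmul (E := E.tensor F) hD hEF v _
        (tmul_mem_tensorDeg hw hx rfl) hv',
      DGData.tensor_mul_tmul hE.internal hF.internal w x' hx hw']
    simp only [TensorProduct.assoc_symm_tmul]
    rw [DGData.tensor_mul_tmul (D := D.tensor E) hDE hF.internal _ x' hx
        (tmul_mem_tensorDeg hv' hw' rfl),
      DGData.tensor_mul_tmul hD hE.internal v w' hw hv']
    simp only [TensorProduct.tmul_smul, map_smul, TensorProduct.assoc_symm_tmul,
      ← TensorProduct.smul_tmul', smul_smul]
    congr 1
    ring

end Tensor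

/-! ### Generation in degree zero -/

section Generation

variable {k : Type*} [Field k]
variable {A : Type*} [AddCommGroup A] [Module k A]
variable {V : Type*} [AddCommGroup V] [Module k V]
variable {X : Type*} [AddCommGroup X] [Module k X]
variable {R : AlgData k A} {D : DGData k V} {ι : A →ₗ[k] V}

theorem DGData.monomial_nil (D : DGData k V) (ι : A →ₗ[k] V) (a : A) : D.monomial ι a [] = ι a :=
  rfl

theorem DGData.monomial_concat (D : DGData k V) (ι : A →ₗ[k] V) (a : A) (l : List A) (b : A) :
    D.monomial ι a (l ++ [b]) = D.mul (D.monomial ι a l) (D.d (ι b)) := by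
  simp [DGData.monomial]

theorem IsDifferentialCalculus.ι_mem (h : IsDifferentialCalculus R D ι) (a : A) :
    ι a ∈ D.deg 0 :=
  h.range_eq ▸ LinearMap.mem_range_self ι a

theorem IsDifferentialCalculus.monomial_mem (h : IsDifferentialCalculus R D ι) (a : A)
    (l : List A) : D.monomial ι a l ∈ D.deg l.length :=
  h.generated _ ▸ Submodule.subset_span ⟨a, l, rfl, rfl⟩

/-- Forms are spanned by monomials, and a monomial is a left fold, so the only inductive step is
right multiplication by some `da`; lists are accordingly taken apart from the end. -/
theorem IsDifferentialCalculus.induction_deg (h : IsDifferentialCalculus R D ι)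
    {p : ℕ → V → Prop} (zero : ∀ n, p n 0)
    (add : ∀ n x y, x ∈ D.deg n → y ∈ D.deg n → p n x → p n y → p n (x + y))
    (smul : ∀ n (c : k) x, x ∈ D.deg n → p n x → p n (c • x))
    (base : ∀ a, p 0 (ι a))
    (step : ∀ n x a, x ∈ D.deg n → p n x → p (n + 1) (D.mul x (D.d (ι a)))) :
    ∀ n x, x ∈ D.deg n → p n x := by
  intro n x hx
  have key : ∀ (a : A) (l : List A), p l.length (D.monomial ι a l) := by
    intro a l
    induction l using List.reverseRecOn with
    | nil => exact base a
    | append_singleton l b ih =>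
      rw [DGData.monomial_concat, List.length_append]
      exact step _ _ _ (h.monomial_mem a l) ih
  rw [h.generated] at hx
  have : x ∈ D.deg n ∧ p n x := by
    induction hx using Submodule.span_induction with
    | mem x hx =>
      obtain ⟨a, l, rfl, rfl⟩ := hx
      exact ⟨h.monomial_mem a l, key a l⟩
    | zero => exact ⟨zero_mem _, zero n⟩
    | add x y _ _ hx hy => exact ⟨add_mem hx.1 hy.1, add _ _ _ hx.1 hy.1 hx.2 hy.2⟩
    | smul c x _ hx => exact ⟨Submodule.smul_mem _ _ hx.1, smul _ _ _ hx.1 hx.2⟩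
  exact this.2

theorem IsDifferentialCalculus.submodule_eq_top (h : IsDifferentialCalculus R D ι)
    (S : Submodule k V) (base : ∀ a, ι a ∈ S) (step : ∀ x ∈ S, ∀ a, D.mul x (D.d (ι a)) ∈ S)
    (x : V) : x ∈ S := by
  induction x using isInternal_induction h.isDGA.internal with
  | add x y hx hy => exact add_mem hx hy
  | hom n x hx =>
    exact h.induction_deg (p := fun _ x => x ∈ S) (fun _ => zero_mem _)
      (fun _ _ _ _ _ => add_mem) (fun _ c _ _ => Submodule.smul_mem _ c) base
      (fun _ x a _ hx => step x hx a) n x hx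

/-- Two multiplicative maps on a differential calculus are equal if they agree on `a` and `da`. -/
theorem IsDifferentialCalculus.hom_ext (h : IsDifferentialCalculus R D ι) {f g : V →ₗ[k] X}
    (m : X →ₗ[k] X →ₗ[k] X) (hf : ∀ x y, f (D.mul x y) = m (f x) (f y))
    (hg : ∀ x y, g (D.mul x y) = m (g x) (g y)) (h0 : ∀ a, f (ι a) = g (ι a))
    (h1 : ∀ a, f (D.d (ι a)) = g (D.d (ι a))) : f = g := by
  ext x
  refine h.submodule_eq_top (LinearMap.eqLocus f g) h0 (fun x hx a => ?_) x
  rw [LinearMap.mem_eqLocus] at hx ⊢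
  rw [hf, hg, hx, h1]

/-- The value on `da` is forced by the value on `a`, and these elements generate. This uniqueness
replaces computations with forms by computations in H or in B ♯_σ H. -/
theorem IsDGHom.ext {D' : DGData k X} (h : IsDifferentialCalculus R D ι) {f g : V →ₗ[k] X}
    (hf : IsDGHom D D' f) (hg : IsDGHom D D' g) (h0 : ∀ a, f (ι a) = g (ι a)) : f = g :=
  h.hom_ext D'.mul hf.map_mul hg.map_mul h0 fun a => by rw [hf.map_d, hg.map_d, h0]

theorem DGData.IsDGA.d_one (h : D.IsDGA) : D.d D.one = 0 := by
  have h1 := h.leibniz 0 D.one D.one h.one_mem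
  simpa [h.one_mul, h.mul_one] using h1

end Generation

/-! ### Convolution -/

section Conv

variable {k : Type*} [Field k]
variable {A : Type*} [AddCommGroup A] [Module k A]
variable {A' : Type*} [AddCommGroup A'] [Module k A']
variable {C : Type*} [AddCommGroup C] [Module k C] [Coalgebra k C]
variable {C' : Type*} [AddCommGroup C'] [Module k C'] [Coalgebra k C']
variable {m : A →ₗ[k] A →ₗ[k] A} {m' : A' →ₗ[k] A' →ₗ[k] A'}

theorem conv_apply (m : A →ₗ[k] A →ₗ[k] A) (f g : C →ₗ[k] A) (c : C) :
    conv m f g c = TensorProduct.lift m (TensorProduct.map f g (Coalgebra.comul c)) := rfl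

/-- Coassociativity of the source and associativity of the target make Hom(C, A) an associative
algebra. Sweedler identities become equations there, with C one of H, H ⊗ H and H ⊗ H ⊗ H. -/
theorem conv_assoc (hm : ∀ x y z, m (m x y) z = m x (m y z)) (f g h : C →ₗ[k] A) :
    conv m (conv m f g) h = conv m f (conv m g h) := by
  have key : ∀ t : (C ⊗[k] C) ⊗[k] C,
      TensorProduct.lift m (TensorProduct.map (TensorProduct.lift m ∘ₗ TensorProduct.map f g) h t) =
        TensorProduct.lift m (TensorProduct.map f (TensorProduct.lift m ∘ₗ TensorProduct.map g h)
          (TensorProduct.assoc k C C C t)) := by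
    intro t
    induction t with
    | zero => simp
    | add x y hx hy => simp only [map_add, hx, hy]
    | tmul t c =>
      induction t with
      | zero => simp
      | add x y hx hy => simp only [TensorProduct.add_tmul, map_add, hx, hy]
      | tmul a b => simp [hm]
  ext c
  have h1 := key (LinearMap.rTensor C Coalgebra.comul (Coalgebra.comul c))
  rw [Coalgebra.coassoc_apply] at h1
  rw [LinearMap.map_rTensor, LinearMap.map_lTensor] at h1
  exact h1

theorem conv_counit {e : A} (he : ∀ x, m x e = x) (f : C →ₗ[k] A) :
    conv m f (Coalgebra.counit.smulRight e) = f := by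
  ext c
  have key : ∀ t : C ⊗[k] C, TensorProduct.lift m
      (TensorProduct.map f ((Coalgebra.counit (R := k) (A := C)).smulRight e) t) =
        f (TensorProduct.rid k C (LinearMap.lTensor C Coalgebra.counit t)) := by
    intro t
    induction t with
    | zero => simp
    | add x y hx hy => simp only [map_add, hx, hy]
    | tmul a b => simp [he]
  rw [conv_apply, key, Coalgebra.lTensor_counit_comul, TensorProduct.rid_tmul, one_smul]

theorem counit_conv {e : A} (he : ∀ x, m e x = x) (f : C →ₗ[k] A) :
    conv m (Coalgebra.counit.smulRight e) f = f := by
  ext c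
  have key : ∀ t : C ⊗[k] C, TensorProduct.lift m
      (TensorProduct.map ((Coalgebra.counit (R := k) (A := C)).smulRight e) f t) =
        f (TensorProduct.lid k C (LinearMap.rTensor C Coalgebra.counit t)) := by
    intro t
    induction t with
    | zero => simp
    | add x y hx hy => simp only [map_add, hx, hy]
    | tmul a b => simp [he]
  rw [conv_apply, key, Coalgebra.rTensor_counit_comul, TensorProduct.lid_tmul, one_smul]

/-- Pulling back along a coalgebra map is multiplicative for convolution. It is applied to the
multiplication H ⊗ H → H and to the associator, among others. -/
theorem conv_comp_coalgHom (m : A →ₗ[k] A →ₗ[k] A) (f g : C' →ₗ[k] A) (φ : C →ₗc[k] C') :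
    conv m f g ∘ₗ φ.toLinearMap = conv m (f ∘ₗ φ.toLinearMap) (g ∘ₗ φ.toLinearMap) := by
  simp only [conv, LinearMap.comp_assoc, TensorProduct.map_comp]
  rw [← φ.map_comp_comul]

theorem comp_conv {F : A →ₗ[k] A'} (hF : ∀ x y, F (m x y) = m' (F x) (F y)) (f g : C →ₗ[k] A) :
    F ∘ₗ conv m f g = conv m' (F ∘ₗ f) (F ∘ₗ g) := by
  ext c
  simp only [LinearMap.comp_apply, conv_apply]
  induction (Coalgebra.comul c : C ⊗[k] C) with
  | zero => simp
  | add x y hx hy => simp only [map_add, hx, hy]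
  | tmul a b => simp [hF]

theorem conv_add_left (m : A →ₗ[k] A →ₗ[k] A) (f f' g : C →ₗ[k] A) :
    conv m (f + f') g = conv m f g + conv m f' g := by
  ext c; simp [conv_apply, TensorProduct.map_add_left]

theorem conv_add_right (m : A →ₗ[k] A →ₗ[k] A) (f g g' : C →ₗ[k] A) :
    conv m f (g + g') = conv m f g + conv m f g' := by
  ext c; simp [conv_apply, TensorProduct.map_add_right]

theorem conv_smul_left (m : A →ₗ[k] A →ₗ[k] A) (a : k) (f g : C →ₗ[k] A) :
    conv m (a • f) g = a • conv m f g := by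
  ext c; simp [conv_apply, TensorProduct.map_smul_left]

theorem conv_smul_right (m : A →ₗ[k] A →ₗ[k] A) (a : k) (f g : C →ₗ[k] A) :
    conv m f (a • g) = a • conv m f g := by
  ext c; simp [conv_apply, TensorProduct.map_smul_right]

theorem conv_zero_right (m : A →ₗ[k] A →ₗ[k] A) (f : C →ₗ[k] A) : conv m f 0 = 0 := by
  ext c; simp [conv_apply]

theorem conv_mem {D : DGData k A} (hD : D.IsDGA) {i j : ℕ} {f g : C →ₗ[k] A}
    (hf : ∀ c, f c ∈ D.deg i) (hg : ∀ c, g c ∈ D.deg j) (c : C) :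
    conv D.mul f g c ∈ D.deg (i + j) := by
  rw [conv_apply]
  induction (Coalgebra.comul c : C ⊗[k] C) with
  | zero => simp
  | add x y hx hy => simp only [map_add]; exact add_mem hx hy
  | tmul a b => simpa using hD.mul_mem _ _ _ _ (hf a) (hg b)

theorem d_comp_conv {D : DGData k A} (hD : D.IsDGA) {n : ℕ} {f : C →ₗ[k] A}
    (hf : ∀ c, f c ∈ D.deg n) (g : C →ₗ[k] A) :
    D.d ∘ₗ conv D.mul f g =
      conv D.mul (D.d ∘ₗ f) g + (-1 : k) ^ n • conv D.mul f (D.d ∘ₗ g) := by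
  ext c
  simp only [LinearMap.comp_apply, conv_apply, LinearMap.add_apply, LinearMap.smul_apply]
  induction (Coalgebra.comul c : C ⊗[k] C) with
  | zero => simp
  | add x y hx hy => simp only [map_add, hx, hy, smul_add]; abel
  | tmul a b => simp [hD.leibniz _ _ _ (hf a)]

end Conv

/-! ### Twisted module calculi -/

section Twisted

variable {k : Type*} [Field k]
variable {H : Type*} [Ring H] [HopfAlgebra k H]
variable {B : Type*} [Ring B] [Algebra k B]
variable {A : Type*} [AddCommGroup A] [Module k A]
variable {V : Type*} [AddCommGroup V] [Module k V]

/-- A differential graded algebra which is a `σ`-twisted module, with a closed cocycle. -/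
structure IsTwistedDGA (D : DGData k V) (act : H →ₗ[k] V →ₗ[k] V) (σ σInv : H ⊗[k] H →ₗ[k] V) :
    Prop where
  isDGA : D.IsDGA
  act_mem : ∀ h n x, x ∈ D.deg n → act h x ∈ D.deg n
  act_one : ∀ h, act h D.one = Coalgebra.counit (R := k) h • D.one
  act_mul : ∀ x y, act.flip (D.mul x y) = conv D.mul (act.flip x) (act.flip y)
  one_act : ∀ x, act 1 x = x
  d_act : ∀ h x, D.d (act h x) = act h (D.d x)
  σ_mem : ∀ t, σ t ∈ D.deg 0
  σInv_mem : ∀ t, σInv t ∈ D.deg 0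
  d_σ : ∀ t, D.d (σ t) = 0
  σ_one_right : ∀ h, σ (h ⊗ₜ 1) = Coalgebra.counit (R := k) h • D.one
  σ_one_left : ∀ h, σ (1 ⊗ₜ h) = Coalgebra.counit (R := k) h • D.one
  σInv_conv_σ : conv D.mul σInv σ = Coalgebra.counit.smulRight D.one
  cocycle :
    conv D.mul (TensorProduct.lift act ∘ₗ TensorProduct.map LinearMap.id σ)
        (σ ∘ₗ TensorProduct.map LinearMap.id (LinearMap.mul' k H)) =
      conv D.mul
        ((TensorProduct.rid k V).toLinearMap ∘ₗ TensorProduct.map σ Coalgebra.counit ∘ₗ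
          (TensorProduct.assoc k H H H).symm.toLinearMap)
        (σ ∘ₗ TensorProduct.map (LinearMap.mul' k H) LinearMap.id ∘ₗ
          (TensorProduct.assoc k H H H).symm.toLinearMap)
  twisted : ∀ x,
    conv D.mul (TensorProduct.lift act ∘ₗ TensorProduct.map LinearMap.id (act.flip x)) σ =
      conv D.mul σ (act.flip x ∘ₗ LinearMap.mul' k H)

theorem IsDifferentialCalculus.monomial_induction {R : AlgData k A} {D : DGData k V}
    {ι : A →ₗ[k] V} (h : IsDifferentialCalculus R D ι) {p : V → Prop}
    (add : ∀ x y, p x → p y → p (x + y)) (smul : ∀ (c : k) x, p x → p (c • x))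
    (mono : ∀ a l, p (D.monomial ι a l)) (x : V) : p x := by
  induction x using isInternal_induction h.isDGA.internal with
  | add x y hx hy => exact add x y hx hy
  | hom n x hx =>
    rw [h.generated] at hx
    induction hx using Submodule.span_induction with
    | mem x hx => obtain ⟨a, l, -, rfl⟩ := hx; exact mono a l
    | zero => simpa using smul 0 _ (mono 0 [])
    | add x y _ _ hx hy => exact add x y hx hy
    | smul c x _ hx => exact smul c x hx

theorem IsDifferentialCalculus.induction {R : AlgData k A} {D : DGData k V}
    {ι : A →ₗ[k] V} (h : IsDifferentialCalculus R D ι) {p : V → Prop}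
    (add : ∀ x y, p x → p y → p (x + y)) (smul : ∀ (c : k) x, p x → p (c • x))
    (base : ∀ a, p (ι a)) (step : ∀ x a, p x → p (D.mul x (D.d (ι a)))) (x : V) : p x := by
  refine h.monomial_induction add smul (fun a l => ?_) x
  induction l using List.reverseRecOn with
  | nil => exact base a
  | append_singleton l b ih => rw [DGData.monomial_concat]; exact step _ _ ih

variable {T : TwistedModule k H B} {D : DGData k V} {ι : B →ₗ[k] V} {actV : H →ₗ[k] V →ₗ[k] V}

theorem IsTwistedCalculus.flip_ι (h : IsTwistedCalculus T D ι actV) (b : B) :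
    actV.flip (ι b) = ι ∘ₗ T.act.flip b := by
  ext x; simp [h.act_zero]

theorem IsTwistedCalculus.flip_d_ι (h : IsTwistedCalculus T D ι actV) (b : B) :
    actV.flip (D.d (ι b)) = D.d ∘ₗ ι ∘ₗ T.act.flip b := by
  ext x; simp [h.act_d]

theorem IsDifferentialCalculus.comp_conv_of {C : Type*} [AddCommGroup C] [Module k C]
    [Coalgebra k C] (hD : IsDifferentialCalculus (AlgData.of k B) D ι) (f g : C →ₗ[k] B) :
    ι ∘ₗ conv (LinearMap.mul k B) f g = conv D.mul (ι ∘ₗ f) (ι ∘ₗ g) :=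
  comp_conv (fun x y => hD.map_mul x y) f g

/-- Appending `b` to a monomial appends one convolution factor to the fold in `act_monomial`. -/
theorem IsTwistedCalculus.act_mul_d (hD : IsDifferentialCalculus (AlgData.of k B) D ι)
    (h : IsTwistedCalculus T D ι actV) (x : V) (b : B) :
    actV.flip (D.mul x (D.d (ι b))) = conv D.mul (actV.flip x) (actV.flip (D.d (ι b))) := by
  induction x using hD.monomial_induction with
  | add x y hx hy => simp only [map_add, LinearMap.add_apply, hx, hy, conv_add_left]
  | smul c x hx => simp only [map_smul, LinearMap.smul_apply, hx, conv_smul_left]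
  | mono a l => rw [← DGData.monomial_concat, h.act_monomial, h.act_monomial]; simp

/-- Monomials are not visibly closed under right multiplication by functions. The Leibniz rule (x
da)b + (xa)db = x d(ab) expresses the unknown term through products ending in an exact form, where
`act_mul_d` applies; the common summand is then cancelled. -/
theorem IsTwistedCalculus.act_mul_ι (hD : IsDifferentialCalculus (AlgData.of k B) D ι)
    (h : IsTwistedCalculus T D ι actV) (x : V) (b : B) :
    actV.flip (D.mul x (ι b)) = conv D.mul (actV.flip x) (actV.flip (ι b)) := by
  have hι : ∀ a b, actV.flip (ι (a * b)) = conv D.mul (actV.flip (ι a)) (actV.flip (ι b)) := by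
    intro a b
    rw [h.flip_ι, T.act_mul, hD.comp_conv_of, h.flip_ι, h.flip_ι]
  have hmul : ∀ a b, ι (a * b) = D.mul (ι a) (ι b) := fun a b => hD.map_mul a b
  induction x using hD.induction generalizing b with
  | add x y hx hy => simp only [map_add, LinearMap.add_apply, hx, hy, conv_add_left]
  | smul c x hx => simp only [map_smul, LinearMap.smul_apply, hx, conv_smul_left]
  | base a => rw [← hmul, hι]
  | step x a hx =>
    have e : D.mul (D.mul x (D.d (ι a))) (ι b) + D.mul (D.mul x (ι a)) (D.d (ι b)) =
        D.mul x (D.d (ι (a * b))) := by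
      rw [hmul, hD.isDGA.leibniz 0 _ _ (hD.ι_mem a), hD.isDGA.mul_assoc, hD.isDGA.mul_assoc]
      simp
    have e' : actV.flip (D.d (ι (a * b))) =
        conv D.mul (actV.flip (D.d (ι a))) (actV.flip (ι b)) +
          conv D.mul (actV.flip (ι a)) (actV.flip (D.d (ι b))) := by
      rw [h.flip_d_ι, T.act_mul, hD.comp_conv_of,
        d_comp_conv hD.isDGA (n := 0) (C := H) (fun c => hD.ι_mem _), h.flip_d_ι, h.flip_d_ι, h.flip_ι,
        h.flip_ι, pow_zero, one_smul]
    have e1 := congrArg actV.flip e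
    rw [map_add, h.act_mul_d hD, h.act_mul_d hD, hx, e', conv_add_right,
      conv_assoc hD.isDGA.mul_assoc] at e1
    rw [h.act_mul_d hD, conv_assoc hD.isDGA.mul_assoc]
    exact add_right_cancel e1

theorem IsTwistedCalculus.act_mul (hD : IsDifferentialCalculus (AlgData.of k B) D ι)
    (h : IsTwistedCalculus T D ι actV) (x y : V) :
    actV.flip (D.mul x y) = conv D.mul (actV.flip x) (actV.flip y) := by
  induction y using hD.induction with
  | add y z hy hz => simp only [map_add, hy, hz, conv_add_right]
  | smul c y hy => simp only [map_smul, hy, conv_smul_right]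
  | base b => exact h.act_mul_ι hD x b
  | step y b hy =>
    rw [← hD.isDGA.mul_assoc, h.act_mul_d hD, hy, h.act_mul_d hD, conv_assoc hD.isDGA.mul_assoc]

/-- The unit of H is grouplike, so it acts multiplicatively, and it acts trivially on each `b` and
`db`. -/
theorem IsTwistedCalculus.one_act (hD : IsDifferentialCalculus (AlgData.of k B) D ι)
    (h : IsTwistedCalculus T D ι actV) (x : V) : actV 1 x = x := by
  induction x using hD.induction with
  | add y z hy hz => simp only [map_add, hy, hz]
  | smul c y hy => simp only [map_smul, hy]
  | base b => rw [h.act_zero, T.one_act]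
  | step y b hy =>
    have e := LinearMap.congr_fun (h.act_mul_d hD y b) 1
    rw [conv_apply, Bialgebra.comul_one, Algebra.TensorProduct.one_def] at e
    simpa [hy, h.act_d, T.one_act] using e

/-- In the inductive step d(x db) = dx db, because d² = 0, and the action respects this product. -/
theorem IsTwistedCalculus.d_act (hD : IsDifferentialCalculus (AlgData.of k B) D ι)
    (h : IsTwistedCalculus T D ι actV) (a : H) (x : V) : D.d (actV a x) = actV a (D.d x) := by
  have key : ∀ n x, x ∈ D.deg n → D.d ∘ₗ actV.flip x = actV.flip (D.d x) := by
    refine hD.induction_deg (fun _ => by simp) ?_ ?_ ?_ ?_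
    · intro n x y _ _ hx hy
      simp only [map_add, LinearMap.comp_add, hx, hy]
    · intro n c x _ hx
      simp only [map_smul, LinearMap.comp_smul, hx]
    · intro b
      rw [h.flip_ι, h.flip_d_ι]
    · intro n x b hx ih
      have e : D.d ∘ₗ actV.flip (D.d (ι b)) = 0 := by
        rw [h.flip_d_ι]
        ext c
        exact hD.isDGA.d_d _
      rw [h.act_mul_d hD, d_comp_conv hD.isDGA (n := n) (C := H) (f := actV.flip x) (fun c => h.act_mem _ _ _ hx), e, ih,
        conv_zero_right, hD.isDGA.leibniz n _ _ hx, hD.isDGA.d_d, map_zero, smul_zero, smul_zero,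
        add_zero, add_zero, h.act_mul_d hD]
  induction x using isInternal_induction hD.isDGA.internal with
  | add y z hy hz => simp only [map_add, hy, hz]
  | hom n x hx => exact LinearMap.congr_fun (key n x hx) a

/-- `σ(h₁ ⊗ h'₁) ((h₂h'₂) · b) = (h₁ · (h'₁ · b)) σ(h₂ ⊗ h'₂)`. -/
theorem TwistedModule.twisted_conv_σ (T : TwistedModule k H B) (b : B) :
    conv (LinearMap.mul k B)
      (TensorProduct.lift T.act ∘ₗ TensorProduct.map LinearMap.id (T.act.flip b)) T.σ =
      conv (LinearMap.mul k B) T.σ (T.act.flip b ∘ₗ LinearMap.mul' k H) := by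
  have hm : ∀ x y z : B, LinearMap.mul k B (LinearMap.mul k B x y) z =
      LinearMap.mul k B x (LinearMap.mul k B y z) := fun x y z => mul_assoc x y z
  have e : Algebra.linearMap k B ∘ₗ (Coalgebra.counit : H ⊗[k] H →ₗ[k] k) =
      Coalgebra.counit.smulRight (1 : B) := by
    ext; simp [Algebra.smul_def]
  rw [T.twisted, conv_assoc hm, T.σInv_conv_σ, e]
  exact conv_counit (fun x => mul_one x) _

/-- Acting on a convolution product distributes over its factors, since the action measures the
product and `φ` preserves the comultiplication. -/
theorem lift_act_flip_mul {D : DGData k V} {act : H →ₗ[k] V →ₗ[k] V}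
    (hact : ∀ x y, act.flip (D.mul x y) = conv D.mul (act.flip x) (act.flip y))
    {C C' : Type*} [AddCommGroup C] [Module k C] [Coalgebra k C]
    [AddCommGroup C'] [Module k C'] [Coalgebra k C'] (φ : C' →ₗc[k] H) (f g : C →ₗ[k] V) :
    TensorProduct.lift act ∘ₗ TensorProduct.map φ.toLinearMap (conv D.mul f g) =
      conv D.mul (TensorProduct.lift act ∘ₗ TensorProduct.map φ.toLinearMap f)
        (TensorProduct.lift act ∘ₗ TensorProduct.map φ.toLinearMap g) := by
  ext x c
  simp only [TensorProduct.AlgebraTensorModule.curry_apply, LinearMap.restrictScalars_self,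
    TensorProduct.curry_apply, LinearMap.comp_apply, TensorProduct.map_tmul,
    TensorProduct.lift.tmul, conv_apply, TensorProduct.comul_tmul]
  induction (Coalgebra.comul c : C ⊗[k] C) with
  | zero => simp
  | add s t hs ht => simp only [map_add, TensorProduct.tmul_add, hs, ht]
  | tmul a b =>
    have e := LinearMap.congr_fun (hact (f a) (g b)) (φ x)
    simp only [conv_apply, LinearMap.flip_apply] at e
    simp only [TensorProduct.map_tmul, TensorProduct.lift.tmul]
    have e2 : (Coalgebra.comul (R := k) (φ.toLinearMap x)) =
      TensorProduct.map φ.toLinearMap φ.toLinearMap (Coalgebra.comul x) :=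
        (LinearMap.congr_fun φ.map_comp_comul x).symm
    refine e.trans ?_
    change TensorProduct.lift D.mul (TensorProduct.map (act.flip (f a)) (act.flip (g b))
      (Coalgebra.comul (R := k) (φ.toLinearMap x))) = _
    rw [e2]
    induction (Coalgebra.comul x : C' ⊗[k] C') with
    | zero => simp
    | add s t hs ht => simp only [map_add, TensorProduct.add_tmul, hs, ht]
    | tmul p q => simp

/-- With σ⁻¹ moved to the other side, the relation says that `σ` intertwines two maps x ↦ Hom(H ⊗ H,
Ω(B)), both multiplicative for convolution. Hence it needs checking only on `b` and `db`. -/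
theorem IsTwistedCalculus.twisted (hD : IsDifferentialCalculus (AlgData.of k B) D ι)
    (h : IsTwistedCalculus T D ι actV) (x : V) :
    conv D.mul (TensorProduct.lift actV ∘ₗ TensorProduct.map LinearMap.id (actV.flip x))
        (ι ∘ₗ T.σ) =
      conv D.mul (ι ∘ₗ T.σ) (actV.flip x ∘ₗ LinearMap.mul' k H) := by
  have hlift : TensorProduct.lift actV ∘ₗ TensorProduct.map LinearMap.id ι =
      ι ∘ₗ TensorProduct.lift T.act := by
    ext x b; simp [h.act_zero]
  have hlift' : TensorProduct.lift actV ∘ₗ TensorProduct.map LinearMap.id D.d =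
      D.d ∘ₗ TensorProduct.lift actV := by
    ext x b; simp [h.d_act hD]
  have hι : ∀ b, TensorProduct.lift actV ∘ₗ TensorProduct.map LinearMap.id (actV.flip (ι b)) =
      ι ∘ₗ TensorProduct.lift T.act ∘ₗ TensorProduct.map LinearMap.id (T.act.flip b) := by
    intro b
    rw [h.flip_ι, ← LinearMap.comp_id (LinearMap.id : H →ₗ[k] H), TensorProduct.map_comp,
      ← LinearMap.comp_assoc, LinearMap.comp_id, hlift, LinearMap.comp_assoc]
  have hdι : ∀ b, TensorProduct.lift actV ∘ₗ
      TensorProduct.map LinearMap.id (actV.flip (D.d (ι b))) =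
      D.d ∘ₗ TensorProduct.lift actV ∘ₗ TensorProduct.map LinearMap.id (actV.flip (ι b)) := by
    intro b
    rw [h.flip_d_ι, ← h.flip_ι, ← LinearMap.comp_id (LinearMap.id : H →ₗ[k] H),
      TensorProduct.map_comp, ← LinearMap.comp_assoc, LinearMap.comp_id, hlift',
      LinearMap.comp_assoc]
  have hd0 : D.d ∘ₗ ι ∘ₗ T.σ = 0 := by ext1; ext a b; exact h.d_σ _
  have base : ∀ b,
      conv D.mul (TensorProduct.lift actV ∘ₗ TensorProduct.map LinearMap.id (actV.flip (ι b)))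
        (ι ∘ₗ T.σ) =
      conv D.mul (ι ∘ₗ T.σ) (actV.flip (ι b) ∘ₗ LinearMap.mul' k H) := by
    intro b
    rw [hι, ← hD.comp_conv_of, T.twisted_conv_σ, hD.comp_conv_of, h.flip_ι, LinearMap.comp_assoc]
  have dbase : ∀ b,
      conv D.mul (TensorProduct.lift actV ∘ₗ
        TensorProduct.map LinearMap.id (actV.flip (D.d (ι b)))) (ι ∘ₗ T.σ) =
      conv D.mul (ι ∘ₗ T.σ) (actV.flip (D.d (ι b)) ∘ₗ LinearMap.mul' k H) := by
    intro b
    -- Differentiating the relation for `b` gives the relation for `db`, as the terms containing d ∘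
    -- σ vanish.
    have e := congrArg (D.d ∘ₗ ·) (base b)
    rw [d_comp_conv hD.isDGA (n := 0) (f := TensorProduct.lift actV ∘ₗ
        TensorProduct.map LinearMap.id (actV.flip (ι b))) ?_,
      d_comp_conv hD.isDGA (n := 0) (f := ι ∘ₗ T.σ) (fun c => hD.ι_mem _), hd0,
      conv_zero_right, smul_zero, add_zero, pow_zero, one_smul, ← hdι] at e
    · have h0 : conv D.mul 0 (actV.flip (ι b) ∘ₗ LinearMap.mul' k H) = 0 := by
        ext
        simp [conv_apply]
      rw [e, h0, zero_add, h.flip_d_ι, h.flip_ι]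
      rfl
    · intro c
      rw [hι]
      exact hD.ι_mem _
  induction x using hD.induction with
  | add y z hy hz =>
    simp only [map_add, TensorProduct.map_add_right, LinearMap.comp_add, LinearMap.add_comp,
      conv_add_left, conv_add_right, hy, hz]
  | smul c y hy =>
    simp only [map_smul, TensorProduct.map_smul_right, LinearMap.comp_smul, LinearMap.smul_comp,
      conv_smul_left, conv_smul_right, hy]
  | base b => exact base b
  | step y b hy =>
    have e1 := lift_act_flip_mul (h.act_mul hD) (CoalgHom.id k H) (actV.flip y)
      (actV.flip (D.d (ι b)))
    have e2 := conv_comp_coalgHom D.mul (actV.flip y) (actV.flip (D.d (ι b)))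
      (Bialgebra.mulCoalgHom k H)
    change TensorProduct.lift actV ∘ₗ TensorProduct.map LinearMap.id _ = conv D.mul
      (TensorProduct.lift actV ∘ₗ TensorProduct.map LinearMap.id _)
      (TensorProduct.lift actV ∘ₗ TensorProduct.map LinearMap.id _) at e1
    change conv D.mul _ _ ∘ₗ LinearMap.mul' k H =
      conv D.mul (_ ∘ₗ LinearMap.mul' k H) (_ ∘ₗ LinearMap.mul' k H) at e2
    rw [h.act_mul_d hD, e1, e2, conv_assoc hD.isDGA.mul_assoc, dbase,
      ← conv_assoc hD.isDGA.mul_assoc, hy, conv_assoc hD.isDGA.mul_assoc]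

theorem IsTwistedCalculus.isTwistedDGA (hD : IsDifferentialCalculus (AlgData.of k B) D ι)
    (h : IsTwistedCalculus T D ι actV) :
    IsTwistedDGA D actV (ι ∘ₗ T.σ) (ι ∘ₗ T.σInv) := by
  have hone : ∀ c : k, ι (algebraMap k B c) = c • D.one := by
    intro c
    rw [Algebra.algebraMap_eq_smul_one, map_smul]
    exact congrArg (c • ·) hD.map_one
  have hι1 : ι 1 = D.one := hD.map_one
  exact
  { isDGA := hD.isDGA
    act_mem := h.act_mem
    act_one := fun a => by rw [← hι1, h.act_zero, T.act_one, hone, hι1]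
    act_mul := h.act_mul hD
    one_act := h.one_act hD
    d_act := h.d_act hD
    σ_mem := fun _ => hD.ι_mem _
    σInv_mem := fun _ => hD.ι_mem _
    d_σ := h.d_σ
    σ_one_right := fun a => by rw [LinearMap.comp_apply, T.σ_one_right, hone]
    σ_one_left := fun a => by rw [LinearMap.comp_apply, T.σ_one_left, hone]
    σInv_conv_σ := by
      rw [← hD.comp_conv_of, T.σInv_conv_σ]
      ext
      simp [Algebra.algebraMap_eq_smul_one, hι1]
    cocycle := by
      have e := congrArg (ι ∘ₗ ·) T.cocycle
      rw [hD.comp_conv_of, hD.comp_conv_of] at e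
      convert e using 2
      · ext; simp [h.act_zero]
      · rfl
      · ext; simp
      · rfl
    twisted := h.twisted hD }

end Twisted

/-! ### Elements of the form F(c₁) ⊗ g(c₂), and convolution with counits. -/

section Smash

variable {k : Type*} [Field k]
variable {C : Type*} [AddCommGroup C] [Module k C] [Coalgebra k C]
variable {C' : Type*} [AddCommGroup C'] [Module k C'] [Coalgebra k C']
variable {V : Type*} [AddCommGroup V] [Module k V]
variable {Y : Type*} [AddCommGroup Y] [Module k Y]

/-- `c ⊗ c' ↦ f(c) ε(c')`. -/
def fstMap {X : Type*} [AddCommGroup X] [Module k X] (C' : Type*) [AddCommGroup C'] [Module k C']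
    [Coalgebra k C'] (f : X →ₗ[k] V) : X ⊗[k] C' →ₗ[k] V :=
  (TensorProduct.rid k V).toLinearMap ∘ₗ TensorProduct.map f Coalgebra.counit

@[simp]
theorem fstMap_tmul {X : Type*} [AddCommGroup X] [Module k X] (f : X →ₗ[k] V) (x : X) (c : C) :
    fstMap C f (x ⊗ₜ c) = Coalgebra.counit (R := k) c • f x := by
  simp [fstMap]

theorem fstMap_add {X : Type*} [AddCommGroup X] [Module k X] (f g : X →ₗ[k] V) :
    fstMap C (f + g) = fstMap C f + fstMap C g := by
  simp only [fstMap, TensorProduct.map_add_left, LinearMap.comp_add]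

theorem fstMap_smul {X : Type*} [AddCommGroup X] [Module k X] (a : k) (f : X →ₗ[k] V) :
    fstMap C (a • f) = a • fstMap C f := by
  simp only [fstMap, TensorProduct.map_smul_left, LinearMap.comp_smul]

/-- `fstMap` is pullback along id ⊗ ε, and only the counit law in the second factor is needed to
preserve convolution. -/
theorem fstMap_conv (m : V →ₗ[k] V →ₗ[k] V) (f g : C →ₗ[k] V) :
    fstMap C' (conv m f g) = conv m (fstMap C' f) (fstMap C' g) := by
  ext x y
  simp only [TensorProduct.AlgebraTensorModule.curry_apply, LinearMap.restrictScalars_self,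
    TensorProduct.curry_apply, fstMap_tmul, conv_apply, TensorProduct.comul_tmul]
  have key : ∀ (s : C ⊗[k] C) (t : C' ⊗[k] C'),
      TensorProduct.lift m (TensorProduct.map (fstMap C' f) (fstMap C' g)
        (TensorProduct.AlgebraTensorModule.tensorTensorTensorComm k k k k C C C' C' (s ⊗ₜ t))) =
      Coalgebra.counit (R := k) (TensorProduct.lid k C' (LinearMap.rTensor C' Coalgebra.counit t)) •
        TensorProduct.lift m (TensorProduct.map f g s) := by
    intro s t
    induction s with
    | zero => simp
    | add s s' hs hs' => simp only [TensorProduct.add_tmul, map_add, hs, hs', smul_add]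
    | tmul a b =>
      induction t with
      | zero => simp
      | add s s' hs hs' => simp only [TensorProduct.tmul_add, map_add, hs, hs', add_smul]
      | tmul a' b' => simp [smul_smul, mul_comm]
  rw [key, Coalgebra.rTensor_counit_comul, TensorProduct.lid_tmul, one_smul]

/-- `c ↦ F(c₁) ⊗ g(c₂)`. -/
def coSmash (F : C →ₗ[k] V) (g : C →ₗ[k] Y) : C →ₗ[k] V ⊗[k] Y :=
  TensorProduct.map F g ∘ₗ Coalgebra.comul

theorem coSmash_apply (F : C →ₗ[k] V) (g : C →ₗ[k] Y) (c : C) :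
    coSmash F g c = TensorProduct.map F g (Coalgebra.comul c) := rfl

theorem coSmash_comp_coalgHom (F : C' →ₗ[k] V) (g : C' →ₗ[k] Y) (φ : C →ₗc[k] C') :
    coSmash F g ∘ₗ φ.toLinearMap = coSmash (F ∘ₗ φ.toLinearMap) (g ∘ₗ φ.toLinearMap) := by
  simp only [coSmash, LinearMap.comp_assoc, TensorProduct.map_comp]
  rw [← φ.map_comp_comul]

/-- Every pure tensor is of the form F(c₁) ⊗ g(c₂) with F = ε(·)v. This family, unlike pure tensors,
is stable under the crossed product. -/
theorem tmul_eq_coSmash (v : V) (c : C) :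
    v ⊗ₜ[k] c = coSmash (Coalgebra.counit.smulRight v) LinearMap.id c := by
  have key : ∀ t : C ⊗[k] C,
      TensorProduct.map ((Coalgebra.counit (R := k) (A := C)).smulRight v) LinearMap.id t =
        v ⊗ₜ[k] TensorProduct.lid k C (LinearMap.rTensor C Coalgebra.counit t) := by
    intro t
    induction t with
    | zero => simp
    | add s t hs ht => simp only [map_add, TensorProduct.tmul_add, hs, ht]
    | tmul a b => simp [TensorProduct.smul_tmul]
  rw [coSmash_apply, key, Coalgebra.rTensor_counit_comul, TensorProduct.lid_tmul, one_smul]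

/-- Coassociativity in the form Q(c₁, c₂) ⊗ g(c₃): the first two legs may come from splitting the
first leg or the last two from splitting the second. -/
theorem map_lift_coassoc (Q : C →ₗ[k] C →ₗ[k] V) (g : C →ₗ[k] Y) (c : C) :
    TensorProduct.map (TensorProduct.lift Q) g ((TensorProduct.assoc k C C C).symm
      (LinearMap.lTensor C Coalgebra.comul (Coalgebra.comul c))) =
      TensorProduct.map (TensorProduct.lift Q ∘ₗ Coalgebra.comul) g (Coalgebra.comul c) := by
  rw [← Coalgebra.coassoc_apply, LinearEquiv.symm_apply_apply, LinearMap.map_rTensor]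

end Smash

/-! ### The crossed product formula in terms of convolution. -/

section Crossed

variable {k : Type*} [Field k]
variable {H : Type*} [Ring H] [HopfAlgebra k H]
variable {V : Type*} [AddCommGroup V] [Module k V]
variable {W : Type*} [AddCommGroup W] [Module k W]

/-- `h ⊗ h' ↦ v (h₁ · v') σ(h₂ ⊗ h')`. -/
def crossedCocycle (m : V →ₗ[k] V →ₗ[k] V) (act : H →ₗ[k] V →ₗ[k] V) (σ : H ⊗[k] H →ₗ[k] V) :
    V →ₗ[k] V →ₗ[k] H ⊗[k] H →ₗ[k] V :=
  LinearMap.mk₂ k (fun v v' => m v ∘ₗ conv m (fstMap H (act.flip v')) σ)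
    (fun _ _ _ => by rw [map_add, LinearMap.add_comp])
    (fun _ _ _ => by rw [map_smul, LinearMap.smul_comp])
    (fun _ _ _ => by rw [map_add, fstMap_add, conv_add_left, LinearMap.comp_add])
    (fun _ _ _ => by rw [map_smul, fstMap_smul, conv_smul_left, LinearMap.comp_smul])

theorem crossedCocycle_eq (m : V →ₗ[k] V →ₗ[k] V) (act : H →ₗ[k] V →ₗ[k] V)
    (σ : H ⊗[k] H →ₗ[k] V) (v v' : V) :
    crossedCocycle m act σ v v' = m v ∘ₗ conv m (fstMap H (act.flip v')) σ := rfl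

/-- The coproduct of `c'` collapses because its first leg meets only the counit, so only `c` is
split. -/
theorem conv_fstMap_tmul {C C' : Type*} [AddCommGroup C] [Module k C] [Coalgebra k C]
    [AddCommGroup C'] [Module k C'] [Coalgebra k C']
    (m : V →ₗ[k] V →ₗ[k] V) (f : C →ₗ[k] V) (σ : C ⊗[k] C' →ₗ[k] V) (c : C) (c' : C') :
    conv m (fstMap C' f) σ (c ⊗ₜ c') =
      TensorProduct.lift m (TensorProduct.map f
        (σ ∘ₗ (TensorProduct.mk k C C').flip c') (Coalgebra.comul c)) := by
  have key : ∀ (s : C ⊗[k] C) (t : C' ⊗[k] C'),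
      TensorProduct.lift m (TensorProduct.map (fstMap C' f) σ
        (TensorProduct.AlgebraTensorModule.tensorTensorTensorComm k k k k C C C' C' (s ⊗ₜ t))) =
      TensorProduct.lift m (TensorProduct.map f (σ ∘ₗ (TensorProduct.mk k C C').flip
        (TensorProduct.lid k C' (LinearMap.rTensor C' Coalgebra.counit t))) s) := by
    intro s t
    induction s with
    | zero => simp
    | add s s' hs hs' => simp only [TensorProduct.add_tmul, map_add, hs, hs']
    | tmul a b =>
      induction t with
      | zero => simp
      | add s s' hs hs' =>
        simp only [TensorProduct.tmul_add, map_add, hs, hs', LinearMap.comp_add,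
          TensorProduct.map_add_right, LinearMap.add_apply]
      | tmul a' b' => simp
  rw [conv_apply, TensorProduct.comul_tmul, key, Coalgebra.rTensor_counit_comul,
    TensorProduct.lid_tmul, one_smul]

theorem crossedKernel_comul {m : V →ₗ[k] V →ₗ[k] V} (hm : ∀ x y z, m (m x y) z = m x (m y z))
    (act : H →ₗ[k] V →ₗ[k] V) (σ : H ⊗[k] H →ₗ[k] V) (v v' : V) (h h' : H) :
    crossedKernel m act σ ((v ⊗ₜ Coalgebra.comul h) ⊗ₜ (v' ⊗ₜ h')) =
      crossedCocycle m act σ v v' (h ⊗ₜ h') := by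
  rw [crossedCocycle_eq, LinearMap.comp_apply, conv_fstMap_tmul]
  induction (Coalgebra.comul h : H ⊗[k] H) with
  | zero => simp
  | add s t hs ht => simp only [TensorProduct.tmul_add, TensorProduct.add_tmul, map_add, hs, ht]
  | tmul a b => simp [crossedKernel_tmul, hm]

/-- This form keeps the two coactions as unexpanded tensors, so identities can be proved for
arbitrary elements of H ⊗ W before the coactions are inserted. -/
theorem crossedMul_tmul {m : V →ₗ[k] V →ₗ[k] V} (hm : ∀ x y z, m (m x y) z = m x (m y z))
    (act : H →ₗ[k] V →ₗ[k] V) (σ : H ⊗[k] H →ₗ[k] V) (mW : W →ₗ[k] W →ₗ[k] W)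
    (lco : W →ₗ[k] H ⊗[k] W) (v v' : V) (w w' : W) :
    crossedMul m act σ mW lco (v ⊗ₜ w) (v' ⊗ₜ w') =
      TensorProduct.map₂ (TensorProduct.curry (crossedCocycle m act σ v v')) mW (lco w)
        (lco w') := by
  simp only [crossedMul, TensorProduct.curry_apply, LinearMap.comp_apply, TensorProduct.map_tmul,
    LinearMap.id_apply]
  induction lco w with
  | zero => simp
  | add s t hs ht =>
    simp only [TensorProduct.tmul_add, TensorProduct.add_tmul, map_add, hs, ht,
      LinearMap.add_apply]
  | tmul a w =>
    induction lco w' with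
    | zero => simp
    | add s t hs ht =>
      simp only [TensorProduct.tmul_add, map_add, hs, ht]
    | tmul a' w' =>
      simp [crossedKernel_comul hm, TensorProduct.map₂_apply_tmul]

theorem map₂_comul {m : H →ₗ[k] H →ₗ[k] V} {g : H →ₗ[k] H →ₗ[k] W} (h h' : H) :
    TensorProduct.map₂ m g (Coalgebra.comul h) (Coalgebra.comul h') =
      coSmash (TensorProduct.lift m) (TensorProduct.lift g) (h ⊗ₜ[k] h') := by
  rw [coSmash_apply, TensorProduct.comul_tmul]
  induction (Coalgebra.comul h : H ⊗[k] H) with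
  | zero => simp
  | add s t hs ht => simp only [TensorProduct.add_tmul, map_add, hs, ht, LinearMap.add_apply]
  | tmul a b =>
    induction (Coalgebra.comul h' : H ⊗[k] H) with
    | zero => simp
    | add s t hs ht => simp only [TensorProduct.tmul_add, map_add, hs, ht]
    | tmul a' b' => simp [TensorProduct.map₂_apply_tmul]

theorem crossedMul_comul_tmul {m : V →ₗ[k] V →ₗ[k] V}
    (hm : ∀ x y z, m (m x y) z = m x (m y z))
    (act : H →ₗ[k] V →ₗ[k] V) (σ : H ⊗[k] H →ₗ[k] V) (v v' : V) (h h' : H) :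
    crossedMul m act σ (LinearMap.mul k H) Coalgebra.comul (v ⊗ₜ h) (v' ⊗ₜ h') =
      coSmash (crossedCocycle m act σ v v') (LinearMap.mul' k H) (h ⊗ₜ h') := by
  rw [crossedMul_tmul hm, map₂_comul]
  congr 1
  congr 1
  ext
  simp

variable {C : Type*} [AddCommGroup C] [Module k C] [Coalgebra k C]
variable {C' : Type*} [AddCommGroup C'] [Module k C'] [Coalgebra k C']

/-- A product of elements F(x₁) ⊗ g(x₂) and F'(y₁) ⊗ g'(y₂) is again of this form over C ⊗ C', with
first leg F(x₁)(g(x₂)·F'(y₁))σ(g(x₃) ⊗ g'(y₂)). Iterating it turns associativity of the crossed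
product into an equality of convolution products. -/
theorem crossedMul_coSmash {m : V →ₗ[k] V →ₗ[k] V}
    (hm : ∀ x y z, m (m x y) z = m x (m y z))
    (act : H →ₗ[k] V →ₗ[k] V) (σ : H ⊗[k] H →ₗ[k] V) (F : C →ₗ[k] V) (g : C →ₗc[k] H)
    (F' : C' →ₗ[k] V) (g' : C' →ₗc[k] H) (x : C) (y : C') :
    crossedMul m act σ (LinearMap.mul k H) Coalgebra.comul
        (coSmash F g.toLinearMap x) (coSmash F' g'.toLinearMap y) =
      coSmash
        (conv m (conv m (fstMap C' F) (TensorProduct.lift act ∘ₗ TensorProduct.map g.toLinearMap F'))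
          (σ ∘ₗ TensorProduct.map g.toLinearMap g'.toLinearMap))
        (LinearMap.mul' k H ∘ₗ TensorProduct.map g.toLinearMap g'.toLinearMap) (x ⊗ₜ[k] y) := by
  let φ : C ⊗[k] C' →ₗc[k] H ⊗[k] H := Coalgebra.TensorProduct.map g g'
  have hφ : ∀ z, φ z = TensorProduct.map g.toLinearMap g'.toLinearMap z := fun _ => rfl
  -- `Q` is the V-valued kernel before regrouping: coefficients in its first argument, the legs
  -- entering the action and `σ` in its second.
  let Q : C ⊗[k] C' →ₗ[k] C ⊗[k] C' →ₗ[k] V :=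
    LinearMap.lcomp k V φ.toLinearMap ∘ₗ
      TensorProduct.lift (crossedCocycle m act σ) ∘ₗ TensorProduct.map F F'
  -- `P`, and `R` built from it, omit the factor `σ`; regrouping by coassociativity splits it off
  -- the kernel `Q`.
  let P : V →ₗ[k] V →ₗ[k] C ⊗[k] C' →ₗ[k] V :=
    LinearMap.mk₂ k (fun v v' => m v ∘ₗ fstMap C' (act.flip v' ∘ₗ g.toLinearMap))
      (fun _ _ _ => by rw [map_add, LinearMap.add_comp])
      (fun _ _ _ => by rw [map_smul, LinearMap.smul_comp])
      (fun _ _ _ => by rw [map_add, LinearMap.add_comp, fstMap_add, LinearMap.comp_add])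
      (fun _ _ _ => by rw [map_smul, LinearMap.smul_comp, fstMap_smul, LinearMap.comp_smul])
  let R : C ⊗[k] C' →ₗ[k] C ⊗[k] C' →ₗ[k] V := TensorProduct.lift P ∘ₗ TensorProduct.map F F'
  have hR : TensorProduct.lift R ∘ₗ Coalgebra.comul =
      conv m (fstMap C' F) (TensorProduct.lift act ∘ₗ TensorProduct.map g.toLinearMap F') := by
    ext x y
    simp only [TensorProduct.AlgebraTensorModule.curry_apply, LinearMap.restrictScalars_self,
      TensorProduct.curry_apply, conv_apply, TensorProduct.comul_tmul, LinearMap.comp_apply]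
    have key : ∀ (s : C ⊗[k] C) (t : C' ⊗[k] C'),
        TensorProduct.lift R
          (TensorProduct.AlgebraTensorModule.tensorTensorTensorComm k k k k C C C' C' (s ⊗ₜ t)) =
        TensorProduct.lift m (TensorProduct.map F (act.flip (F'
          (TensorProduct.rid k C' (LinearMap.lTensor C' Coalgebra.counit t))) ∘ₗ
            g.toLinearMap) s) := by
      intro s t
      induction s with
      | zero => simp
      | add s s' hs hs' => simp only [TensorProduct.add_tmul, map_add, hs, hs']
      | tmul a b =>
        induction t with
        | zero => simp
        | add s s' hs hs' =>
          simp only [TensorProduct.tmul_add, map_add, hs, hs', LinearMap.add_comp,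
            TensorProduct.map_add_right, LinearMap.add_apply]
        | tmul a' b' => simp [R, P]
    rw [key, Coalgebra.lTensor_counit_comul, TensorProduct.rid_tmul, one_smul]
    have e := conv_fstMap_tmul m F
      (TensorProduct.lift act ∘ₗ TensorProduct.map g.toLinearMap F') x y
    rw [conv_apply, TensorProduct.comul_tmul] at e
    rw [e]
    congr 2
  have hQ : TensorProduct.lift Q ∘ₗ Coalgebra.comul =
      conv m (conv m (fstMap C' F) (TensorProduct.lift act ∘ₗ TensorProduct.map g.toLinearMap F'))
          (σ ∘ₗ TensorProduct.map g.toLinearMap g'.toLinearMap) := by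
    rw [← hR]
    refine LinearMap.ext fun z => ?_
    rw [conv_apply, ← map_lift_coassoc, LinearMap.comp_apply]
    induction (Coalgebra.comul z : (C ⊗[k] C') ⊗[k] (C ⊗[k] C')) with
    | zero => simp
    | add s t hs ht => simp only [map_add, hs, ht]
    | tmul a b =>
      simp only [TensorProduct.lift.tmul, LinearMap.lTensor_tmul]
      induction a with
      | zero => simp
      | add s t hs ht => simp only [map_add, TensorProduct.add_tmul, hs, ht, LinearMap.add_apply]
      | tmul p p' =>
        have e : Q (p ⊗ₜ p') b = m (F p) (conv m
            (fstMap C' (act.flip (F' p') ∘ₗ g.toLinearMap)) (σ ∘ₗ φ.toLinearMap) b) := by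
          have e1 := LinearMap.congr_fun
            (conv_comp_coalgHom m (fstMap H (act.flip (F' p'))) σ φ) b
          have e2 : fstMap H (act.flip (F' p')) ∘ₗ φ.toLinearMap =
              fstMap C' (act.flip (F' p') ∘ₗ g.toLinearMap) := by
            ext q q'
            simp [hφ]
          rw [e2] at e1
          rw [← e1]
          simp [Q, crossedCocycle_eq]
        rw [e, conv_apply]
        induction (Coalgebra.comul b : (C ⊗[k] C') ⊗[k] (C ⊗[k] C')) with
        | zero => simp
        | add s t hs ht => simp only [map_add, TensorProduct.tmul_add, hs, ht]
        | tmul q r => simp [R, P, hm, hφ]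
  rw [← hQ, coSmash_apply _ _ (x ⊗ₜ[k] y), ← map_lift_coassoc, TensorProduct.comul_tmul,
    coSmash_apply, coSmash_apply]
  induction (Coalgebra.comul x : C ⊗[k] C) with
  | zero => simp
  | add s t hs ht => simp only [map_add, TensorProduct.add_tmul, hs, ht, LinearMap.add_apply]
  | tmul a b =>
    induction (Coalgebra.comul y : C' ⊗[k] C') with
    | zero => simp
    | add s t hs ht => simp only [map_add, TensorProduct.tmul_add, hs, ht]
    | tmul a' b' =>
      rw [TensorProduct.map_tmul, TensorProduct.map_tmul, crossedMul_comul_tmul hm]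
      have e := LinearMap.congr_fun (coSmash_comp_coalgHom
        (crossedCocycle m act σ (F a) (F' a')) (LinearMap.mul' k H) φ) (b ⊗ₜ b')
      have e' : (coSmash (crossedCocycle m act σ (F a) (F' a')) (LinearMap.mul' k H))
        (g b ⊗ₜ g' b') = _ := e
      refine e'.trans ?_
      rw [coSmash_apply, TensorProduct.AlgebraTensorModule.tensorTensorTensorComm_tmul,
        LinearMap.lTensor_tmul]
      induction (Coalgebra.comul (b ⊗ₜ[k] b') : (C ⊗[k] C') ⊗[k] (C ⊗[k] C')) with
      | zero => simp
      | add s t hs ht => simp only [map_add, TensorProduct.tmul_add, hs, ht]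
      | tmul q r => simp [Q, hφ]

end Crossed

/-! ### Associativity of the crossed product with H, and the differential graded algebra Ω(B) ♯_σ H.
-/

section CrossedAlgebra

variable {k : Type*} [Field k]
variable {H : Type*} [Ring H] [HopfAlgebra k H]
variable {V : Type*} [AddCommGroup V] [Module k V]
variable {W : Type*} [AddCommGroup W] [Module k W]
variable {D : DGData k V} {act : H →ₗ[k] V →ₗ[k] V} {σ σInv : H ⊗[k] H →ₗ[k] V}
variable {E : DGData k W} {lco : W →ₗ[k] H ⊗[k] W}

/-- After cancelling the factors of `v` and h·v', the left side is σ(h ⊗ h')(hh'·v'')σ(hh' ⊗ h'')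
and the right side (h·(h'·v''))(h·σ(h' ⊗ h''))σ(h ⊗ h'h''), with coproduct legs suppressed. The
cocycle condition rewrites the last two factors as σ(h ⊗ h')σ(hh' ⊗ h''), and the twisted module
condition moves `v''` past σ(h ⊗ h'). -/
theorem crossed_assoc_conv (h : IsTwistedDGA D act σ σInv) (v v' v'' : V) :
    conv D.mul (conv D.mul
      (fstMap H (conv D.mul (conv D.mul (fstMap H (Coalgebra.counit.smulRight v))
        (TensorProduct.lift act ∘ₗ
          TensorProduct.map LinearMap.id (Coalgebra.counit.smulRight v'))) σ))
      (TensorProduct.lift act ∘ₗ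
        TensorProduct.map (LinearMap.mul' k H) (Coalgebra.counit.smulRight v'')))
      (σ ∘ₗ TensorProduct.map (LinearMap.mul' k H) LinearMap.id) =
    conv D.mul (conv D.mul (fstMap (H ⊗[k] H) (Coalgebra.counit.smulRight v))
      (TensorProduct.lift act ∘ₗ TensorProduct.map LinearMap.id
        (conv D.mul (conv D.mul (fstMap H (Coalgebra.counit.smulRight v'))
          (TensorProduct.lift act ∘ₗ
            TensorProduct.map LinearMap.id (Coalgebra.counit.smulRight v''))) σ)))
      (σ ∘ₗ TensorProduct.map LinearMap.id (LinearMap.mul' k H)) ∘ₗ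
      (Coalgebra.TensorProduct.assoc k k H H H).toCoalgHom.toLinearMap := by
  have hm := h.isDGA.mul_assoc
  have hlift : ∀ f g : H ⊗[k] H →ₗ[k] V,
      TensorProduct.lift act ∘ₗ TensorProduct.map LinearMap.id (conv D.mul f g) =
        conv D.mul (TensorProduct.lift act ∘ₗ TensorProduct.map LinearMap.id f)
          (TensorProduct.lift act ∘ₗ TensorProduct.map LinearMap.id g) :=
    fun f g => lift_act_flip_mul h.act_mul (CoalgHom.id k H) f g
  set α := (Coalgebra.TensorProduct.assoc k k H H H).toCoalgHom with hα
  have hαapp : ∀ t, α t = TensorProduct.assoc k H H H t := fun _ => rfl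
  have hcoc := congrArg (· ∘ₗ α.toLinearMap) h.cocycle
  simp only [conv_comp_coalgHom] at hcoc
  have htw := congrArg (fstMap H) (h.twisted v'')
  rw [fstMap_conv, fstMap_conv] at htw
  have e1 : fstMap H (fstMap H (Coalgebra.counit.smulRight v)) =
      fstMap (H ⊗[k] H) (Coalgebra.counit.smulRight v) ∘ₗ α.toLinearMap := by
    ext; simp [hαapp, smul_smul, mul_comm, mul_left_comm]
  have e2 : fstMap H (TensorProduct.lift act ∘ₗ
        TensorProduct.map LinearMap.id (Coalgebra.counit.smulRight v')) =
      (TensorProduct.lift act ∘ₗ TensorProduct.map LinearMap.id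
        (fstMap H (Coalgebra.counit.smulRight v'))) ∘ₗ α.toLinearMap := by
    ext; simp [hαapp]
  have e3 : fstMap H σ =
      ((TensorProduct.rid k V).toLinearMap ∘ₗ TensorProduct.map σ Coalgebra.counit ∘ₗ
          (TensorProduct.assoc k H H H).symm.toLinearMap) ∘ₗ α.toLinearMap := by
    ext; simp [hαapp]
  have e4 : TensorProduct.lift act ∘ₗ
        TensorProduct.map (LinearMap.mul' k H) (Coalgebra.counit.smulRight v'') =
      fstMap H (act.flip v'' ∘ₗ LinearMap.mul' k H) := by
    ext; simp
  have e5 : σ ∘ₗ TensorProduct.map (LinearMap.mul' k H) LinearMap.id =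
      (σ ∘ₗ TensorProduct.map (LinearMap.mul' k H) LinearMap.id ∘ₗ
          (TensorProduct.assoc k H H H).symm.toLinearMap) ∘ₗ α.toLinearMap := by
    ext; simp [hαapp]
  have e6 : (TensorProduct.lift act ∘ₗ TensorProduct.map LinearMap.id
        (TensorProduct.lift act ∘ₗ
          TensorProduct.map LinearMap.id (Coalgebra.counit.smulRight v''))) ∘ₗ α.toLinearMap =
      fstMap H (TensorProduct.lift act ∘ₗ TensorProduct.map LinearMap.id (act.flip v'')) := by
    ext; simp [hαapp]
  rw [← e3, ← e5] at hcoc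
  rw [hlift, hlift, fstMap_conv, fstMap_conv, e1, e2, e4]
  simp only [conv_comp_coalgHom]
  rw [e6]
  simp only [conv_assoc hm]
  -- The cocycle identity is used first and exposes the `σ` to which the twisted relation `htw`
  -- applies.
  rw [hcoc, ← conv_assoc hm (fstMap H σ) (fstMap H (act.flip v'' ∘ₗ _)), ← htw, conv_assoc hm]

theorem crossedMul_comul_assoc (h : IsTwistedDGA D act σ σInv) (x y z : V ⊗[k] H) :
    crossedMul D.mul act σ (LinearMap.mul k H) Coalgebra.comul
      (crossedMul D.mul act σ (LinearMap.mul k H) Coalgebra.comul x y) z =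
    crossedMul D.mul act σ (LinearMap.mul k H) Coalgebra.comul x
      (crossedMul D.mul act σ (LinearMap.mul k H) Coalgebra.comul y z) := by
  have hm := h.isDGA.mul_assoc
  induction x with
  | zero => simp
  | add s t hs ht => simp only [map_add, LinearMap.add_apply, hs, ht]
  | tmul v a =>
  induction y with
  | zero => simp
  | add s t hs ht => simp only [map_add, LinearMap.add_apply, hs, ht]
  | tmul v' a' =>
  induction z with
  | zero => simp
  | add s t hs ht => simp only [map_add, hs, ht]
  | tmul v'' a'' =>
    have e1 := crossedMul_coSmash hm act σ (Coalgebra.counit.smulRight v) (CoalgHom.id k H)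
      (Coalgebra.counit.smulRight v') (CoalgHom.id k H) a a'
    have e2 := crossedMul_coSmash hm act σ (Coalgebra.counit.smulRight v') (CoalgHom.id k H)
      (Coalgebra.counit.smulRight v'') (CoalgHom.id k H) a' a''
    have hid : (CoalgHom.id k H).toLinearMap = LinearMap.id := rfl
    rw [hid] at e1 e2
    rw [TensorProduct.map_id, LinearMap.comp_id, LinearMap.comp_id] at e1 e2
    rw [tmul_eq_coSmash v, tmul_eq_coSmash v', tmul_eq_coSmash v'', e1, e2]
    have e3 := crossedMul_coSmash hm act σ
      (conv D.mul (conv D.mul (fstMap H (Coalgebra.counit.smulRight v))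
        (TensorProduct.lift act ∘ₗ
          TensorProduct.map LinearMap.id (Coalgebra.counit.smulRight v'))) σ)
      (Bialgebra.mulCoalgHom k H) (Coalgebra.counit.smulRight v'') (CoalgHom.id k H)
      (a ⊗ₜ a') a''
    have e4 := crossedMul_coSmash hm act σ (Coalgebra.counit.smulRight v) (CoalgHom.id k H)
      (conv D.mul (conv D.mul (fstMap H (Coalgebra.counit.smulRight v'))
        (TensorProduct.lift act ∘ₗ
          TensorProduct.map LinearMap.id (Coalgebra.counit.smulRight v''))) σ)
      (Bialgebra.mulCoalgHom k H) a (a' ⊗ₜ a'')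
    have hmul : (Bialgebra.mulCoalgHom k H).toLinearMap = LinearMap.mul' k H := rfl
    rw [hmul, hid] at e3 e4
    rw [e3, e4, crossed_assoc_conv h]
    have e5 : LinearMap.mul' k H ∘ₗ TensorProduct.map (LinearMap.mul' k H) LinearMap.id =
        (LinearMap.mul' k H ∘ₗ TensorProduct.map LinearMap.id (LinearMap.mul' k H)) ∘ₗ
          (Coalgebra.TensorProduct.assoc k k H H H).toCoalgHom.toLinearMap := by
      ext a b c
      exact mul_assoc a b c
    -- The associator is a coalgebra map, hence passes through `coSmash`; both sides are then
    -- evaluated at the same a ⊗ (a' ⊗ a'').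
    rw [e5, ← coSmash_comp_coalgHom]
    rfl

/-! ### The crossed product of a twisted differential graded algebra and `H` -/

/-- The algebra `H`, concentrated in degree zero and with zero differential. -/
def trivialDG (k H : Type*) [Field k] [Ring H] [HopfAlgebra k H] : DGData k H where
  mul := LinearMap.mul k H
  one := 1
  deg n := if n = 0 then ⊤ else ⊥
  d := 0

theorem mem_trivialDG_deg (a : H) : a ∈ (trivialDG k H).deg 0 := by
  simp [trivialDG]

theorem trivialDG_eq_zero {n : ℕ} (hn : n ≠ 0) {a : H} (ha : a ∈ (trivialDG k H).deg n) :
    a = 0 := by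
  simpa [trivialDG, hn] using ha

theorem trivialDG_isInternal : DirectSum.IsInternal (trivialDG k H).deg := by
  refine isInternal_of_projections ?_ (fun n => if n = 0 then LinearMap.id else 0) ?_ ?_
  · rw [eq_top_iff]
    exact fun a _ => Submodule.mem_iSup_of_mem 0 (mem_trivialDG_deg a)
  · intro n x hx
    by_cases hn : n = 0
    · simp [hn]
    · simp [trivialDG_eq_zero hn hx]
  · intro m n hmn x hx
    by_cases hn : n = 0
    · subst hn
      simp [trivialDG_eq_zero hmn hx]
    · simp [hn]

theorem trivialDG_isDGA : (trivialDG k H).IsDGA where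
  mul_assoc x y z := mul_assoc x y z
  one_mul x := one_mul x
  mul_one x := mul_one x
  internal := trivialDG_isInternal
  one_mem := mem_trivialDG_deg 1
  mul_mem m n x y hx hy := by
    by_cases hm : m = 0
    · by_cases hn : n = 0
      · subst hm hn
        exact mem_trivialDG_deg _
      · rw [trivialDG_eq_zero hn hy, map_zero]
        exact zero_mem _
    · rw [trivialDG_eq_zero hm hx, map_zero]
      exact zero_mem _
  d_mem n x _ := zero_mem _
  d_d x := rfl
  leibniz n x y _ := by simp [trivialDG]

theorem tensorDeg_trivialDG_induction {degV : ℕ → Submodule k V} {n : ℕ}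
    {p : (x : V ⊗[k] H) → x ∈ tensorDeg degV (trivialDG k H).deg n → Prop}
    (tmul : ∀ v (hv : v ∈ degV n) a,
      p (v ⊗ₜ a) (tmul_mem_tensorDeg hv (mem_trivialDG_deg a) (add_zero n)))
    (add : ∀ x y hx hy, p x hx → p y hy → p (x + y) (add_mem hx hy)) {x : V ⊗[k] H}
    (hx : x ∈ tensorDeg degV (trivialDG k H).deg n) : p x hx := by
  induction hx using tensorDeg_induction with
  | tmul i j hij v hv a ha =>
    by_cases hj : j = 0
    · subst hj
      obtain rfl : i = n := hij
      exact tmul v hv a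
    · obtain rfl := trivialDG_eq_zero hj ha
      simpa using tmul 0 (zero_mem _) 0
  | add x y hx hy ihx ihy => exact add x y hx hy ihx ihy

/-- The second factor is entirely even, so no sign occurs. -/
theorem koszul_trivialDG {degV : ℕ → Submodule k V}
    (m : (V ⊗[k] H) →ₗ[k] (V ⊗[k] H) →ₗ[k] (V ⊗[k] H)) :
    koszul degV (trivialDG k H).deg m = m := by
  have hi := trivialDG_isInternal (k := k) (H := H)
  have he : evenPart (trivialDG k H).deg = LinearMap.id := by
    refine LinearMap.ext fun a => ?_
    have h := gradedScale_apply hi (fun n => if Even n then 1 else 0) (mem_trivialDG_deg a)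
    simpa [evenPart] using h
  have ho : oddPart (trivialDG k H).deg = 0 := by
    refine LinearMap.ext fun a => ?_
    have h := gradedScale_apply hi (fun n => if Even n then 0 else 1) (mem_trivialDG_deg a)
    simpa [oddPart] using h
  rw [koszul, he, ho, TensorProduct.map_id, TensorProduct.map_zero_right, LinearMap.comp_id,
    LinearMap.comp_zero, add_zero]

theorem koszul_trivialDG_left {degW : ℕ → Submodule k W} (hW : DirectSum.IsInternal degW)
    (m : (H ⊗[k] W) →ₗ[k] (H ⊗[k] W) →ₗ[k] (H ⊗[k] W)) (x y : H ⊗[k] W) :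
    koszul (trivialDG k H).deg degW m x y = m x y := by
  have hi := trivialDG_isInternal (k := k) (H := H)
  induction x with
  | zero => rw [map_zero, map_zero]
  | add s t hs ht => rw [map_add, map_add, LinearMap.add_apply, LinearMap.add_apply, hs, ht]
  | tmul a w =>
  induction w using isInternal_induction hW with
  | add s t hs ht =>
    rw [TensorProduct.tmul_add, map_add, map_add, LinearMap.add_apply, LinearMap.add_apply, hs, ht]
  | hom j w hw =>
  induction y with
  | zero => rw [map_zero, map_zero]
  | add s t hs ht => rw [map_add, map_add, hs, ht]
  | tmul a' w' =>
    rw [koszul_tmul hi hW m a w' hw (mem_trivialDG_deg a'), mul_zero, pow_zero, one_smul]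

/-- The crossed product of differential graded algebras on `V ⊗ W`. -/
def crossedDG (D : DGData k V) (act : H →ₗ[k] V →ₗ[k] V) (σ : H ⊗[k] H →ₗ[k] V)
    (E : DGData k W) (lco : W →ₗ[k] H ⊗[k] W) : DGData k (V ⊗[k] W) where
  mul := koszul D.deg E.deg (crossedMul D.mul act σ E.mul lco)
  one := D.one ⊗ₜ E.one
  deg := tensorDeg D.deg E.deg
  d := tensorD D E

theorem crossedDG_mul_tmul (h : IsTwistedDGA D act σ σInv) (hE : DirectSum.IsInternal E.deg)
    {i j : ℕ} (v : V) {w : W} {v' : V} (w' : W) (hw : w ∈ E.deg j) (hv' : v' ∈ D.deg i) :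
    (crossedDG D act σ E lco).mul (v ⊗ₜ w) (v' ⊗ₜ w') = (-1 : k) ^ (j * i) •
      TensorProduct.map₂ (TensorProduct.curry (crossedCocycle D.mul act σ v v')) E.mul (lco w)
        (lco w') := by
  simp only [crossedDG]
  rw [koszul_tmul h.isDGA.internal hE _ v w' hw hv', crossedMul_tmul h.isDGA.mul_assoc]

theorem IsTwistedDGA.crossedCocycle_one_left (h : IsTwistedDGA D act σ σInv) (v v' : V) (a : H) :
    crossedCocycle D.mul act σ v v' (1 ⊗ₜ a) =
      Coalgebra.counit (R := k) a • D.mul v v' := by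
  rw [crossedCocycle_eq, LinearMap.comp_apply, conv_fstMap_tmul, Bialgebra.comul_one,
    Algebra.TensorProduct.one_def]
  simp [h.one_act, h.σ_one_left, h.isDGA.mul_one]

theorem IsTwistedDGA.crossedCocycle_one_right (h : IsTwistedDGA D act σ σInv) (v : V)
    (t : H ⊗[k] H) : crossedCocycle D.mul act σ v D.one t = D.mul v (σ t) := by
  have e : fstMap H (act.flip D.one) = (Coalgebra.counit (R := k)).smulRight D.one := by
    ext; simp [h.act_one, smul_smul, mul_comm]
  rw [crossedCocycle_eq, LinearMap.comp_apply, e, counit_conv h.isDGA.one_mul]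

theorem IsTwistedDGA.crossedCocycle_mem (h : IsTwistedDGA D act σ σInv) {i i' : ℕ} {v v' : V}
    (hv : v ∈ D.deg i) (hv' : v' ∈ D.deg i') (t : H ⊗[k] H) :
    crossedCocycle D.mul act σ v v' t ∈ D.deg (i + i') := by
  rw [crossedCocycle_eq]
  refine h.isDGA.mul_mem _ _ _ _ hv ?_
  refine conv_mem h.isDGA (i := i') (j := 0) (fun c => ?_) h.σ_mem t
  induction c with
  | zero => simp
  | add s t hs ht => rw [map_add]; exact add_mem hs ht
  | tmul a b => rw [fstMap_tmul]; exact Submodule.smul_mem _ _ (h.act_mem _ _ _ hv')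

/-- Differentiating v(h₁·v')σ(h₂ ⊗ h') gives only two terms: `d` kills `σ` and passes through the
action. This is the Leibniz rule of the crossed product. -/
theorem IsTwistedDGA.d_crossedCocycle (h : IsTwistedDGA D act σ σInv) {i : ℕ} {v : V} (v' : V)
    (hv : v ∈ D.deg i) :
    D.d ∘ₗ crossedCocycle D.mul act σ v v' =
      crossedCocycle D.mul act σ (D.d v) v' +
        (-1 : k) ^ i • crossedCocycle D.mul act σ v (D.d v') := by
  have hσ : D.d ∘ₗ σ = 0 := LinearMap.ext h.d_σ
  have key : ∀ i', ∀ v' ∈ D.deg i',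
      D.d ∘ₗ conv D.mul (fstMap H (act.flip v')) σ =
        conv D.mul (fstMap H (act.flip (D.d v'))) σ := by
    intro i' v' hv'
    rw [d_comp_conv h.isDGA (n := i') ?_, hσ, conv_zero_right, smul_zero, add_zero]
    · congr 1
      ext; simp [h.d_act]
    · intro c
      induction c with
      | zero => simp
      | add s t hs ht => rw [map_add]; exact add_mem hs ht
      | tmul a b => rw [fstMap_tmul]; exact Submodule.smul_mem _ _ (h.act_mem _ _ _ hv')
  induction v' using isInternal_induction h.isDGA.internal with
  | add s t hs ht => simp only [map_add, LinearMap.comp_add, hs, ht, smul_add]; abel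
  | hom i' v' hv' =>
    refine LinearMap.ext fun t => ?_
    have e := LinearMap.congr_fun (key i' v' hv') t
    simp only [LinearMap.comp_apply] at e
    simp only [crossedCocycle_eq, LinearMap.comp_apply, LinearMap.add_apply, LinearMap.smul_apply]
    rw [h.isDGA.leibniz i _ _ hv, e]

theorem crossedDG_trivialDG_mul (h : IsTwistedDGA D act σ σInv) (v v' : V) (a a' : H) :
    (crossedDG D act σ (trivialDG k H) Coalgebra.comul).mul (v ⊗ₜ a) (v' ⊗ₜ a') =
      coSmash (crossedCocycle D.mul act σ v v') (LinearMap.mul' k H) (a ⊗ₜ a') := by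
  rw [← crossedMul_comul_tmul h.isDGA.mul_assoc]
  exact congrArg (fun m => m (v ⊗ₜ[k] a) (v' ⊗ₜ[k] a')) (koszul_trivialDG _)

/-- The differential is d ⊗ id and the degree is that of the first leg, so Leibniz is
`d_crossedCocycle`; the unit laws come from the normalisation of `σ`, together with 1·v = v and h·1
= ε(h)1. -/
theorem crossedDG_trivialDG_isDGA (h : IsTwistedDGA D act σ σInv) :
    (crossedDG D act σ (trivialDG k H) Coalgebra.comul).IsDGA where
  internal := tensorDeg_isInternal h.isDGA.internal trivialDG_isInternal
  one_mem := tmul_mem_tensorDeg h.isDGA.one_mem (mem_trivialDG_deg 1) rfl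
  d_mem := tensorD_mem h.isDGA.internal h.isDGA.d_mem trivialDG_isDGA.d_mem
  d_d := tensorD_tensorD h.isDGA trivialDG_isDGA
  mul_assoc x y z := by
    have e : (crossedDG D act σ (trivialDG k H) Coalgebra.comul).mul =
      crossedMul D.mul act σ (LinearMap.mul k H) Coalgebra.comul := koszul_trivialDG _
    rw [e]
    exact crossedMul_comul_assoc h x y z
  one_mul x := by
    induction x with
    | zero => simp
    | add s t hs ht => rw [map_add, hs, ht]
    | tmul v a =>
      refine (crossedDG_trivialDG_mul h D.one v 1 a).trans ?_
      rw [tmul_eq_coSmash v a, coSmash_apply, coSmash_apply, TensorProduct.comul_tmul,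
        Bialgebra.comul_one, Algebra.TensorProduct.one_def]
      induction (Coalgebra.comul a : H ⊗[k] H) with
      | zero => simp
      | add s t hs ht => simp only [map_add, TensorProduct.tmul_add, hs, ht]
      | tmul b c => simp [h.crossedCocycle_one_left, h.isDGA.one_mul]
  mul_one x := by
    induction x with
    | zero => simp
    | add s t hs ht => rw [map_add, LinearMap.add_apply, hs, ht]
    | tmul v a =>
      refine (crossedDG_trivialDG_mul h v D.one a 1).trans ?_
      rw [tmul_eq_coSmash v a, coSmash_apply, coSmash_apply, TensorProduct.comul_tmul,
        Bialgebra.comul_one, Algebra.TensorProduct.one_def]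
      induction (Coalgebra.comul a : H ⊗[k] H) with
      | zero => simp
      | add s t hs ht => simp only [map_add, TensorProduct.add_tmul, hs, ht]
      | tmul b c => simp [h.crossedCocycle_one_right, h.σ_one_right, h.isDGA.mul_one]
  mul_mem m n x y hx hy := by
    induction hx using tensorDeg_trivialDG_induction with
    | add s t _ _ hs ht => rw [map_add, LinearMap.add_apply]; exact add_mem hs ht
    | tmul v hv a =>
    induction hy using tensorDeg_trivialDG_induction with
    | add s t _ _ hs ht => rw [map_add]; exact add_mem hs ht
    | tmul v' hv' a' =>
      rw [crossedDG_trivialDG_mul h, coSmash_apply]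
      induction (Coalgebra.comul (a ⊗ₜ[k] a') : (H ⊗[k] H) ⊗[k] (H ⊗[k] H)) with
      | zero => simp
      | add s t hs ht => rw [map_add]; exact add_mem hs ht
      | tmul s t =>
        exact tmul_mem_tensorDeg (h.crossedCocycle_mem hv hv' s) (mem_trivialDG_deg _) rfl
  leibniz n x y hx := by
    have hd : ∀ t, (crossedDG D act σ (trivialDG k H) Coalgebra.comul).d t =
        TensorProduct.map D.d LinearMap.id t := by
      intro t
      simp [crossedDG, tensorD, trivialDG]
    induction hx using tensorDeg_trivialDG_induction with
    | add s t _ _ hs ht => simp only [map_add, LinearMap.add_apply, hs, ht, smul_add]; abel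
    | tmul v hv a =>
    induction y with
    | zero => simp
    | add s t hs ht => simp only [map_add, hs, ht, smul_add]; abel
    | tmul v' a' =>
      rw [hd, hd, hd]
      simp only [TensorProduct.map_tmul, LinearMap.id_apply]
      simp only [crossedDG_trivialDG_mul h, coSmash_apply]
      rw [← LinearMap.comp_apply, ← TensorProduct.map_comp, h.d_crossedCocycle v' hv,
        TensorProduct.map_add_left, TensorProduct.map_smul_left, LinearMap.id_comp]
      rfl

end CrossedAlgebra

/-! ### Pulling back the axioms of a differential graded algebra along an injective morphism. -/

section Transfer

variable {k : Type*} [Field k]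
variable {V : Type*} [AddCommGroup V] [Module k V]
variable {X : Type*} [AddCommGroup X] [Module k X]

/-- A graded subspace of a differential graded algebra which is closed under the operations is a
differential graded algebra. -/
theorem DGData.IsDGA.of_injective {F : DGData k X} (hF : F.IsDGA) {C : DGData k V}
    (hC : DirectSum.IsInternal C.deg) {f : V →ₗ[k] X} (hf : IsDGHom C F f)
    (inj : Function.Injective f) : C.IsDGA :=
  have reflect : ∀ {n x}, f x ∈ F.deg n → x ∈ C.deg n := fun hx =>
    mem_deg_of_injective hC hF.internal inj hf.map_deg hx
  { internal := hC
    mul_assoc := fun x y z => inj (by simp only [hf.map_mul, hF.mul_assoc])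
    one_mul := fun x => inj (by rw [hf.map_mul, hf.map_one, hF.one_mul])
    mul_one := fun x => inj (by rw [hf.map_mul, hf.map_one, hF.mul_one])
    one_mem := reflect (by rw [hf.map_one]; exact hF.one_mem)
    mul_mem := fun m n x y hx hy => reflect (by
      rw [hf.map_mul]; exact hF.mul_mem _ _ _ _ (hf.map_deg _ _ hx) (hf.map_deg _ _ hy))
    d_mem := fun n x hx => reflect (by
      rw [hf.map_d]; exact hF.d_mem _ _ (hf.map_deg _ _ hx))
    d_d := fun x => inj (by rw [hf.map_d, hf.map_d, hF.d_d, map_zero])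
    leibniz := fun n x y hx => inj (by
      simp only [hf.map_d, hf.map_mul, map_add, map_smul]
      exact hF.leibniz n _ _ (hf.map_deg _ _ hx)) }

theorem IsDGHom.comp {Y : Type*} [AddCommGroup Y] [Module k Y] {C : DGData k V} {F : DGData k X}
    {G : DGData k Y} {g : X →ₗ[k] Y} {f : V →ₗ[k] X} (hg : IsDGHom F G g) (hf : IsDGHom C F f) :
    IsDGHom C G (g ∘ₗ f) where
  map_one := by rw [LinearMap.comp_apply, hf.map_one, hg.map_one]
  map_mul x y := by simp only [LinearMap.comp_apply, hf.map_mul, hg.map_mul]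
  map_deg n x hx := hg.map_deg _ _ (hf.map_deg _ _ hx)
  map_d x := by simp only [LinearMap.comp_apply, hf.map_d, hg.map_d]

end Transfer

/-! ### Embedding the crossed product calculus into (Ω(B) ♯_σ H) ⊗ Ω(H). -/

section Embedding

variable {k : Type*} [Field k]
variable {H : Type*} [Ring H] [HopfAlgebra k H]
variable {V : Type*} [AddCommGroup V] [Module k V]
variable {W : Type*} [AddCommGroup W] [Module k W]
variable {D : DGData k V} {act : H →ₗ[k] V →ₗ[k] V} {σ σInv : H ⊗[k] H →ₗ[k] V}
variable {E : DGData k W} {ι : H →ₗ[k] W} {lco : W →ₗ[k] H ⊗[k] W}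

theorem tensorD_trivialDG (x : H ⊗[k] W) :
    tensorD (trivialDG k H) E x = TensorProduct.map LinearMap.id E.d x := by
  have hi := trivialDG_isInternal (k := k) (H := H)
  induction x with
  | zero => rw [map_zero, map_zero]
  | add s t hs ht => rw [map_add, map_add, hs, ht]
  | tmul a w =>
    rw [tensorD_tmul hi (mem_trivialDG_deg a)]
    simp [trivialDG]

theorem IsLeftCovariant.coassoc_apply (h : IsLeftCovariant E ι lco) (w : W) :
    LinearMap.lTensor H lco (lco w) =
      TensorProduct.assoc k H H W (LinearMap.rTensor W Coalgebra.comul (lco w)) :=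
  LinearMap.congr_fun h.coassoc w

theorem IsLeftCovariant.counit_apply (h : IsLeftCovariant E ι lco) (w : W) :
    TensorProduct.lid k W (LinearMap.rTensor W Coalgebra.counit (lco w)) = w :=
  LinearMap.congr_fun h.counit w

theorem IsLeftCovariant.lco_one {R : AlgData k H} (hι : IsDifferentialCalculus R E ι)
    (hR : R.one = 1) (h : IsLeftCovariant E ι lco) : lco E.one = 1 ⊗ₜ E.one := by
  have e := LinearMap.congr_fun h.extends_comul 1
  rw [LinearMap.comp_apply, LinearMap.comp_apply, Bialgebra.comul_one,
    Algebra.TensorProduct.one_def, TensorProduct.map_tmul, ← hR, hι.map_one] at e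
  rw [e, hR, LinearMap.id_apply]

/-- With H in degree zero, left covariance makes the coaction a morphism of differential graded
algebras, so the general results on tensor products and on uniqueness apply to it. -/
theorem IsLeftCovariant.isDGHom (hι : IsDifferentialCalculus (AlgData.of k H) E ι)
    (h : IsLeftCovariant E ι lco) : IsDGHom E ((trivialDG k H).tensor E) lco where
  map_one := h.lco_one hι rfl
  map_mul x y := by
    rw [h.map_mul]
    exact (koszul_trivialDG_left hι.isDGA.internal _ _ _).symm
  map_deg n x hx := by
    obtain ⟨t, ht⟩ := h.map_deg n x hx
    rw [← ht]
    clear ht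
    induction t with
    | zero => rw [map_zero]; exact zero_mem _
    | add s t hs ht => rw [map_add]; exact add_mem hs ht
    | tmul a w => exact tmul_mem_tensorDeg (mem_trivialDG_deg a) w.2 (zero_add n)
  map_d x := (LinearMap.congr_fun h.map_d x).trans (tensorD_trivialDG _).symm

/-- The map `v ⊗ w ↦ (v ⊗ w₋₁) ⊗ w₀`. -/
def crossedEmbedding (V : Type*) [AddCommGroup V] [Module k V] (lco : W →ₗ[k] H ⊗[k] W) :
    V ⊗[k] W →ₗ[k] (V ⊗[k] H) ⊗[k] W :=
  (TensorProduct.assoc k V H W).symm.toLinearMap ∘ₗ TensorProduct.map LinearMap.id lco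

theorem crossedEmbedding_tmul (lco : W →ₗ[k] H ⊗[k] W) (v : V) (w : W) :
    crossedEmbedding V lco (v ⊗ₜ w) = (TensorProduct.assoc k V H W).symm (v ⊗ₜ lco w) := rfl

/-- Applying the counit of H to the middle leg is a left inverse. -/
theorem IsLeftCovariant.crossedEmbedding_injective (h : IsLeftCovariant E ι lco) :
    Function.Injective (crossedEmbedding V lco) := by
  refine Function.LeftInverse.injective (g := TensorProduct.map
    ((TensorProduct.rid k V).toLinearMap ∘ₗ LinearMap.lTensor V Coalgebra.counit)
      LinearMap.id) fun x => ?_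
  induction x with
  | zero => rw [map_zero, map_zero]
  | add s t hs ht => rw [map_add, map_add, hs, ht]
  | tmul v w =>
    conv_rhs => rw [← h.counit_apply w]
    rw [crossedEmbedding_tmul]
    induction lco w with
    | zero => simp
    | add s t hs ht => simp only [TensorProduct.tmul_add, map_add, hs, ht]
    | tmul a b => simp [TensorProduct.smul_tmul]

/-- The sign-free part of multiplicativity. `h1` uses that the coaction is multiplicative;
coassociativity then replaces the iterated coaction by the coproduct of its H-leg, and `h2`
recognises the product of Ω(B) ♯_σ H. -/
theorem IsLeftCovariant.crossedEmbedding_map₂ (hD : IsTwistedDGA D act σ σInv)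
    (h : IsLeftCovariant E ι lco) (v v' : V) (w w' : W) :
    crossedEmbedding V lco (TensorProduct.map₂
      (TensorProduct.curry (crossedCocycle D.mul act σ v v')) E.mul (lco w) (lco w')) =
    TensorProduct.map₂ (crossedDG D act σ (trivialDG k H) Coalgebra.comul).mul E.mul
      (crossedEmbedding V lco (v ⊗ₜ w)) (crossedEmbedding V lco (v' ⊗ₜ w')) := by
  set κ := TensorProduct.curry (crossedCocycle D.mul act σ v v') with hκ
  have h1 : ∀ t t' : H ⊗[k] W,
      TensorProduct.map LinearMap.id lco (TensorProduct.map₂ κ E.mul t t') =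
        TensorProduct.map₂ κ (TensorProduct.map₂ (LinearMap.mul k H) E.mul)
          (LinearMap.lTensor H lco t) (LinearMap.lTensor H lco t') := by
    intro t t'
    induction t with
    | zero => simp
    | add s t hs ht => simp only [map_add, LinearMap.add_apply, hs, ht]
    | tmul a w =>
      induction t' with
      | zero => simp
      | add s t hs ht => simp only [map_add, hs, ht]
      | tmul a' w' => simp [TensorProduct.map₂_apply_tmul, h.map_mul]
  have h2 : ∀ t t' : H ⊗[k] W,
      (TensorProduct.assoc k V H W).symm
        (TensorProduct.map₂ κ (TensorProduct.map₂ (LinearMap.mul k H) E.mul)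
          (TensorProduct.assoc k H H W (LinearMap.rTensor W Coalgebra.comul t))
          (TensorProduct.assoc k H H W (LinearMap.rTensor W Coalgebra.comul t'))) =
      TensorProduct.map₂ (crossedDG D act σ (trivialDG k H) Coalgebra.comul).mul E.mul
        ((TensorProduct.assoc k V H W).symm (v ⊗ₜ t))
        ((TensorProduct.assoc k V H W).symm (v' ⊗ₜ t')) := by
    intro t t'
    induction t with
    | zero => simp
    | add s t hs ht =>
      simp only [map_add, TensorProduct.tmul_add, LinearMap.add_apply, hs, ht]
    | tmul a w =>
      induction t' with
      | zero => simp
      | add s t hs ht => simp only [map_add, TensorProduct.tmul_add, hs, ht]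
      | tmul a' w' =>
        have e : (crossedDG D act σ (trivialDG k H) Coalgebra.comul).mul (v ⊗ₜ a) (v' ⊗ₜ a') =
            TensorProduct.map₂ κ (LinearMap.mul k H) (Coalgebra.comul a) (Coalgebra.comul a') := by
          rw [← crossedMul_tmul hD.isDGA.mul_assoc]
          exact congrArg (fun m => m (v ⊗ₜ[k] a) (v' ⊗ₜ[k] a')) (koszul_trivialDG _)
        rw [TensorProduct.assoc_symm_tmul, TensorProduct.assoc_symm_tmul,
          TensorProduct.map₂_apply_tmul, TensorProduct.map_tmul, e, LinearMap.rTensor_tmul,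
          LinearMap.rTensor_tmul]
        induction (Coalgebra.comul a : H ⊗[k] H) with
        | zero => simp
        | add s t hs ht =>
          simp only [map_add, TensorProduct.add_tmul, LinearMap.add_apply, hs, ht]
        | tmul b c =>
          induction (Coalgebra.comul a' : H ⊗[k] H) with
          | zero => simp
          | add s t hs ht => simp only [map_add, TensorProduct.add_tmul, hs, ht]
          | tmul b' c' => simp [TensorProduct.map₂_apply_tmul]
  rw [crossedEmbedding, LinearMap.comp_apply, h1, h.coassoc_apply, h.coassoc_apply]
  exact h2 _ _

theorem IsLeftCovariant.crossedEmbedding_isDGHom (hD : IsTwistedDGA D act σ σInv)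
    (hι : IsDifferentialCalculus (AlgData.of k H) E ι) (h : IsLeftCovariant E ι lco) :
    IsDGHom (crossedDG D act σ E lco)
      ((crossedDG D act σ (trivialDG k H) Coalgebra.comul).tensor E)
      (crossedEmbedding V lco) where
  map_one := by
    refine (crossedEmbedding_tmul lco _ _).trans ?_
    rw [h.lco_one hι rfl]
    rfl
  map_deg n x hx :=
    assoc_symm_mem_tensorDeg (D := D) (E := trivialDG k H) (F := E) _ _
      (map_mem_tensorDeg (D := D) (E := E) (D' := D) (E' := (trivialDG k H).tensor E)
        (fun _ _ hx => hx) (h.isDGHom hι).map_deg n x hx)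
  map_d x := by
    have e1 := map_tensorD (D := D) (E := E) (D' := D) (E' := (trivialDG k H).tensor E)
      (f := LinearMap.id) hD.isDGA.internal hD.isDGA.internal (fun _ _ hx => hx) (fun _ => rfl)
      (h.isDGHom hι).map_d x
    have e2 := assoc_symm_tensorD (D := D) (E := trivialDG k H) (F := E) hD.isDGA.internal
      trivialDG_isInternal (TensorProduct.map LinearMap.id lco x)
    rw [← e1] at e2
    exact e2
  map_mul x y := by
    have hA := crossedDG_trivialDG_isDGA hD
    have hE := hι.isDGA.internal
    induction x using tensor_induction hD.isDGA.internal hE with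
    | add s t hs ht => simp only [map_add, LinearMap.add_apply, hs, ht]
    | tmul i j v hv w hw =>
    induction y using tensor_induction hD.isDGA.internal hE with
    | add s t hs ht => simp only [map_add, hs, ht]
    | tmul i' j' v' hv' w' hw' =>
      rw [crossedDG_mul_tmul hD hE v w' hw hv', map_smul, h.crossedEmbedding_map₂ hD,
        crossedEmbedding_tmul, crossedEmbedding_tmul]
      -- The coaction preserves degree, so w₀ has the degree of `w` and both products carry the same
      -- Koszul sign.
      obtain ⟨t, ht⟩ := h.map_deg j w hw
      rw [← ht]
      clear ht
      induction t with
      | zero => simp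
      | add s t hs ht =>
        simp only [map_add, TensorProduct.tmul_add, LinearMap.add_apply, smul_add, hs, ht]
      | tmul a b =>
        induction lco w' with
        | zero => simp
        | add s t hs ht => simp only [map_add, TensorProduct.tmul_add, smul_add, hs, ht]
        | tmul a' b' =>
          simp only [TensorProduct.map_tmul, TensorProduct.assoc_symm_tmul, LinearMap.id_apply,
            Submodule.subtype_apply]
          rw [DGData.tensor_mul_tmul hA.internal hE _ b' b.2
            (tmul_mem_tensorDeg hv' (mem_trivialDG_deg a') (add_zero i')),
            TensorProduct.map₂_apply_tmul, TensorProduct.map_tmul]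

theorem IsLeftCovariant.crossedDG_isDGA (hD : IsTwistedDGA D act σ σInv)
    (hι : IsDifferentialCalculus (AlgData.of k H) E ι) (h : IsLeftCovariant E ι lco) :
    (crossedDG D act σ E lco).IsDGA :=
  (tensor_isDGA (crossedDG_trivialDG_isDGA hD) hι.isDGA).of_injective
    (tensorDeg_isInternal hD.isDGA.internal hι.isDGA.internal)
    (h.crossedEmbedding_isDGHom hD hι) h.crossedEmbedding_injective

end Embedding

/-! ### Spans of monomials -/

section Monomial

variable {k : Type*} [Field k]
variable {A : Type*} [AddCommGroup A] [Module k A]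
variable {V : Type*} [AddCommGroup V] [Module k V]
variable {R : AlgData k A} {C : DGData k V} {ι : A →ₗ[k] V}

/-- The span of the forms `a₀ da₁ ∧ ⋯ ∧ daₙ`. -/
def DGData.monomialSpan (C : DGData k V) (ι : A →ₗ[k] V) (n : ℕ) : Submodule k V :=
  Submodule.span k {ω | ∃ (a₀ : A) (l : List A), l.length = n ∧ ω = C.monomial ι a₀ l}

theorem DGData.monomial_mem_span (C : DGData k V) (ι : A →ₗ[k] V) (a : A) (l : List A) :
    C.monomial ι a l ∈ C.monomialSpan ι l.length :=
  Submodule.subset_span ⟨a, l, rfl, rfl⟩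

theorem DGData.ι_mem_monomialSpan (C : DGData k V) (ι : A →ₗ[k] V) (a : A) :
    ι a ∈ C.monomialSpan ι 0 :=
  C.monomial_mem_span ι a []

theorem DGData.mul_d_mem_monomialSpan (C : DGData k V) (ι : A →ₗ[k] V) {n : ℕ} {x : V}
    (hx : x ∈ C.monomialSpan ι n) (a : A) :
    C.mul x (C.d (ι a)) ∈ C.monomialSpan ι (n + 1) := by
  induction hx using Submodule.span_induction with
  | zero => simp
  | add x y _ _ hx hy => rw [map_add, LinearMap.add_apply]; exact add_mem hx hy
  | smul c x _ hx => rw [map_smul, LinearMap.smul_apply]; exact Submodule.smul_mem _ _ hx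
  | mem x hx =>
    obtain ⟨a₀, l, rfl, rfl⟩ := hx
    rw [← DGData.monomial_concat]
    simpa using C.monomial_mem_span ι a₀ (l ++ [a])

/-- The Leibniz rule read backwards, (x dc)b = x d(cb) − (xc)db, with induction on the number of
differentials. -/
theorem DGData.IsDGA.mul_ι_mem_monomialSpan (hC : C.IsDGA) (h0 : ∀ a, ι a ∈ C.deg 0)
    (hmul : ∀ a b, ι (R.mul a b) = C.mul (ι a) (ι b)) {n : ℕ} {x : V}
    (hx : x ∈ C.monomialSpan ι n) (b : A) : C.mul x (ι b) ∈ C.monomialSpan ι n := by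
  induction hx using Submodule.span_induction with
  | zero => simp
  | add x y _ _ hx hy => rw [map_add, LinearMap.add_apply]; exact add_mem hx hy
  | smul c x _ hx => rw [map_smul, LinearMap.smul_apply]; exact Submodule.smul_mem _ _ hx
  | mem x hx =>
    obtain ⟨a₀, l, rfl, rfl⟩ := hx
    induction l using List.reverseRecOn generalizing b with
    | nil =>
      rw [DGData.monomial_nil, ← hmul]
      exact C.ι_mem_monomialSpan ι _
    | append_singleton l c ih =>
      have e : C.mul (C.mul (C.monomial ι a₀ l) (C.d (ι c))) (ι b) =
          C.mul (C.monomial ι a₀ l) (C.d (ι (R.mul c b))) -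
            C.mul (C.mul (C.monomial ι a₀ l) (ι c)) (C.d (ι b)) := by
        rw [hmul, hC.leibniz 0 _ _ (h0 c), hC.mul_assoc, hC.mul_assoc]
        simp
      rw [DGData.monomial_concat, e, List.length_append]
      exact sub_mem (C.mul_d_mem_monomialSpan ι (C.monomial_mem_span ι _ _) _)
        (C.mul_d_mem_monomialSpan ι (ih c) _)

theorem DGData.IsDGA.monomialSpan_le (hC : C.IsDGA) (h0 : ∀ a, ι a ∈ C.deg 0) (n : ℕ) :
    C.monomialSpan ι n ≤ C.deg n := by
  refine Submodule.span_le.mpr ?_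
  rintro _ ⟨a₀, l, rfl, rfl⟩
  induction l using List.reverseRecOn with
  | nil => exact h0 a₀
  | append_singleton l c ih =>
    rw [DGData.monomial_concat, List.length_append]
    exact hC.mul_mem _ _ _ _ ih (hC.d_mem _ _ (h0 c))

theorem IsDifferentialCalculus.deg_succ (h : IsDifferentialCalculus R C ι) (n : ℕ)
    {S : Submodule k V} (hS : ∀ x ∈ C.deg n, ∀ a, C.mul x (C.d (ι a)) ∈ S) :
    C.deg (n + 1) ≤ S := by
  rw [h.generated]
  refine Submodule.span_le.mpr ?_
  rintro _ ⟨a₀, l, hl, rfl⟩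
  induction l using List.reverseRecOn with
  | nil => simp at hl
  | append_singleton l c _ =>
    have hl' : l.length = n := by simpa using hl
    rw [DGData.monomial_concat]
    exact hS _ (hl' ▸ h.monomial_mem a₀ l) c

end Monomial

/-! ### The crossed product calculus -/

section Calculus

variable {k : Type*} [Field k]
variable {H : Type*} [Ring H] [HopfAlgebra k H]
variable {B : Type*} [Ring B] [Algebra k B]
variable {V : Type*} [AddCommGroup V] [Module k V]
variable {W : Type*} [AddCommGroup W] [Module k W]
variable {D : DGData k V} {act : H →ₗ[k] V →ₗ[k] V} {σ σInv : H ⊗[k] H →ₗ[k] V}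
variable {E : DGData k W} {ι : H →ₗ[k] W} {lco : W →ₗ[k] H ⊗[k] W}

theorem crossedDG_mul_one_tmul (hD : IsTwistedDGA D act σ σInv) (hE : DirectSum.IsInternal E.deg)
    (v : V) (w w' : W) :
    (crossedDG D act σ E lco).mul (v ⊗ₜ w) (D.one ⊗ₜ w') =
      TensorProduct.map₂ (TensorProduct.curry (D.mul v ∘ₗ σ)) E.mul (lco w) (lco w') := by
  have e : crossedCocycle D.mul act σ v D.one = D.mul v ∘ₗ σ :=
    LinearMap.ext fun t => hD.crossedCocycle_one_right v t
  induction w using isInternal_induction hE with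
  | add s t hs ht => simp only [map_add, TensorProduct.tmul_add, LinearMap.add_apply, hs, ht]
  | hom j w hw =>
    rw [crossedDG_mul_tmul hD hE v w' hw hD.isDGA.one_mem, mul_zero, pow_zero, one_smul, e]

theorem IsLeftCovariant.crossedDG_mul_one (hD : IsTwistedDGA D act σ σInv)
    (hι : IsDifferentialCalculus (AlgData.of k H) E ι) (h : IsLeftCovariant E ι lco)
    (v : V) (w : W) :
    (crossedDG D act σ E lco).mul (v ⊗ₜ E.one) (D.one ⊗ₜ w) = v ⊗ₜ w := by
  rw [crossedDG_mul_one_tmul hD hι.isDGA.internal, h.lco_one hι rfl]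
  conv_rhs => rw [← h.counit_apply w]
  induction lco w with
  | zero => simp
  | add s t hs ht => simp only [map_add, TensorProduct.tmul_add, hs, ht]
  | tmul a x =>
    simp [TensorProduct.map₂_apply_tmul, hD.σ_one_left, hD.isDGA.mul_one, hι.isDGA.one_mul,
      TensorProduct.smul_tmul]

theorem IsLeftCovariant.inclusion_isDGHom (hD : IsTwistedDGA D act σ σInv)
    (hι : IsDifferentialCalculus (AlgData.of k H) E ι) (h : IsLeftCovariant E ι lco) :
    IsDGHom D (crossedDG D act σ E lco) ((TensorProduct.mk k V W).flip E.one) where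
  map_one := rfl
  map_deg n x hx := tmul_mem_tensorDeg hx hι.isDGA.one_mem (add_zero n)
  map_d x := by
    have e : ∀ t, (crossedDG D act σ E lco).d t = tensorD D E t := fun _ => rfl
    rw [e]
    induction x using isInternal_induction hD.isDGA.internal with
    | add s t hs ht => simp only [map_add, hs, ht]
    | hom n x hx =>
      simp only [LinearMap.flip_apply, TensorProduct.mk_apply]
      rw [tensorD_tmul hD.isDGA.internal hx, hι.isDGA.d_one]
      simp
  map_mul x y := by
    simp only [LinearMap.flip_apply, TensorProduct.mk_apply]
    induction y using isInternal_induction hD.isDGA.internal with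
    | add s t hs ht => simp only [map_add, TensorProduct.add_tmul, hs, ht]
    | hom n y hy =>
      rw [crossedDG_mul_tmul hD hι.isDGA.internal x E.one hι.isDGA.one_mem hy, h.lco_one hι rfl]
      simp [TensorProduct.map₂_apply_tmul, hD.crossedCocycle_one_left, hι.isDGA.one_mul]

/-- `v ⊗ w w' = (v σ⁻¹(w₋₁ ⊗ w'₋₁) ⊗ w₀)(1 ⊗ w'₀)`. -/
theorem IsLeftCovariant.tmul_mul_eq (hD : IsTwistedDGA D act σ σInv)
    (hι : IsDifferentialCalculus (AlgData.of k H) E ι) (h : IsLeftCovariant E ι lco)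
    (v : V) (w w' : W) :
    (TensorProduct.lift (crossedDG D act σ E lco).mul ∘ₗ
      TensorProduct.map LinearMap.id (TensorProduct.mk k V W D.one) ∘ₗ
      (TensorProduct.assoc k V W W).symm.toLinearMap ∘ₗ
      TensorProduct.map (D.mul v ∘ₗ σInv) LinearMap.id ∘ₗ
      (TensorProduct.tensorTensorTensorComm k H W H W).toLinearMap) (lco w ⊗ₜ lco w') =
      v ⊗ₜ E.mul w w' := by
  set Ψ := TensorProduct.lift (crossedDG D act σ E lco).mul ∘ₗ
      TensorProduct.map LinearMap.id (TensorProduct.mk k V W D.one) ∘ₗ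
      (TensorProduct.assoc k V W W).symm.toLinearMap ∘ₗ
      TensorProduct.map (D.mul v ∘ₗ σInv) LinearMap.id ∘ₗ
      (TensorProduct.tensorTensorTensorComm k H W H W).toLinearMap with hΨ
  -- On (a ⊗ b) and (a' ⊗ b') this is v σ⁻¹(a ⊗ a')σ(b ⊗ b'): the coefficient produced when the
  -- crossed product reintroduces `σ`.
  let β : H ⊗[k] H →ₗ[k] H ⊗[k] H →ₗ[k] V :=
    TensorProduct.curry (D.mul v ∘ₗ TensorProduct.lift D.mul ∘ₗ TensorProduct.map σInv σ ∘ₗ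
      (TensorProduct.tensorTensorTensorComm k H H H H).toLinearMap)
  have hco : ∀ w, (TensorProduct.assoc k H H W).symm (LinearMap.lTensor H lco (lco w)) =
      LinearMap.rTensor W Coalgebra.comul (lco w) := by
    intro w
    rw [h.coassoc_apply, LinearEquiv.symm_apply_apply]
  have h1 : ∀ t t' : H ⊗[k] W, Ψ (t ⊗ₜ t') = TensorProduct.map₂ β E.mul
      ((TensorProduct.assoc k H H W).symm (LinearMap.lTensor H lco t))
      ((TensorProduct.assoc k H H W).symm (LinearMap.lTensor H lco t')) := by
    intro t t'
    induction t with
    | zero => simp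
    | add s t hs ht => simp only [map_add, TensorProduct.add_tmul, LinearMap.add_apply, hs, ht]
    | tmul a x =>
      induction t' with
      | zero => simp
      | add s t hs ht => simp only [map_add, TensorProduct.tmul_add, hs, ht]
      | tmul a' x' =>
        have e : Ψ ((a ⊗ₜ x) ⊗ₜ (a' ⊗ₜ x')) =
            (crossedDG D act σ E lco).mul (D.mul v (σInv (a ⊗ₜ a')) ⊗ₜ x) (D.one ⊗ₜ x') := by
          simp [hΨ]
        rw [e, crossedDG_mul_one_tmul hD hι.isDGA.internal, LinearMap.lTensor_tmul,
          LinearMap.lTensor_tmul]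
        induction lco x with
        | zero => simp
        | add s t hs ht =>
          simp only [map_add, TensorProduct.tmul_add, LinearMap.add_apply, hs, ht]
        | tmul b y =>
          induction lco x' with
          | zero => simp
          | add s t hs ht => simp only [map_add, TensorProduct.tmul_add, hs, ht]
          | tmul b' y' => simp [TensorProduct.map₂_apply_tmul, β, hD.isDGA.mul_assoc]
  have h2 : ∀ t t' : H ⊗[k] W, TensorProduct.map₂ β E.mul
      (LinearMap.rTensor W Coalgebra.comul t) (LinearMap.rTensor W Coalgebra.comul t') =
      v ⊗ₜ E.mul (TensorProduct.lid k W (LinearMap.rTensor W Coalgebra.counit t))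
        (TensorProduct.lid k W (LinearMap.rTensor W Coalgebra.counit t')) := by
    intro t t'
    induction t with
    | zero => simp
    | add s t hs ht => simp only [map_add, TensorProduct.tmul_add, LinearMap.add_apply, hs, ht]
    | tmul a x =>
      induction t' with
      | zero => simp
      | add s t hs ht => simp only [map_add, TensorProduct.tmul_add, hs, ht]
      | tmul a' x' =>
        -- On coproducts the two factors combine to σ⁻¹ ∗ σ = ε, leaving `v`.
        have e := congrArg (D.mul v) (LinearMap.congr_fun hD.σInv_conv_σ (a ⊗ₜ a'))
        rw [conv_apply, TensorProduct.comul_tmul] at e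
        have e' : β (Coalgebra.comul a) (Coalgebra.comul a') = D.mul v _ := e
        rw [LinearMap.rTensor_tmul, LinearMap.rTensor_tmul, TensorProduct.map₂_apply_tmul,
          TensorProduct.map_tmul, e']
        simp [hD.isDGA.mul_one, TensorProduct.smul_tmul, smul_smul, mul_comm]
  rw [h1, hco, hco, h2, h.counit_apply, h.counit_apply]

theorem IsDifferentialCalculus.map_crossedProduct_mul {T : TwistedModule k H B} {ιB : B →ₗ[k] V}
    {actV : H →ₗ[k] V →ₗ[k] V} (hB : IsDifferentialCalculus (AlgData.of k B) D ιB)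
    (hact : IsTwistedCalculus T D ιB actV)
    (hι : IsDifferentialCalculus (AlgData.of k H) E ι) (h : IsLeftCovariant E ι lco)
    (x y : B ⊗[k] H) :
    TensorProduct.map ιB ι (T.crossedProduct.mul x y) =
      (crossedDG D actV (ιB ∘ₗ T.σ) E lco).mul (TensorProduct.map ιB ι x)
        (TensorProduct.map ιB ι y) := by
  have hD := hact.isTwistedDGA hB
  have hco : ∀ a, lco (ι a) = TensorProduct.map LinearMap.id ι (Coalgebra.comul a) :=
    LinearMap.congr_fun h.extends_comul
  have hmul : ∀ a b, ι (a * b) = E.mul (ι a) (ι b) := fun a b => hι.map_mul a b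
  have hmulB : ∀ a b, ιB (a * b) = D.mul (ιB a) (ιB b) := fun a b => hB.map_mul a b
  induction x with
  | zero => simp
  | add s t hs ht => simp only [map_add, LinearMap.add_apply, hs, ht]
  | tmul b a =>
  induction y with
  | zero => simp
  | add s t hs ht => simp only [map_add, hs, ht]
  | tmul b' a' =>
    have hcc : ∀ t, crossedCocycle D.mul actV (ιB ∘ₗ T.σ) (ιB b) (ιB b') t =
        ιB (crossedCocycle (LinearMap.mul k B) T.act T.σ b b' t) := by
      intro t
      have e1 : fstMap H (actV.flip (ιB b')) = ιB ∘ₗ fstMap H (T.act.flip b') := by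
        ext; simp [hact.act_zero]
      rw [crossedCocycle_eq, crossedCocycle_eq, e1, ← hB.comp_conv_of]
      exact (hmulB _ _).symm
    have e : T.crossedProduct.mul (b ⊗ₜ a) (b' ⊗ₜ a') =
        TensorProduct.map₂ (TensorProduct.curry
          (crossedCocycle (LinearMap.mul k B) T.act T.σ b b')) (LinearMap.mul k H)
          (Coalgebra.comul a) (Coalgebra.comul a') :=
      crossedMul_tmul (fun x y z => mul_assoc x y z) _ _ _ _ _ _ _ _
    rw [e, TensorProduct.map_tmul, TensorProduct.map_tmul,
      crossedDG_mul_tmul hD hι.isDGA.internal _ _ (hι.ι_mem a) (hB.ι_mem b'), mul_zero, pow_zero,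
      one_smul, hco, hco]
    induction (Coalgebra.comul a : H ⊗[k] H) with
    | zero => simp
    | add s t hs ht => simp only [map_add, LinearMap.add_apply, hs, ht]
    | tmul c d =>
      induction (Coalgebra.comul a' : H ⊗[k] H) with
      | zero => simp
      | add s t hs ht => simp only [map_add, hs, ht]
      | tmul c' d' => simp [TensorProduct.map₂_apply_tmul, hmul, hcc]

/-- Induction on the degree of the second leg, for all `v` at once, because peeling off a factor
`da` replaces `v` by v σ⁻¹(x₋₁ ⊗ a₁), of the same degree. -/
theorem IsDifferentialCalculus.tmul_mem_monomialSpan {T : TwistedModule k H B} {ιB : B →ₗ[k] V}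
    {actV : H →ₗ[k] V →ₗ[k] V} (hB : IsDifferentialCalculus (AlgData.of k B) D ιB)
    (hact : IsTwistedCalculus T D ιB actV)
    (hι : IsDifferentialCalculus (AlgData.of k H) E ι) (h : IsLeftCovariant E ι lco)
    (j : ℕ) (w : W) (hw : w ∈ E.deg j) (i : ℕ) (v : V) (hv : v ∈ D.deg i) :
    v ⊗ₜ w ∈ (crossedDG D actV (ιB ∘ₗ T.σ) E lco).monomialSpan (TensorProduct.map ιB ι)
      (i + j) := by
  have hD := hact.isTwistedDGA hB
  set C := crossedDG D actV (ιB ∘ₗ T.σ) E lco with hC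
  have hCD : C.IsDGA := h.crossedDG_isDGA hD hι
  have hι1 : ι 1 = E.one := hι.map_one
  have hιB1 : ιB 1 = D.one := hB.map_one
  have hd : ∀ t, C.d t = tensorD D E t := fun _ => rfl
  have hincl := h.inclusion_isDGHom hD hι
  have h0 : ∀ x, TensorProduct.map ιB ι x ∈ C.deg 0 := by
    intro x
    induction x with
    | zero => rw [map_zero]; exact zero_mem _
    | add s t hs ht => rw [map_add]; exact add_mem hs ht
    | tmul b a => exact tmul_mem_tensorDeg (hB.ι_mem b) (hι.ι_mem a) rfl
  have one_right : ∀ i v, v ∈ D.deg i →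
      v ⊗ₜ E.one ∈ C.monomialSpan (TensorProduct.map ιB ι) i := by
    refine hB.induction_deg (fun _ => by simp) ?_ ?_ ?_ ?_
    · intro n x y _ _ hx hy
      rw [TensorProduct.add_tmul]
      exact add_mem hx hy
    · intro n c x _ hx
      rw [← TensorProduct.smul_tmul']
      exact Submodule.smul_mem _ _ hx
    · intro b
      rw [← hι1]
      exact C.ι_mem_monomialSpan (TensorProduct.map ιB ι) (b ⊗ₜ 1)
    · intro n x b _ hx
      have e := hincl.map_mul x (D.d (ιB b))
      rw [hincl.map_d] at e
      simp only [LinearMap.flip_apply, TensorProduct.mk_apply] at e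
      rw [e, ← hι1, ← TensorProduct.map_tmul, hι1]
      exact C.mul_d_mem_monomialSpan _ hx _
  have key : ∀ j w, w ∈ E.deg j → ∀ i v, v ∈ D.deg i →
      v ⊗ₜ w ∈ C.monomialSpan (TensorProduct.map ιB ι) (i + j) := by
    intro j
    induction j with
    | zero =>
      intro w hw i v hv
      rw [← hι.range_eq] at hw
      obtain ⟨a, rfl⟩ := hw
      -- Here v ⊗ a = (v ⊗ 1)(1 ⊗ a): the first factor is in the span by transport along ω ↦ ω ⊗ 1,
      -- and the span is stable under right multiplication by degree zero.
      rw [← h.crossedDG_mul_one hD hι, ← hιB1, ← TensorProduct.map_tmul]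
      exact hCD.mul_ι_mem_monomialSpan (R := T.crossedProduct) h0
        (hB.map_crossedProduct_mul hact hι h) (one_right i v hv) _
    | succ n ih =>
      intro w hw i v hv
      refine hι.deg_succ n (S := (C.monomialSpan (TensorProduct.map ιB ι) (i + (n + 1))).comap
        (TensorProduct.mk k V W v)) (fun w hw a => ?_) hw
      rw [Submodule.mem_comap, TensorProduct.mk_apply]
      rw [← h.tmul_mul_eq hD hι]
      obtain ⟨t, ht⟩ := h.map_deg n w hw
      have e1 : lco (E.d (ι a)) = TensorProduct.map LinearMap.id E.d (lco (ι a)) :=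
        LinearMap.congr_fun h.map_d (ι a)
      have e2 : lco (ι a) = TensorProduct.map LinearMap.id ι (Coalgebra.comul a) :=
        LinearMap.congr_fun h.extends_comul a
      rw [e1, e2, ← ht]
      clear ht e1 e2
      induction t with
      | zero => rw [map_zero, TensorProduct.zero_tmul, map_zero]; exact zero_mem _
      | add s t hs ht => rw [map_add, TensorProduct.add_tmul, map_add]; exact add_mem hs ht
      | tmul b x =>
        induction (Coalgebra.comul a : H ⊗[k] H) with
        | zero => rw [map_zero, map_zero, TensorProduct.tmul_zero, map_zero]; exact zero_mem _
        | add s t hs ht =>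
          rw [map_add, map_add, TensorProduct.tmul_add, map_add]
          exact add_mem hs ht
        | tmul b' c =>
          -- As d1 = 0, the right factor 1 ⊗ da₂ is the differential of an element of B ♯_σ H.
          have hdι : D.one ⊗ₜ E.d (ι c) = C.d (TensorProduct.map ιB ι (1 ⊗ₜ c)) := by
            rw [hd, TensorProduct.map_tmul, hιB1, tensorD_tmul hB.isDGA.internal hB.isDGA.one_mem,
              hB.isDGA.d_one]
            simp
          simp only [LinearMap.comp_apply, TensorProduct.map_tmul, LinearEquiv.coe_coe,
            TensorProduct.tensorTensorTensorComm_tmul, TensorProduct.assoc_symm_tmul,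
            TensorProduct.lift.tmul, LinearMap.id_apply, TensorProduct.mk_apply]
          rw [hdι, ← add_assoc]
          have hv' : D.mul v ((ιB ∘ₗ T.σInv) (b ⊗ₜ b')) ∈ D.deg i :=
            hD.isDGA.mul_mem i 0 _ _ hv (hD.σInv_mem _)
          exact C.mul_d_mem_monomialSpan _ (ih _ x.2 i _ hv') _
  exact key j w hw i v hv

theorem IsDifferentialCalculus.crossedCalculus {T : TwistedModule k H B} {ιB : B →ₗ[k] V}
    {actV : H →ₗ[k] V →ₗ[k] V} (hB : IsDifferentialCalculus (AlgData.of k B) D ιB)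
    (hact : IsTwistedCalculus T D ιB actV)
    (hι : IsDifferentialCalculus (AlgData.of k H) E ι) (h : IsLeftCovariant E ι lco) :
    IsDifferentialCalculus T.crossedProduct (T.crossedCalculus D ιB actV E lco)
      (TensorProduct.map ιB ι) where
  isDGA := h.crossedDG_isDGA (hact.isTwistedDGA hB) hι
  injective := TensorProduct.map_injective_of_flat_flat _ _ hB.injective hι.injective
  range_eq := by
    refine le_antisymm ?_ (tensorDeg_le ?_)
    · rintro _ ⟨x, rfl⟩
      induction x with
      | zero => rw [map_zero]; exact zero_mem _
      | add s t hs ht => rw [map_add]; exact add_mem hs ht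
      | tmul b a => exact tmul_mem_tensorDeg (hB.ι_mem b) (hι.ι_mem a) rfl
    · intro i j hij v hv w hw
      obtain ⟨rfl, rfl⟩ : i = 0 ∧ j = 0 := by omega
      rw [← hB.range_eq] at hv
      rw [← hι.range_eq] at hw
      obtain ⟨b, rfl⟩ := hv
      obtain ⟨a, rfl⟩ := hw
      exact ⟨b ⊗ₜ a, TensorProduct.map_tmul _ _ _ _⟩
  map_one := congrArg₂ (fun v w => v ⊗ₜ[k] w) hB.map_one hι.map_one
  map_mul := hB.map_crossedProduct_mul hact hι h
  generated n := by
    refine le_antisymm (tensorDeg_le ?_) ?_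
    · rintro i j rfl v hv w hw
      exact hB.tmul_mem_monomialSpan hact hι h j w hw i v hv
    · refine DGData.IsDGA.monomialSpan_le (h.crossedDG_isDGA (hact.isTwistedDGA hB) hι) ?_ n
      intro x
      induction x with
      | zero => rw [map_zero]; exact zero_mem _
      | add s t hs ht => rw [map_add]; exact add_mem hs ht
      | tmul b a => exact tmul_mem_tensorDeg (hB.ι_mem b) (hι.ι_mem a) rfl

end Calculus

/-! ### Tensor products of morphisms and the associator. -/

section Morphisms

variable {k : Type*} [Field k]
variable {V : Type*} [AddCommGroup V] [Module k V]
variable {W : Type*} [AddCommGroup W] [Module k W]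
variable {X : Type*} [AddCommGroup X] [Module k X]
variable {V' : Type*} [AddCommGroup V'] [Module k V']
variable {W' : Type*} [AddCommGroup W'] [Module k W']
variable {D : DGData k V} {E : DGData k W} {F : DGData k X}
variable {D' : DGData k V'} {E' : DGData k W'}

theorem IsDGHom.id (D : DGData k V) : IsDGHom D D LinearMap.id :=
  ⟨rfl, fun _ _ => rfl, fun _ _ hx => hx, fun _ => rfl⟩

theorem IsDGHom.tensorMap (hD : D.IsDGA) (hE : E.IsDGA) (hD' : D'.IsDGA) (hE' : E'.IsDGA)
    {f : V →ₗ[k] V'} {g : W →ₗ[k] W'} (hf : IsDGHom D D' f) (hg : IsDGHom E E' g) :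
    IsDGHom (D.tensor E) (D'.tensor E') (TensorProduct.map f g) where
  map_one := congrArg₂ (fun v w => v ⊗ₜ[k] w) hf.map_one hg.map_one
  map_mul := map_tensor_mul hD.internal hE.internal hD'.internal hE'.internal hf.map_deg hg.map_deg
    hf.map_mul hg.map_mul
  map_deg := map_mem_tensorDeg hf.map_deg hg.map_deg
  map_d := map_tensorD hD.internal hD'.internal hf.map_deg hf.map_d hg.map_d

theorem assoc_symm_isDGHom (hD : D.IsDGA) (hE : E.IsDGA) (hF : F.IsDGA) :
    IsDGHom (D.tensor (E.tensor F)) ((D.tensor E).tensor F)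
      (TensorProduct.assoc k V W X).symm.toLinearMap where
  map_one := rfl
  map_mul := assoc_symm_tensor_mul hD.internal hE hF
  map_deg := assoc_symm_mem_tensorDeg
  map_d := assoc_symm_tensorD hD.internal hE.internal

end Morphisms

/-! ### The coaction on forms and the base space forms. -/

section Complete

variable {k : Type*} [Field k]
variable {H : Type*} [Ring H] [HopfAlgebra k H]
variable {B : Type*} [Ring B] [Algebra k B]
variable {V : Type*} [AddCommGroup V] [Module k V]
variable {W : Type*} [AddCommGroup W] [Module k W]
variable {D : DGData k V} {act : H →ₗ[k] V →ₗ[k] V} {σ σInv : H ⊗[k] H →ₗ[k] V}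
variable {E : DGData k W} {ι : H →ₗ[k] W} {lco : W →ₗ[k] H ⊗[k] W} {Δ : W →ₗ[k] W ⊗[k] W}

theorem IsCoactionExtension.Δ_ι
    (hΔ : IsCoactionExtension (Coalgebra.comul : H →ₗ[k] H ⊗[k] H) E ι E ι Δ) (a : H) :
    Δ (ι a) = TensorProduct.map ι ι (Coalgebra.comul a) :=
  LinearMap.congr_fun hΔ.extends_coaction a

/-- `(w₁)₋₁ ⊗ (w₁)₀ ⊗ w₂ = w₋₁ ⊗ (w₀)₁ ⊗ (w₀)₂`. -/
theorem IsLeftCovariant.rTensor_lco_Δ (hι : IsDifferentialCalculus (AlgData.of k H) E ι)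
    (h : IsLeftCovariant E ι lco)
    (hΔ : IsCoactionExtension (Coalgebra.comul : H →ₗ[k] H ⊗[k] H) E ι E ι Δ) (w : W) :
    LinearMap.rTensor W lco (Δ w) =
      (TensorProduct.assoc k H W W).symm (LinearMap.lTensor H Δ (lco w)) := by
  have hT := trivialDG_isDGA (k := k) (H := H)
  have hE := hι.isDGA
  have hEE := tensor_isDGA hE hE
  -- Both sides are morphisms of differential graded algebras out of Ω(H), so it suffices to compare
  -- them on H, where the identity is coassociativity.
  have h1 : IsDGHom E (((trivialDG k H).tensor E).tensor E)
      (TensorProduct.map lco LinearMap.id ∘ₗ Δ) :=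
    ((h.isDGHom hι).tensorMap hE hE (tensor_isDGA hT hE) hE (IsDGHom.id E)).comp hΔ.isDGHom
  have h2 : IsDGHom E (((trivialDG k H).tensor E).tensor E)
      ((TensorProduct.assoc k H W W).symm.toLinearMap ∘ₗ
        TensorProduct.map LinearMap.id Δ ∘ₗ lco) :=
    (assoc_symm_isDGHom hT hE hE).comp
      (((IsDGHom.id _).tensorMap hT hE hT hEE hΔ.isDGHom).comp (h.isDGHom hι))
  refine LinearMap.congr_fun (h1.ext hι h2 fun a => ?_) w
  have hco : ∀ a, lco (ι a) = TensorProduct.map LinearMap.id ι (Coalgebra.comul a) :=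
    LinearMap.congr_fun h.extends_comul
  have e1 : ∀ t : H ⊗[k] H, TensorProduct.map lco LinearMap.id (TensorProduct.map ι ι t) =
      TensorProduct.map (TensorProduct.map LinearMap.id ι) ι
        (LinearMap.rTensor H Coalgebra.comul t) := by
    intro t
    induction t with
    | zero => simp
    | add s t hs ht => simp only [map_add, hs, ht]
    | tmul a b => simp [hco]
  have e2 : ∀ t : H ⊗[k] H, (TensorProduct.assoc k H W W).symm
      (TensorProduct.map LinearMap.id Δ (TensorProduct.map LinearMap.id ι t)) =
      TensorProduct.map (TensorProduct.map LinearMap.id ι) ι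
        ((TensorProduct.assoc k H H H).symm (LinearMap.lTensor H Coalgebra.comul t)) := by
    intro t
    induction t with
    | zero => simp
    | add s t hs ht => simp only [map_add, hs, ht]
    | tmul a b =>
      simp only [TensorProduct.map_tmul, LinearMap.id_apply, hΔ.Δ_ι, LinearMap.lTensor_tmul]
      induction (Coalgebra.comul b : H ⊗[k] H) with
      | zero => simp
      | add s t hs ht => simp only [map_add, TensorProduct.tmul_add, hs, ht]
      | tmul c d => simp
  simp only [LinearMap.comp_apply, LinearEquiv.coe_coe]
  rw [hΔ.Δ_ι, hco, e1, e2, ← Coalgebra.coassoc_apply, LinearEquiv.symm_apply_apply]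

/-- The map `v ⊗ w ↦ (v ⊗ w₁) ⊗ w₂`. -/
def formCoaction (V : Type*) [AddCommGroup V] [Module k V] (Δ : W →ₗ[k] W ⊗[k] W) :
    V ⊗[k] W →ₗ[k] (V ⊗[k] W) ⊗[k] W :=
  (TensorProduct.assoc k V W W).symm.toLinearMap ∘ₗ TensorProduct.map LinearMap.id Δ

theorem formCoaction_tmul (Δ : W →ₗ[k] W ⊗[k] W) (v : V) (w : W) :
    formCoaction V Δ (v ⊗ₜ w) = (TensorProduct.assoc k V W W).symm (v ⊗ₜ Δ w) := rfl

/-- The embedding intertwines id ⊗ Δ on Ω(B) ⊗ Ω(H) with id ⊗ Δ on (Ω(B) ♯_σ H) ⊗ Ω(H). -/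
theorem IsLeftCovariant.map_crossedEmbedding_formCoaction
    (hι : IsDifferentialCalculus (AlgData.of k H) E ι) (h : IsLeftCovariant E ι lco)
    (hΔ : IsCoactionExtension (Coalgebra.comul : H →ₗ[k] H ⊗[k] H) E ι E ι Δ) (x : V ⊗[k] W) :
    TensorProduct.map (crossedEmbedding V lco) LinearMap.id (formCoaction V Δ x) =
      (TensorProduct.assoc k (V ⊗[k] H) W W).symm
        (TensorProduct.map LinearMap.id Δ (crossedEmbedding V lco x)) := by
  induction x with
  | zero => simp
  | add s t hs ht => simp only [map_add, hs, ht]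
  | tmul v w =>
    let L : (H ⊗[k] W) ⊗[k] W →ₗ[k] ((V ⊗[k] H) ⊗[k] W) ⊗[k] W :=
      TensorProduct.map (TensorProduct.map (TensorProduct.mk k V H v) LinearMap.id) LinearMap.id
    have h1 : ∀ t : W ⊗[k] W, TensorProduct.map (crossedEmbedding V lco) LinearMap.id
        ((TensorProduct.assoc k V W W).symm (v ⊗ₜ t)) = L (LinearMap.rTensor W lco t) := by
      intro t
      induction t with
      | zero => simp
      | add s t hs ht => simp only [map_add, TensorProduct.tmul_add, hs, ht]
      | tmul x y =>
        simp only [TensorProduct.assoc_symm_tmul, TensorProduct.map_tmul, crossedEmbedding_tmul,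
          LinearMap.rTensor_tmul]
        induction lco x with
        | zero => simp
        | add s t hs ht =>
          simp only [map_add, TensorProduct.tmul_add, TensorProduct.add_tmul, hs, ht]
        | tmul a x => simp [L]
    have h2 : ∀ t : H ⊗[k] W, (TensorProduct.assoc k (V ⊗[k] H) W W).symm
        (TensorProduct.map LinearMap.id Δ ((TensorProduct.assoc k V H W).symm (v ⊗ₜ t))) =
        L ((TensorProduct.assoc k H W W).symm (LinearMap.lTensor H Δ t)) := by
      intro t
      induction t with
      | zero => simp
      | add s t hs ht => simp only [map_add, TensorProduct.tmul_add, hs, ht]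
      | tmul a x =>
        simp only [TensorProduct.assoc_symm_tmul, TensorProduct.map_tmul, LinearMap.id_apply,
          LinearMap.lTensor_tmul]
        induction Δ x with
        | zero => simp
        | add s t hs ht => simp only [map_add, TensorProduct.tmul_add, hs, ht]
        | tmul y z => simp [L]
    rw [formCoaction_tmul, crossedEmbedding_tmul, h1, h2, h.rTensor_lco_Δ hι hΔ]

theorem formCoaction_isDGHom_tensor (hD : D.IsDGA)
    (hι : IsDifferentialCalculus (AlgData.of k H) E ι)
    (hΔ : IsCoactionExtension (Coalgebra.comul : H →ₗ[k] H ⊗[k] H) E ι E ι Δ) :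
    IsDGHom (D.tensor E) ((D.tensor E).tensor E) (formCoaction V Δ) :=
  (assoc_symm_isDGHom hD hι.isDGA hι.isDGA).comp ((IsDGHom.id D).tensorMap hD hι.isDGA hD
    (tensor_isDGA hι.isDGA hι.isDGA) hΔ.isDGHom)

/-- Over a field the embedding stays injective after tensoring with Ω(H), so the identity may be
checked in the target, where the product is untwisted and id ⊗ Δ is a tensor product of morphisms.
-/
theorem IsLeftCovariant.formCoaction_mul (hD : IsTwistedDGA D act σ σInv)
    (hι : IsDifferentialCalculus (AlgData.of k H) E ι) (h : IsLeftCovariant E ι lco)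
    (hΔ : IsCoactionExtension (Coalgebra.comul : H →ₗ[k] H ⊗[k] H) E ι E ι Δ) (x y : V ⊗[k] W) :
    formCoaction V Δ ((crossedDG D act σ E lco).mul x y) =
      ((crossedDG D act σ E lco).tensor E).mul (formCoaction V Δ x) (formCoaction V Δ y) := by
  have hE := hι.isDGA
  have hA := crossedDG_trivialDG_isDGA hD
  have hj := h.crossedEmbedding_isDGHom hD hι
  have hjj := hj.tensorMap (h.crossedDG_isDGA hD hι) hE (tensor_isDGA hA hE) hE (IsDGHom.id E)
  have hinj : Function.Injective (TensorProduct.map (crossedEmbedding V lco)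
      (LinearMap.id : W →ₗ[k] W)) :=
    Module.Flat.rTensor_preserves_injective_linearMap _ h.crossedEmbedding_injective
  have hg := formCoaction_isDGHom_tensor hA hι hΔ
  have e : ∀ x, TensorProduct.map (crossedEmbedding V lco) LinearMap.id (formCoaction V Δ x) =
      formCoaction (V ⊗[k] H) Δ (crossedEmbedding V lco x) :=
    h.map_crossedEmbedding_formCoaction hι hΔ
  refine hinj ?_
  rw [hjj.map_mul, e, e, e, hj.map_mul, hg.map_mul]

/-- The twist changes only the product, so statements on degree and differential are inherited from
the plain tensor product. -/
theorem crossedDG_tensor_deg :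
    ((crossedDG D act σ E lco).tensor E).deg = ((D.tensor E).tensor E).deg := rfl

theorem crossedDG_tensor_d :
    ((crossedDG D act σ E lco).tensor E).d = ((D.tensor E).tensor E).d := rfl

theorem formCoaction_one (hD : D.IsDGA)
    (hι : IsDifferentialCalculus (AlgData.of k H) E ι)
    (hΔ : IsCoactionExtension (Coalgebra.comul : H →ₗ[k] H ⊗[k] H) E ι E ι Δ) :
    formCoaction V Δ (D.one ⊗ₜ E.one) = (D.one ⊗ₜ E.one) ⊗ₜ E.one :=
  (formCoaction_isDGHom_tensor hD hι hΔ).map_one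

theorem formCoaction_mem_deg (hD : D.IsDGA)
    (hι : IsDifferentialCalculus (AlgData.of k H) E ι)
    (hΔ : IsCoactionExtension (Coalgebra.comul : H →ₗ[k] H ⊗[k] H) E ι E ι Δ)
    (n : ℕ) (x : V ⊗[k] W) (hx : x ∈ (crossedDG D act σ E lco).deg n) :
    formCoaction V Δ x ∈ ((crossedDG D act σ E lco).tensor E).deg n := by
  rw [crossedDG_tensor_deg]
  exact (formCoaction_isDGHom_tensor hD hι hΔ).map_deg n x hx

theorem formCoaction_d (hD : D.IsDGA)
    (hι : IsDifferentialCalculus (AlgData.of k H) E ι)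
    (hΔ : IsCoactionExtension (Coalgebra.comul : H →ₗ[k] H ⊗[k] H) E ι E ι Δ)
    (x : V ⊗[k] W) :
    formCoaction V Δ ((crossedDG D act σ E lco).d x) =
      ((crossedDG D act σ E lco).tensor E).d (formCoaction V Δ x) := by
  rw [crossedDG_tensor_d]
  exact (formCoaction_isDGHom_tensor hD hι hΔ).map_d x

theorem IsLeftCovariant.formCoaction_isDGHom (hD : IsTwistedDGA D act σ σInv)
    (hι : IsDifferentialCalculus (AlgData.of k H) E ι) (h : IsLeftCovariant E ι lco)
    (hΔ : IsCoactionExtension (Coalgebra.comul : H →ₗ[k] H ⊗[k] H) E ι E ι Δ) :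
    IsDGHom (crossedDG D act σ E lco) ((crossedDG D act σ E lco).tensor E)
      (formCoaction V Δ) :=
  ⟨formCoaction_one hD.isDGA hι hΔ, h.formCoaction_mul hD hι hΔ,
    formCoaction_mem_deg hD.isDGA hι hΔ, formCoaction_d hD.isDGA hι hΔ⟩

theorem formCoaction_extends {ιB : B →ₗ[k] V}
    (hΔ : IsCoactionExtension (Coalgebra.comul : H →ₗ[k] H ⊗[k] H) E ι E ι Δ) :
    formCoaction V Δ ∘ₗ TensorProduct.map ιB ι =
      TensorProduct.map (TensorProduct.map ιB ι) ι ∘ₗ crossedCoaction k H B := by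
  ext b a
  simp only [TensorProduct.AlgebraTensorModule.curry_apply, LinearMap.restrictScalars_self,
    TensorProduct.curry_apply, LinearMap.comp_apply, TensorProduct.map_tmul, formCoaction_tmul,
    hΔ.Δ_ι, crossedCoaction, LinearEquiv.coe_coe, LinearMap.id_apply]
  induction (Coalgebra.comul a : H ⊗[k] H) with
  | zero => simp
  | add s t hs ht => simp only [map_add, TensorProduct.tmul_add, hs, ht]
  | tmul c d => simp

/-! ### The counit of a calculus on `H` and the base space forms -/

/-- Project to degree zero and identify it with H by any linear left inverse of `ι`. -/
theorem IsDifferentialCalculus.exists_counit (hι : IsDifferentialCalculus (AlgData.of k H) E ι) :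
    ∃ ε : W →ₗ[k] k, (∀ a, ε (ι a) = Coalgebra.counit (R := k) a) ∧
      ∀ n ≠ 0, ∀ w ∈ E.deg n, ε w = 0 := by
  obtain ⟨r, hr⟩ := LinearMap.exists_leftInverse_of_injective ι
    (LinearMap.ker_eq_bot.mpr hι.injective)
  refine ⟨Coalgebra.counit ∘ₗ r ∘ₗ gradedProj E.deg 0, fun a => ?_, fun n hn w hw => ?_⟩
  · have e : r (ι a) = a := LinearMap.congr_fun hr a
    simp [gradedProj_of_mem hι.isDGA.internal (hι.ι_mem a), e]
  · simp [gradedProj_of_mem_ne hι.isDGA.internal hw hn]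

/-- Such an ε vanishes in positive degree, hence on all dv, and is multiplicative. Only terms with a
degree zero first leg survive, and for these the Koszul signs are trivial. -/
theorem IsDifferentialCalculus.counit_isDGHom
    (hι : IsDifferentialCalculus (AlgData.of k H) E ι) {ε : W →ₗ[k] k}
    (h0 : ∀ a, ε (ι a) = Coalgebra.counit (R := k) a) (hn : ∀ n ≠ 0, ∀ w ∈ E.deg n, ε w = 0) :
    IsDGHom (E.tensor E) E
      ((TensorProduct.lid k W).toLinearMap ∘ₗ TensorProduct.map ε LinearMap.id) := by
  have hE := hι.isDGA
  have hmul : ∀ a b, ι (a * b) = E.mul (ι a) (ι b) := fun a b => hι.map_mul a b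
  set P := (TensorProduct.lid k W).toLinearMap ∘ₗ TensorProduct.map ε (LinearMap.id : W →ₗ[k] W)
    with hP
  have hPt : ∀ v w, P (v ⊗ₜ w) = ε v • w := fun v w => by simp [hP]
  have hd : ∀ t, (E.tensor E).d t = tensorD E E t := fun _ => rfl
  constructor
  · have h1 : ι 1 = E.one := hι.map_one
    have e : (E.tensor E).one = E.one ⊗ₜ E.one := rfl
    rw [e, hPt, ← h1, h0, Bialgebra.counit_one, one_smul]
  · intro x y
    induction x using tensor_induction hE.internal hE.internal with
    | add s t hs ht => simp only [map_add, LinearMap.add_apply, hs, ht]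
    | tmul i j v hv w hw =>
    induction y using tensor_induction hE.internal hE.internal with
    | add s t hs ht => simp only [map_add, hs, ht]
    | tmul i' j' v' hv' w' hw' =>
      rw [DGData.tensor_mul_tmul hE.internal hE.internal v w' hw hv', map_smul, hPt, hPt, hPt]
      by_cases hi : i = 0
      · by_cases hi' : i' = 0
        · subst hi hi'
          rw [← hι.range_eq] at hv hv'
          obtain ⟨a, rfl⟩ := hv
          obtain ⟨a', rfl⟩ := hv'
          rw [← hmul, h0, h0, h0, Bialgebra.counit_mul]
          simp [smul_smul, mul_comm]
        · rw [hn i' hi' v' hv', hn (i + i') (by omega) _ (hE.mul_mem _ _ _ _ hv hv')]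
          simp
      · rw [hn i hi v hv, hn (i + i') (by omega) _ (hE.mul_mem _ _ _ _ hv hv')]
        simp
  · intro n x hx
    induction hx using tensorDeg_induction with
    | add s t _ _ hs ht => rw [map_add]; exact add_mem hs ht
    | tmul i j hij v hv w hw =>
      rw [hPt]
      by_cases hi : i = 0
      · obtain rfl : j = n := by omega
        exact Submodule.smul_mem _ _ hw
      · rw [hn i hi v hv, zero_smul]
        exact zero_mem _
  · intro x
    rw [hd]
    induction x using tensor_induction hE.internal hE.internal with
    | add s t hs ht => simp only [map_add, hs, ht]
    | tmul i j v hv w hw =>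
      rw [tensorD_tmul hE.internal hv, map_add, map_smul, hPt, hPt, hPt,
        hn (i + 1) (Nat.succ_ne_zero i) _ (hE.d_mem _ _ hv)]
      by_cases hi : i = 0
      · simp [hi]
      · simp [hn i hi v hv]

/-- Both sides are morphisms Ω(H) → Ω(H) that agree on H by the counit law. -/
theorem IsDifferentialCalculus.counit_Δ (hι : IsDifferentialCalculus (AlgData.of k H) E ι)
    {ε : W →ₗ[k] k} (h0 : ∀ a, ε (ι a) = Coalgebra.counit (R := k) a)
    (hn : ∀ n ≠ 0, ∀ w ∈ E.deg n, ε w = 0)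
    (hΔ : IsCoactionExtension (Coalgebra.comul : H →ₗ[k] H ⊗[k] H) E ι E ι Δ) (w : W) :
    TensorProduct.lid k W (TensorProduct.map ε LinearMap.id (Δ w)) = w := by
  refine LinearMap.congr_fun (IsDGHom.ext hι ((hι.counit_isDGHom h0 hn).comp hΔ.isDGHom)
    (IsDGHom.id E) fun a => ?_) w
  have key : ∀ t : H ⊗[k] H, TensorProduct.lid k W
      (TensorProduct.map ε LinearMap.id (TensorProduct.map ι ι t)) =
      ι (TensorProduct.lid k H (LinearMap.rTensor H Coalgebra.counit t)) := by
    intro t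
    induction t with
    | zero => simp
    | add s t hs ht => simp only [map_add, hs, ht]
    | tmul a b => simp [h0]
  simp only [LinearMap.comp_apply, LinearEquiv.coe_coe, LinearMap.id_apply]
  rw [hΔ.Δ_ι, key, Coalgebra.rTensor_counit_comul, TensorProduct.lid_tmul, one_smul]

theorem IsDifferentialCalculus.inclusion_injective
    (hι : IsDifferentialCalculus (AlgData.of k H) E ι) :
    Function.Injective ((TensorProduct.mk k V W).flip E.one) := by
  obtain ⟨ε, h0, -⟩ := hι.exists_counit
  have h1 : ι 1 = E.one := hι.map_one
  refine Function.LeftInverse.injective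
    (g := TensorProduct.rid k V ∘ TensorProduct.map LinearMap.id ε) fun v => ?_
  simp [← h1, h0]

theorem IsDifferentialCalculus.baseForms_formCoaction
    (hι : IsDifferentialCalculus (AlgData.of k H) E ι)
    (hΔ : IsCoactionExtension (Coalgebra.comul : H →ₗ[k] H ⊗[k] H) E ι E ι Δ) :
    baseForms E (formCoaction V Δ) = LinearMap.range ((TensorProduct.mk k V W).flip E.one) := by
  obtain ⟨ε, h0, hn⟩ := hι.exists_counit
  refine le_antisymm (fun x hx => ?_) ?_
  · let Q : (V ⊗[k] W) ⊗[k] W →ₗ[k] V ⊗[k] W :=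
      TensorProduct.map ((TensorProduct.rid k V).toLinearMap ∘ₗ
        TensorProduct.map LinearMap.id ε) LinearMap.id
    have hQ : ∀ x, Q (formCoaction V Δ x) = x := by
      intro x
      induction x with
      | zero => simp
      | add s t hs ht => simp only [map_add, hs, ht]
      | tmul v w =>
        conv_rhs => rw [← hι.counit_Δ h0 hn hΔ w]
        rw [formCoaction_tmul]
        induction Δ w with
        | zero => simp
        | add s t hs ht => simp only [map_add, TensorProduct.tmul_add, hs, ht]
        | tmul y z => simp [Q, TensorProduct.smul_tmul]
    have hx' : formCoaction V Δ x = x ⊗ₜ E.one := hx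
    rw [← hQ x, hx']
    exact ⟨TensorProduct.rid k V (TensorProduct.map LinearMap.id ε x), by simp [Q]⟩
  · rintro _ ⟨v, rfl⟩
    change formCoaction V Δ (v ⊗ₜ E.one) = (v ⊗ₜ E.one) ⊗ₜ E.one
    rw [formCoaction_tmul, hΔ.isDGHom.map_one]
    rfl

end Complete

end CrossedCalculus

end

theorem mainTheorem12 {k H B V W : Type*} [Field k] [Ring H] [HopfAlgebra k H]
    [Ring B] [Algebra k B] [AddCommGroup V] [Module k V] [AddCommGroup W] [Module k W]
    -- a `σ`-twisted `H`-module structure on `B`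
    (T : TwistedModule k H B)
    -- a `σ`-twisted `H`-module differential calculus on `B`
    (D : DGData k V) (ιB : B →ₗ[k] V) (hD : IsDifferentialCalculus (AlgData.of k B) D ιB)
    (actV : H →ₗ[k] V →ₗ[k] V) (hactV : IsTwistedCalculus T D ιB actV)
    -- a bicovariant and complete differential calculus on `H`
    (E : DGData k W) (ιH : H →ₗ[k] W) (hE : IsDifferentialCalculus (AlgData.of k H) E ιH)
    (lco : W →ₗ[k] H ⊗[k] W) (rco : W →ₗ[k] W ⊗[k] H) (hbi : IsBicovariant E ιH lco rco)
    (hcomplete : IsCompleteCalculus (Coalgebra.comul : H →ₗ[k] H ⊗[k] H) E ιH E ιH) :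
    -- the crossed product calculus is a differential calculus on `B ♯_σ H`
    IsDifferentialCalculus T.crossedProduct (T.crossedCalculus D ιB actV E lco)
      (TensorProduct.map ιB ιH) ∧
    -- it is complete
    IsCompleteCalculus (crossedCoaction k H B) (T.crossedCalculus D ιB actV E lco)
      (TensorProduct.map ιB ιH) E ιH ∧
    -- its base space forms are `Ω(B) ⊗ 1`, also degree by degree
    (∀ Δ : V ⊗[k] W →ₗ[k] (V ⊗[k] W) ⊗[k] W,
      IsCoactionExtension (crossedCoaction k H B) (T.crossedCalculus D ιB actV E lco)
        (TensorProduct.map ιB ιH) E ιH Δ →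
      baseForms E Δ = LinearMap.range ((TensorProduct.mk k V W).flip E.one) ∧
      ∀ n, baseForms E Δ ⊓ (T.crossedCalculus D ιB actV E lco).deg n =
        (D.deg n).map ((TensorProduct.mk k V W).flip E.one)) ∧
    -- and `ω ↦ ω ⊗ 1` identifies them with `Ω(B)` as differential graded algebras over `B`
    Function.Injective ((TensorProduct.mk k V W).flip E.one) ∧
    IsDGHom D (T.crossedCalculus D ιB actV E lco) ((TensorProduct.mk k V W).flip E.one) ∧
    ∀ b : B, ιB b ⊗ₜ[k] E.one = TensorProduct.map ιB ιH (b ⊗ₜ[k] (1 : H)) := by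
  have hT := hactV.isTwistedDGA hD
  have hcalc := hD.crossedCalculus hactV hE hbi.left
  have hinj := hE.inclusion_injective (V := V)
  have hincl : IsDGHom D (T.crossedCalculus D ιB actV E lco)
      ((TensorProduct.mk k V W).flip E.one) := hbi.left.inclusion_isDGHom hT hE
  obtain ⟨ΔH, hΔH⟩ := hcomplete
  have hext : IsCoactionExtension (crossedCoaction k H B) (T.crossedCalculus D ιB actV E lco)
      (TensorProduct.map ιB ιH) E ιH (formCoaction V ΔH) :=
    ⟨hbi.left.formCoaction_isDGHom hT hE hΔH, formCoaction_extends hΔH⟩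
  have hone : ιH 1 = E.one := hE.map_one
  refine ⟨hcalc, ⟨_, hext⟩, fun Δ hΔ => ?_, hinj, hincl, fun b => ?_⟩
  -- Uniqueness of morphisms out of a calculus identifies an arbitrary extension with id ⊗ Δ.
  · obtain rfl : Δ = formCoaction V ΔH := hΔ.isDGHom.ext hcalc hext.isDGHom fun x =>
      (LinearMap.congr_fun hΔ.extends_coaction x).trans
        (LinearMap.congr_fun hext.extends_coaction x).symm
    rw [hE.baseForms_formCoaction hΔH]
    refine ⟨rfl, fun n => le_antisymm ?_ ?_⟩
    · rintro _ ⟨⟨v, rfl⟩, hv⟩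
      -- The degree of `v` is read off from v ⊗ 1, since ω ↦ ω ⊗ 1 is injective and graded.
      exact ⟨v, mem_deg_of_injective hD.isDGA.internal hcalc.isDGA.internal hinj hincl.map_deg hv,
        rfl⟩
    · rintro _ ⟨v, hv, rfl⟩
      exact ⟨⟨v, rfl⟩, hincl.map_deg n v hv⟩
  · rw [TensorProduct.map_tmul, hone]
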